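/- Let $b_1,b_2,b_3\in\mathbb R$ and consider real-valued solutions of $$\partial_t u-\partial_x^5u+b_1\,u\,\partial_x^3u+b_2\,\partial_xu\,\partial_x^2u+b_3\,u^2\,\partial_xu=0,\qquad x\in\mathbb R,\ t\in[0,T]\qquad(*)$$ (in the sense of distributions). Write $x_+=\max\{x,0\}$, let $\|\cdot\|_{m,2}$ be the norm of $H^m(\mathbb R)$ and $\|\cdot\|_2$ that of $L^2(\mathbb R)$. Let $a_0>0$, $0<\epsilon\le 1$, $T>0$, and let $$u_1\in C([0,T]:H^8(\mathbb R)\cap L^2(|x|^4dx)),\qquad u_2\in C([0,T]:H^4(\mathbb R)\cap L^2(|x|^2dx))$$ be two solutions of $(*)$ such that $$\Lambda:=\int_{-\infty}^{\infty}e^{a_0x_+^{5/4}}\,|u_1(x,0)-u_2(x,0)|^2\,dx<\infty .$$ Then $$\sup_{t\in[0,T]}\int_{-\infty}^{\infty}e^{a(t)\,x_+^{5/4}}\,|u_1(x,t)-u_2(x,t)|^2\,dx\le c^{**}<\infty,$$ where $$a(t)=\frac{a_0}{\sqrt[4]{1+k(\epsilon)\,a_0^4\,t}},\qquad k(\epsilon)=\frac{5^5}{4^5}\Big(\frac32+\frac{25}{4(5-\epsilon)}\Big).$$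 The constant $c^{**}$ is as follows. (i) For all bounds on the four norms $\|u_1(0)\|_{8,2}$, $\|u_2(0)\|_{4,2}$, $\|x^2u_1(0)\|_2$, $\|x\,u_2(0)\|_2$ of the initial data there is a time $T_0>0$, depending only on these bounds and on $b_1,b_2,b_3$, such that for $T\le T_0$ the constant $c^{**}$ can be chosen to depend only on $b_1,b_2,b_3$, $a_0$, $\epsilon$, $T$ and upper bounds for $\Lambda$ and for these four norms. (ii) For arbitrary $T>0$ (as long as the two solutions exist on $[0,T]$), the constant $c^{**}$ can be chosen to depend only on $b_1,b_2,b_3$, $a_0$, $\epsilon$, $T$ and upper bounds for $\Lambda$ and for $\sup_{[0,T]}\|u_1(t)\|_{8,2}$, $\sup_{[0,T]}\|u_2(t)\|_{4,2}$, $\sup_{[0,T]}\|x^2u_1(t)\|_2$, $\sup_{[0,T]}\|x\,u_2(t)\|_2$. -/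

import Mathlib

open MeasureTheory Set Filter Topology
open scoped NNReal ENNReal ContDiff

namespace FifthOrder

/-- `g` is the `j`-th weak (distributional) derivative of `f` on the real line. -/
def IsWeakDeriv (j : ℕ) (f g : ℝ → ℝ) : Prop :=
  LocallyIntegrable f ∧ LocallyIntegrable g ∧
    ∀ φ : ℝ → ℝ, ContDiff ℝ ∞ φ → HasCompactSupport φ →
      ∫ x, f x * iteratedDeriv j φ x = (-1) ^ j * ∫ x, g x * φ x

/-- Weak derivatives are unique up to null sets. -/
theorem IsWeakDeriv.ae_eq {j : ℕ} {f g h : ℝ → ℝ} (hg : IsWeakDeriv j f g)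
    (hh : IsWeakDeriv j f h) : g =ᵐ[volume] h := by
  refine ae_eq_of_integral_contDiff_smul_eq hg.2.1 hh.2.1 fun φ hφ hc => ?_
  have h1 := (hg.2.2 φ hφ hc).symm.trans (hh.2.2 φ hφ hc)
  have h2 : ((-1 : ℝ)) ^ j ≠ 0 := pow_ne_zero _ (by norm_num)
  simpa only [smul_eq_mul, mul_comm] using mul_left_cancel₀ h2 h1

open Classical in
/-- A representative of the `j`-th weak derivative of `f` (the zero function if there is none). -/
noncomputable def weakDeriv (j : ℕ) (f : ℝ → ℝ) : ℝ → ℝ :=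
  if h : ∃ g, IsWeakDeriv j f g then h.choose else 0

/-- `weakDeriv j f` is the weak derivative whenever one exists. -/
theorem IsWeakDeriv.weakDeriv_ae_eq {j : ℕ} {f g : ℝ → ℝ} (hg : IsWeakDeriv j f g) :
    weakDeriv j f =ᵐ[volume] g := by
  have h : ∃ g, IsWeakDeriv j f g := ⟨g, hg⟩
  have h1 : weakDeriv j f = h.choose := by
    unfold weakDeriv
    rw [dif_pos h]
  rw [h1]
  exact h.choose_spec.ae_eq hg

/-- Membership in the Sobolev space `H^m(ℝ)`. -/
def MemH (m : ℕ) (f : ℝ → ℝ) : Prop :=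
  MemLp f 2 ∧ ∀ j ≤ m, ∃ g : ℝ → ℝ, MemLp g 2 ∧ IsWeakDeriv j f g

/-- The norm of `H^m(ℝ)`: the square root of `∑_{j ≤ m} ‖∂ₓʲ f‖₂²` (for `f` in `H^m(ℝ)`). -/
noncomputable def sobolevNorm (m : ℕ) (f : ℝ → ℝ) : ℝ≥0∞ :=
  (∑ j ∈ Finset.range (m + 1), eLpNorm (weakDeriv j f) 2 volume ^ 2) ^ (1 / 2 : ℝ)

/-- The weighted norm `‖ |x|^k f ‖₂`, that is, the norm of `L²(|x|^{2k} dx)`. -/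
noncomputable def weightedNorm (k : ℕ) (f : ℝ → ℝ) : ℝ≥0∞ :=
  eLpNorm (fun x => |x| ^ k * f x) 2 volume

/-- `u ∈ C([0,T] : H^m(ℝ) ∩ L²(|x|^{2k} dx))`, where `u t x` is the value at time `t` and
position `x`. -/
def ContHWeighted (m k : ℕ) (T : ℝ) (u : ℝ → ℝ → ℝ) : Prop :=
  (∀ t ∈ Icc 0 T, MemH m (u t) ∧ MemLp (fun x => |x| ^ k * u t x) 2) ∧
    ∀ t ∈ Icc 0 T,
      Tendsto (fun s => sobolevNorm m (u s - u t)) (𝓝[Icc 0 T] t) (𝓝 0) ∧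
        Tendsto (fun s => weightedNorm k (u s - u t)) (𝓝[Icc 0 T] t) (𝓝 0)

/-- The nonlinear term `b₁ f ∂ₓ³f + b₂ ∂ₓf ∂ₓ²f + b₃ f² ∂ₓf`. -/
noncomputable def nonlinearTerm (b₁ b₂ b₃ : ℝ) (f : ℝ → ℝ) (x : ℝ) : ℝ :=
  b₁ * f x * weakDeriv 3 f x + b₂ * weakDeriv 1 f x * weakDeriv 2 f x +
    b₃ * f x ^ 2 * weakDeriv 1 f x

/-- `u` solves `∂ₜu - ∂ₓ⁵u + b₁ u ∂ₓ³u + b₂ ∂ₓu ∂ₓ²u + b₃ u² ∂ₓu = 0` on `[0,T]`: at each time,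
the equation holds in the sense of distributions in `x`. -/
def IsSolution (b₁ b₂ b₃ T : ℝ) (u : ℝ → ℝ → ℝ) : Prop :=
  ∀ φ : ℝ → ℝ, ContDiff ℝ ∞ φ → HasCompactSupport φ → ∀ t ∈ Icc 0 T,
    HasDerivWithinAt (fun s => ∫ x, u s x * φ x)
      (-(∫ x, u t x * iteratedDeriv 5 φ x) - ∫ x, nonlinearTerm b₁ b₂ b₃ (u t) x * φ x)
      (Icc 0 T) t

/-- The constant `k(ε) = (5⁵/4⁵) (3/2 + 25/(4(5-ε)))`. -/
noncomputable def kConst (ε : ℝ) : ℝ :=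
  5 ^ 5 / 4 ^ 5 * (3 / 2 + 25 / (4 * (5 - ε)))

/-- The decay rate `a(t) = a₀ / (1 + k(ε) a₀⁴ t)^{1/4}`. -/
noncomputable def decayRate (a₀ ε t : ℝ) : ℝ :=
  a₀ / (1 + kConst ε * a₀ ^ 4 * t) ^ (1 / 4 : ℝ)

/-- The integral `∫ e^{a x₊^{5/4}} |f(x)|² dx`, a value in `[0,∞]`. -/
noncomputable def expEnergy (a : ℝ) (f : ℝ → ℝ) : ℝ≥0∞ :=
  ∫⁻ x, ENNReal.ofReal (Real.exp (a * max x 0 ^ (5 / 4 : ℝ)) * |f x| ^ 2)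

end FifthOrder

open FifthOrder

/-! Let `w = u₁ - u₂` and `s = (u₁ + u₂) / 2`. The theorem is a weighted energy estimate for `w`
with weight `φ = exp (a(t) χ)`, where `χ` stands for `x₊^{5/4}`. Write `q = a χ'`. Integrating by
parts in `2 ∫ φ w ∂ₓ⁵w` and completing a square gives at most `9/16 ∫ φ q⁵ w² - ∫ φ q (∂ₓ²w)²` plus
terms of lower order (`hasDerivAt_flux`). The exponent `5/4` is the one for which `χ'⁵ = (5/4)⁵ χ`.
A decreasing `a` contributes `a' ∫ φ χ w²`, and `a' ≤ -(11/16)(5/4)⁵ a⁵` makes this at most `-11/16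
∫ φ q⁵ w²`. That pays for the `9/16` and leaves `1/8` for the lower-order terms. The given `a(t)`
satisfies `a' = -(k(ε)/4) a⁵`, and `k(ε)/4 ≥ (11/16)(5/4)⁵`.

The dangerous lower-order terms are those in `(∂ₓw)²` with coefficients of the size of `u` and
`∂ₓu`, for which the dispersion gives nothing directly. A large multiple of `B (∂ₓw)²`, `B = q² + q
+ b`, is subtracted and then restored through an integration by parts into `B w ∂ₓ²w` and `w²`
terms. The first of these is absorbed by `q (∂ₓ²w)²` as soon as `b² ≲ q`, where `b` bounds the
solutions and their first derivatives (`Jet.exists_far_bound`).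

The weight has to be truncated before it is known that the energy is finite. The slope of `x₊^{5/4}`
is capped by a decreasing function and the phase is smoothed; the inequality `χ'⁵ ≤ (5/4)⁵ χ`
survives both operations (`IsCap.phase_one_pow_five_le`). Two families of caps are used. With a cap
of order `1/x` at infinity, `exp (a χ)` grows at most like `⟨x⟩`, so `exp (a χ) w` is in `L²` by the
polynomial decay of the solutions. That decay also gives `u² + (∂ₓu)² ≲ 1/⟨x⟩`, which is exactly `b²
≲ q`. Letting the cap tend to infinity proves finiteness with an uncontrolled constant
(`exists_expEnergy_bound`). With constant caps, `χ` grows linearly and even the doubled weight is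
admissible by the first pass; now `χ'` is bounded below far out, a constant `b` will do, and the
final constant involves the solutions only through a bound in `H²` (`exists_constant`).

For short times the `H²` bound follows from the data. In the evolution of `∫ (∂ₓ²u)²` the term `(b₁
+ 2b₂) ∂ₓu (∂ₓ³u)²` loses a derivative; it is cancelled by adding `c u (∂ₓu)²` with `5c = b₁ + 2b₂`
(`SmoothEvolution.modified_energy_growth`), and a continuity argument closes the bound
(`exists_time_sobolev_bound`).

All the computations are made on spatial mollifications of the solutions. These are smooth and
satisfy the equation up to an `L²` error of the size of the kernel's width
(`H4Bound.mollified_error`). The error disappears in the limit, which is taken by Fatou's lemma, so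
quantities that multiply it need only be finite. -/

namespace FifthOrder

/-! ### Mollifiers and convolution estimates -/

/-- A smooth, even, nonnegative kernel of mass one that vanishes off `(-δ, δ)`. -/
structure IsMollifier (δ : ℝ) (η : ℝ → ℝ) : Prop where
  pos : 0 < δ
  smooth : ContDiff ℝ ∞ η
  nonneg : ∀ x, 0 ≤ η x
  zero : ∀ x, δ ≤ |x| → η x = 0
  even : ∀ x, η (-x) = η x
  integral : ∫ x, η x = 1

/-- The convolution `η * f`. -/
noncomputable def cv (η f : ℝ → ℝ) (x : ℝ) : ℝ := ∫ y, η (x - y) * f y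

theorem cv_eq_convolution (η f : ℝ → ℝ) :
    cv η f = convolution η f (ContinuousLinearMap.lsmul ℝ ℝ) volume := by
  ext x
  rw [convolution_eq_swap]
  rfl

theorem IsMollifier.hasCompactSupport {δ : ℝ} {η : ℝ → ℝ} (h : IsMollifier δ η) :
    HasCompactSupport η := by
  refine HasCompactSupport.intro (isCompact_closedBall (0 : ℝ) δ) fun x hx => h.zero x ?_
  simp only [Metric.mem_closedBall, dist_zero_right, Real.norm_eq_abs, not_le] at hx
  exact hx.le

theorem hasCompactSupport_iteratedDeriv {η : ℝ → ℝ} (h : HasCompactSupport η) (j : ℕ) :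
    HasCompactSupport (iteratedDeriv j η) := by
  induction j with
  | zero => simpa using h
  | succ n ih => rw [iteratedDeriv_succ]; exact ih.deriv

theorem contDiff_iteratedDeriv {η : ℝ → ℝ} (h : ContDiff ℝ ∞ η) (j : ℕ) :
    ContDiff ℝ ∞ (iteratedDeriv j η) := by
  induction j with
  | zero => simpa using h
  | succ n ih =>
    rw [iteratedDeriv_succ]
    exact (contDiff_infty_iff_deriv.1 ih).2

theorem IsMollifier.iteratedDeriv_zero_of_le {δ : ℝ} {η : ℝ → ℝ} (h : IsMollifier δ η) (j : ℕ) :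
    ∀ x, δ < |x| → iteratedDeriv j η x = 0 := by
  intro x hx
  have h1 : η =ᶠ[𝓝 x] fun _ => 0 := by
    have : {y : ℝ | δ < |y|} ∈ 𝓝 x := (isOpen_lt continuous_const continuous_abs).mem_nhds hx
    filter_upwards [this] with y hy
    exact h.zero y (le_of_lt hy)
  have h2 := h1.iteratedDeriv_eq j
  rw [h2]
  rcases j with _ | j
  · simp
  · simp

theorem cv_hasDerivAt {η f : ℝ → ℝ} (hη : ContDiff ℝ ∞ η) (hc : HasCompactSupport η)
    (hf : LocallyIntegrable f) (j : ℕ) (x : ℝ) :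
    HasDerivAt (cv (iteratedDeriv j η) f) (cv (iteratedDeriv (j + 1) η) f x) x := by
  rw [cv_eq_convolution, cv_eq_convolution, iteratedDeriv_succ]
  exact (hasCompactSupport_iteratedDeriv hc j).hasDerivAt_convolution_left _
    ((contDiff_iteratedDeriv hη j).of_le (by exact_mod_cast le_top)) hf x

/-- The test function is the reflected kernel `y ↦ iteratedDeriv i η (x - y)`. Its `j`-th derivative
carries the factor `(-1) ^ j`, which cancels the sign in the definition of a weak derivative. -/
theorem cv_weakDeriv {η f g : ℝ → ℝ} (hη : ContDiff ℝ ∞ η) (hc : HasCompactSupport η) {j : ℕ}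
    (h : IsWeakDeriv j f g) (i : ℕ) :
    cv (iteratedDeriv (i + j) η) f = cv (iteratedDeriv i η) g := by
  ext x
  have h1 := h.2.2 (fun y => iteratedDeriv i η (x - y))
    ((contDiff_iteratedDeriv hη i).comp (contDiff_const.sub contDiff_id))
    ((hasCompactSupport_iteratedDeriv hc i).comp_homeomorph (Homeomorph.subLeft x))
  have h2 : iteratedDeriv j (iteratedDeriv i η) = iteratedDeriv (i + j) η := by
    rw [iteratedDeriv_eq_iterate, iteratedDeriv_eq_iterate, iteratedDeriv_eq_iterate, add_comm i j,
      Function.iterate_add_apply]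
  rw [iteratedDeriv_comp_const_sub, h2] at h1
  have h3 : ((-1 : ℝ)) ^ j ≠ 0 := pow_ne_zero _ (by norm_num)
  apply mul_left_cancel₀ h3
  unfold cv
  rw [← integral_const_mul]
  refine Eq.trans ?_ (h1.trans ?_)
  · refine integral_congr_ae (Eventually.of_forall fun y => ?_)
    simp only [smul_eq_mul]
    ring
  · congr 1
    refine integral_congr_ae (Eventually.of_forall fun y => ?_)
    ring

theorem integrable_kernel_mul {k f : ℝ → ℝ} (hk : Continuous k) (hc : HasCompactSupport k)
    (hf : LocallyIntegrable f) (x : ℝ) : Integrable fun y => k (x - y) * f y := by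
  have h1 : HasCompactSupport fun y => k (x - y) := hc.comp_homeomorph (Homeomorph.subLeft x)
  have h2 : Continuous fun y => k (x - y) := hk.comp (continuous_const.sub continuous_id)
  simpa [mul_comm] using hf.integrable_smul_right_of_hasCompactSupport h2 h1

theorem sq_integral_mul_le {f g : ℝ → ℝ} (hf : MemLp f 2) (hg : MemLp g 2) :
    (∫ x, f x * g x) ^ 2 ≤ (∫ x, f x ^ 2) * ∫ x, g x ^ 2 := by
  have hfg : Integrable fun x => f x * g x := hf.integrable_mul hg
  have hf2 : Integrable fun x => f x ^ 2 := hf.integrable_sq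
  have hg2 : Integrable fun x => g x ^ 2 := hg.integrable_sq
  have key : ∀ c : ℝ, 0 ≤ (∫ x, f x ^ 2) * (c * c) + (-2 * ∫ x, f x * g x) * c + ∫ x, g x ^ 2 := by
    intro c
    have h0 : 0 ≤ ∫ x, (c * f x - g x) ^ 2 := integral_nonneg fun x => sq_nonneg _
    have h1 : ∫ x, (c * f x - g x) ^ 2
        = (∫ x, f x ^ 2) * (c * c) + (-2 * ∫ x, f x * g x) * c + ∫ x, g x ^ 2 := by
      have i1 := hf2.mul_const (c * c)
      have i2 := hfg.mul_const (-2 * c)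
      have i12 : Integrable fun x => f x ^ 2 * (c * c) + (f x * g x) * (-2 * c) := i1.add i2
      have : (fun x => (c * f x - g x) ^ 2)
          = fun x => (f x ^ 2 * (c * c) + (f x * g x) * (-2 * c)) + g x ^ 2 := by ext x; ring
      rw [this, integral_add i12 hg2, integral_add i1 i2, integral_mul_const, integral_mul_const]
      ring
    linarith
  have := discrim_le_zero key
  unfold discrim at this
  nlinarith

/-- Cauchy–Schwarz with respect to the measure `|k (x - y)| dy`, obtained by splitting the kernel
into two square roots. -/
theorem cv_sq_le {k f : ℝ → ℝ} (hk : Continuous k) (hc : HasCompactSupport k)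
    (hf : MemLp f 2) (x : ℝ) :
    cv k f x ^ 2 ≤ (∫ y, |k y|) * cv (fun y => |k y|) (fun y => f y ^ 2) x := by
  have hfl : LocallyIntegrable f := hf.locallyIntegrable (by norm_num)
  have hf2 : LocallyIntegrable fun y => f y ^ 2 := hf.integrable_sq.locallyIntegrable
  have hka : Continuous fun y => |k y| := hk.abs
  have hca : HasCompactSupport fun y => |k y| := hc.comp_left (g := fun r : ℝ => |r|) abs_zero
  have hks : Continuous fun y => k (x - y) := hk.comp (continuous_const.sub continuous_id)
  have i1 : Integrable fun y => |k (x - y)| :=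
    (hka.integrable_of_hasCompactSupport hca).comp_sub_left x
  have i2 : Integrable fun y => |k (x - y)| * f y ^ 2 := integrable_kernel_mul hka hca hf2 x
  have m1 : MemLp (fun y => Real.sqrt |k (x - y)|) 2 := by
    rw [memLp_two_iff_integrable_sq hks.abs.sqrt.aestronglyMeasurable]
    simpa [Real.sq_sqrt] using i1
  have m2 : MemLp (fun y => Real.sqrt |k (x - y)| * |f y|) 2 := by
    have hm : AEStronglyMeasurable (fun y => Real.sqrt |k (x - y)| * |f y|) volume :=
      hks.abs.sqrt.aestronglyMeasurable.mul hf.1.norm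
    rw [memLp_two_iff_integrable_sq hm]
    simpa [mul_pow, Real.sq_sqrt] using i2
  have h := sq_integral_mul_le m1 m2
  have e1 : (fun y => Real.sqrt |k (x - y)| * (Real.sqrt |k (x - y)| * |f y|))
      = fun y => |k (x - y) * f y| := by
    ext y
    rw [← mul_assoc, Real.mul_self_sqrt (abs_nonneg _), abs_mul]
  rw [e1] at h
  have e2 : (∫ y, Real.sqrt |k (x - y)| ^ 2) = ∫ y, |k y| := by
    simp only [Real.sq_sqrt (abs_nonneg _)]
    exact integral_sub_left_eq_self (fun y => |k y|) volume x
  have e3 : (fun y => (Real.sqrt |k (x - y)| * |f y|) ^ 2) = fun y => |k (x - y)| * f y ^ 2 := by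
    ext y
    rw [mul_pow, Real.sq_sqrt (abs_nonneg _), sq_abs]
  rw [e2, e3] at h
  refine le_trans ?_ h
  rw [← sq_abs]
  gcongr
  exact abs_integral_le_integral_abs

theorem cv_continuous {k f : ℝ → ℝ} (hk : Continuous k) (hc : HasCompactSupport k)
    (hf : LocallyIntegrable f) : Continuous (cv k f) := by
  rw [cv_eq_convolution]
  exact hc.continuous_convolution_left _ hk hf

theorem cv_memLp {k f : ℝ → ℝ} (hk : Continuous k) (hc : HasCompactSupport k)
    (hf : MemLp f 2) :
    MemLp (cv k f) 2 ∧ ∫ x, cv k f x ^ 2 ≤ (∫ y, |k y|) ^ 2 * ∫ x, f x ^ 2 := by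
  have hfl : LocallyIntegrable f := hf.locallyIntegrable (by norm_num)
  have hka : Continuous fun y => |k y| := hk.abs
  have hca : HasCompactSupport fun y => |k y| := hc.comp_left (g := fun r : ℝ => |r|) abs_zero
  have hki : Integrable fun y => |k y| := hka.integrable_of_hasCompactSupport hca
  have hcont := cv_continuous hk hc hfl
  have i1 : Integrable (cv (fun y => |k y|) (fun y => f y ^ 2)) := by
    rw [cv_eq_convolution]
    exact hki.integrable_convolution _ hf.integrable_sq
  have i2 : Integrable fun x => cv k f x ^ 2 := by
    refine (i1.const_mul (∫ y, |k y|)).mono' (hcont.pow 2).aestronglyMeasurable ?_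
    refine Eventually.of_forall fun x => ?_
    rw [Real.norm_of_nonneg (sq_nonneg _)]
    exact cv_sq_le hk hc hf x
  refine ⟨(memLp_two_iff_integrable_sq hcont.aestronglyMeasurable).2 i2, ?_⟩
  calc ∫ x, cv k f x ^ 2
      ≤ ∫ x, (∫ y, |k y|) * cv (fun y => |k y|) (fun y => f y ^ 2) x :=
        integral_mono i2 (i1.const_mul _) fun x => cv_sq_le hk hc hf x
    _ = (∫ y, |k y|) ^ 2 * ∫ x, f x ^ 2 := by
        rw [integral_const_mul, cv_eq_convolution, integral_convolution _ hki hf.integrable_sq]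
        simp only [ContinuousLinearMap.lsmul_apply, smul_eq_mul]
        ring

/-- Weighted `L²` bound for a convolution, for weights varying slowly on the kernel's support. -/
theorem cv_memLp_weight {k f φ : ℝ → ℝ} {δ Λ : ℝ} (hk : Continuous k) (hc : HasCompactSupport k)
    (hz : ∀ x, δ < |x| → k x = 0) (hφc : Continuous φ) (hφ : ∀ x, 0 ≤ φ x)
    (hφΛ : ∀ x y, |x - y| ≤ δ → φ x ≤ Λ * φ y)
    (hf : LocallyIntegrable f) (hφf : MemLp (fun x => φ x * f x) 2) :
    MemLp (fun x => φ x * cv k f x) 2 ∧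
      ∫ x, (φ x * cv k f x) ^ 2 ≤ Λ ^ 2 * (∫ y, |k y|) ^ 2 * ∫ x, (φ x * f x) ^ 2 := by
  have hka : Continuous fun y => |k y| := hk.abs
  have hca : HasCompactSupport fun y => |k y| := hc.comp_left (g := fun r : ℝ => |r|) abs_zero
  have hφf' : MemLp (fun x => |φ x * f x|) 2 := hφf.norm
  obtain ⟨h1, h2⟩ := cv_memLp hka hca hφf'
  -- On the kernel's support `φ x ≤ Λ φ y`, so the weight can be moved inside the convolution at the
  -- price of `Λ`. What remains is the unweighted bound for `|k| * |φ f|`.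
  have key : ∀ x, |φ x * cv k f x| ≤ Λ * cv (fun y => |k y|) (fun x => |φ x * f x|) x := by
    intro x
    unfold cv
    rw [← integral_const_mul, ← integral_const_mul]
    refine (abs_integral_le_integral_abs).trans (integral_mono ?_ ?_ fun y => ?_)
    · exact ((integrable_kernel_mul hk hc hf x).const_mul _).abs
    · exact (integrable_kernel_mul hka hca (hφf'.locallyIntegrable (by norm_num)) x).const_mul _
    · simp only [abs_mul, abs_of_nonneg (hφ _)]
      by_cases hxy : |x - y| ≤ δ
      · have := hφΛ x y hxy
        calc φ x * (|k (x - y)| * |f y|) ≤ (Λ * φ y) * (|k (x - y)| * |f y|) := by gcongr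
          _ = _ := by ring
      · rw [hz _ (not_le.1 hxy)]; simp
  have hm : AEStronglyMeasurable (fun x => φ x * cv k f x) volume :=
    (hφc.mul (cv_continuous hk hc hf)).aestronglyMeasurable
  have key2 : ∀ x, (φ x * cv k f x) ^ 2 ≤
      Λ ^ 2 * cv (fun y => |k y|) (fun x => |φ x * f x|) x ^ 2 := by
    intro x
    rw [← sq_abs, ← mul_pow]
    gcongr
    exact key x
  have i1 : Integrable fun x => (φ x * cv k f x) ^ 2 := by
    refine (h1.integrable_sq.const_mul (Λ ^ 2)).mono' (hm.pow 2) (Eventually.of_forall fun x => ?_)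
    rw [Real.norm_of_nonneg (sq_nonneg _)]
    exact key2 x
  refine ⟨(memLp_two_iff_integrable_sq hm).2 i1, ?_⟩
  refine (integral_mono i1 (h1.integrable_sq.const_mul (Λ ^ 2)) key2).trans ?_
  rw [integral_const_mul, mul_assoc]
  gcongr
  simpa only [sq_abs, abs_abs] using h2

/-- A sequence of bump functions shrinking to the origin. -/
noncomputable def bump (n : ℕ) : ContDiffBump (0 : ℝ) :=
  ⟨1 / (2 * (n + 1)), 1 / (n + 1), by positivity, by
    apply one_div_lt_one_div_of_lt
    · positivity
    · have : (0 : ℝ) ≤ n := n.cast_nonneg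
      linarith⟩

/-- The associated sequence of mollifiers. -/
noncomputable def moll (n : ℕ) : ℝ → ℝ := (bump n).normed volume

theorem moll_isMollifier (n : ℕ) : IsMollifier (1 / (n + 1)) (moll n) where
  pos := by positivity
  smooth := (bump n).contDiff_normed
  nonneg := (bump n).nonneg_normed
  zero x hx := by
    have h : x ∉ Function.support ((bump n).normed volume) := by
      rw [(bump n).support_normed_eq]
      simpa [bump] using hx
    exact Function.notMem_support.1 h
  even := (bump n).normed_neg
  integral := (bump n).integral_normed

theorem ae_tendsto_cv_moll {f : ℝ → ℝ} (hf : LocallyIntegrable f) :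
    ∀ᵐ x, Tendsto (fun n => cv (moll n) f x) atTop (𝓝 (f x)) := by
  have h := ContDiffBump.ae_convolution_tendsto_right_of_locallyIntegrable
    (φ := bump) (l := atTop) (K := 2) (μ := volume) (g := f) ?_ ?_ hf
  · filter_upwards [h] with x hx
    simpa only [cv_eq_convolution, moll] using hx
  · exact tendsto_one_div_add_atTop_nhds_zero_nat
  · refine Eventually.of_forall fun n => ?_
    simp only [bump]
    rw [mul_one_div, ← div_div, div_self two_ne_zero]

theorem IsMollifier.integral_abs {δ : ℝ} {η : ℝ → ℝ} (h : IsMollifier δ η) : ∫ y, |η y| = 1 := by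
  simp only [abs_of_nonneg (h.nonneg _), h.integral]

theorem IsMollifier.cv_const {δ : ℝ} {η : ℝ → ℝ} (h : IsMollifier δ η) (c x : ℝ) :
    cv η (fun _ => c) x = c := by
  unfold cv
  rw [integral_mul_const, integral_sub_left_eq_self η volume x, h.integral, one_mul]

theorem IsMollifier.cv_mono {δ : ℝ} {η f g : ℝ → ℝ} (h : IsMollifier δ η)
    (hf : LocallyIntegrable f) (hg : LocallyIntegrable g) (x : ℝ)
    (hfg : ∀ y, |x - y| < δ → f y ≤ g y) : cv η f x ≤ cv η g x := by
  refine integral_mono (integrable_kernel_mul h.smooth.continuous h.hasCompactSupport hf x)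
    (integrable_kernel_mul h.smooth.continuous h.hasCompactSupport hg x) fun y => ?_
  by_cases hy : |x - y| < δ
  · exact mul_le_mul_of_nonneg_left (hfg y hy) (h.nonneg _)
  · simp [h.zero _ (not_lt.1 hy)]

/-! ### One-dimensional Sobolev and interpolation inequalities -/

theorem abs_le_integral_abs_deriv {F F' : ℝ → ℝ} (h : ∀ x, HasDerivAt F (F' x) x)
    (hF : Integrable F) (hF' : Integrable F') (x : ℝ) : |F x| ≤ ∫ y, |F' y| := by
  have h1 : Tendsto F atBot (𝓝 0) :=
    tendsto_zero_of_hasDerivAt_of_integrableOn_Iic (a := 0) (fun y _ => h y)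
      hF'.integrableOn hF.integrableOn
  have h2 := integral_Iic_of_hasDerivAt_of_tendsto' (a := x) (fun y _ => h y) hF'.integrableOn h1
  rw [sub_zero] at h2
  rw [← h2]
  exact abs_integral_le_integral_abs.trans
    (setIntegral_le_integral hF'.abs (Eventually.of_forall fun y => abs_nonneg _))

theorem integral_abs_mul_le {f g : ℝ → ℝ} (hf : MemLp f 2) (hg : MemLp g 2) :
    2 * ∫ x, |f x * g x| ≤ (∫ x, f x ^ 2) + ∫ x, g x ^ 2 := by
  rw [← integral_add hf.integrable_sq hg.integrable_sq, ← integral_const_mul]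
  refine integral_mono ((hf.integrable_mul hg).abs.const_mul 2)
    (hf.integrable_sq.add hg.integrable_sq) fun x => ?_
  simp only [abs_mul]
  nlinarith [sq_nonneg (|f x| - |g x|), sq_abs (f x), sq_abs (g x)]

theorem hasDerivAt_continuous {f f' : ℝ → ℝ} (h : ∀ x, HasDerivAt f (f' x) x) : Continuous f :=
  continuous_iff_continuousAt.2 fun x => (h x).continuousAt

theorem sq_le_integral {f f' : ℝ → ℝ} (h : ∀ x, HasDerivAt f (f' x) x)
    (hf : MemLp f 2) (hf' : MemLp f' 2) (x : ℝ) :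
    f x ^ 2 ≤ (∫ x, f x ^ 2) + ∫ x, f' x ^ 2 := by
  have h1 : ∀ x, HasDerivAt (fun y => f y ^ 2) (2 * (f x * f' x)) x := fun x => by
    refine ((h x).pow 2).congr_deriv ?_
    push_cast; ring
  have h2 := abs_le_integral_abs_deriv h1 hf.integrable_sq ((hf.integrable_mul hf').const_mul 2) x
  have h3 := integral_abs_mul_le hf hf'
  simp only [abs_mul, abs_two] at h2
  rw [integral_const_mul] at h2
  simp only [abs_mul] at h3
  linarith [le_abs_self (f x ^ 2)]

theorem integral_deriv_sq {f f' f'' : ℝ → ℝ} (h : ∀ x, HasDerivAt f (f' x) x)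
    (h' : ∀ x, HasDerivAt f' (f'' x) x) (hf : MemLp f 2) (hf' : MemLp f' 2) (hf'' : MemLp f'' 2) :
    ∫ x, f' x ^ 2 = -∫ x, f x * f'' x := by
  have h1 : ∀ x, HasDerivAt (fun y => f y * f' y) (f' x ^ 2 + f x * f'' x) x := fun x =>
    ((h x).fun_mul (h' x)).congr_deriv (by ring)
  have hi : Integrable fun x => f x * f'' x := hf.integrable_mul hf''
  have h2 := integral_eq_zero_of_hasDerivAt_of_integrable h1
    (hf'.integrable_sq.add hi) (hf.integrable_mul hf')
  rw [integral_add hf'.integrable_sq hi] at h2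
  exact eq_neg_of_add_eq_zero_left h2

theorem integral_deriv_sq_le {f f' f'' : ℝ → ℝ} (h : ∀ x, HasDerivAt f (f' x) x)
    (h' : ∀ x, HasDerivAt f' (f'' x) x) (hf : MemLp f 2) (hf' : MemLp f' 2) (hf'' : MemLp f'' 2) :
    2 * ∫ x, f' x ^ 2 ≤ (∫ x, f x ^ 2) + ∫ x, f'' x ^ 2 := by
  rw [integral_deriv_sq h h' hf hf' hf'']
  refine le_trans ?_ (integral_abs_mul_le hf hf'')
  have := neg_abs_le (∫ x, f x * f'' x)
  have h2 : |∫ x, f x * f'' x| ≤ ∫ x, |f x * f'' x| := abs_integral_le_integral_abs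
  linarith

theorem integral_deriv_sq_sq_le {f f' f'' : ℝ → ℝ} (h : ∀ x, HasDerivAt f (f' x) x)
    (h' : ∀ x, HasDerivAt f' (f'' x) x) (hf : MemLp f 2) (hf' : MemLp f' 2) (hf'' : MemLp f'' 2) :
    (∫ x, f' x ^ 2) ^ 2 ≤ (∫ x, f x ^ 2) * ∫ x, f'' x ^ 2 := by
  rw [integral_deriv_sq h h' hf hf' hf'', neg_sq]
  exact sq_integral_mul_le hf hf''

/-! ### Spatial cutoff and an abstract Gronwall inequality -/

/-- The bump function used as a spatial cutoff. -/
noncomputable def cutoffBump : ContDiffBump (0 : ℝ) := ⟨1, 2, one_pos, one_lt_two⟩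

/-- The cutoff to `[-2R, 2R]`. -/
noncomputable def cutoff (R x : ℝ) : ℝ := cutoffBump (R⁻¹ * x)

theorem cutoff_continuous (R : ℝ) : Continuous (cutoff R) :=
  cutoffBump.continuous.comp (continuous_const.mul continuous_id)

theorem cutoff_nonneg (R x : ℝ) : 0 ≤ cutoff R x := cutoffBump.nonneg
theorem cutoff_le_one (R x : ℝ) : cutoff R x ≤ 1 := cutoffBump.le_one

theorem cutoff_hasCompactSupport {R : ℝ} (hR : 0 < R) : HasCompactSupport (cutoff R) :=
  cutoffBump.hasCompactSupport.comp_homeomorph (Homeomorph.mulLeft₀ R⁻¹ (inv_ne_zero hR.ne'))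

theorem cutoff_hasDerivAt (R x : ℝ) :
    HasDerivAt (cutoff R) (R⁻¹ * deriv cutoffBump (R⁻¹ * x)) x := by
  have h1 : HasDerivAt (cutoffBump : ℝ → ℝ) (deriv cutoffBump (R⁻¹ * x)) (R⁻¹ * x) :=
    ((cutoffBump.contDiff (n := 1)).differentiable (by norm_num) _).hasDerivAt
  have h2 : HasDerivAt (fun y : ℝ => R⁻¹ * y) R⁻¹ x := by
    simpa using (hasDerivAt_id x).const_mul R⁻¹
  exact (h1.comp x h2).congr_deriv (by ring)

theorem exists_bound_deriv_cutoffBump : ∃ C, 0 ≤ C ∧ ∀ x, |deriv cutoffBump x| ≤ C := by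
  have hc : Continuous (deriv cutoffBump) :=
    (cutoffBump.contDiff (n := 1)).continuous_deriv le_rfl
  obtain ⟨C, hC⟩ := hc.bounded_above_of_compact_support cutoffBump.hasCompactSupport.deriv
  exact ⟨C, (norm_nonneg _).trans (hC 0), fun x => hC x⟩

theorem cutoff_tendsto (x : ℝ) : Tendsto (fun n : ℕ => cutoff (n + 1) x) atTop (𝓝 1) := by
  refine tendsto_const_nhds.congr' ?_
  filter_upwards [eventually_ge_atTop ⌈|x|⌉₊] with n hn
  symm
  unfold cutoff
  apply cutoffBump.one_of_mem_closedBall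
  have h1 : |x| ≤ n := (Nat.le_ceil _).trans (by exact_mod_cast hn)
  have h2 : (0 : ℝ) < n + 1 := by positivity
  simp only [cutoffBump, Metric.mem_closedBall, dist_zero_right, Real.norm_eq_abs, abs_mul,
    abs_inv, abs_of_pos h2]
  rw [inv_mul_le_iff₀ h2]
  linarith

theorem integrable_cutoff_mul {R : ℝ} (hR : 0 < R) {f : ℝ → ℝ} (hf : Continuous f) :
    Integrable fun x => cutoff R x * f x :=
  ((cutoff_continuous R).mul hf).integrable_of_hasCompactSupport
    ((cutoff_hasCompactSupport hR).mul_right)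

/-- Integration by parts against the cutoff. -/
theorem abs_integral_cutoff_mul_deriv_le {C R : ℝ} (hR : 0 < R)
    (hC : ∀ x, |deriv cutoffBump x| ≤ C) {G Gx : ℝ → ℝ} (hG : ∀ x, HasDerivAt G (Gx x) x)
    (hGx : Continuous Gx) (hGi : Integrable G) :
    |∫ x, cutoff R x * Gx x| ≤ R⁻¹ * C * ∫ x, |G x| := by
  have hGc := hasDerivAt_continuous hG
  have hb : ∀ x, |R⁻¹ * deriv cutoffBump (R⁻¹ * x)| ≤ R⁻¹ * C := fun x => by
    rw [abs_mul, abs_of_pos (inv_pos.2 hR)]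
    exact mul_le_mul_of_nonneg_left (hC _) (inv_pos.2 hR).le
  have hm : Continuous fun x => R⁻¹ * deriv cutoffBump (R⁻¹ * x) :=
    continuous_const.mul (((cutoffBump.contDiff (n := 1)).continuous_deriv le_rfl).comp
      (continuous_const.mul continuous_id))
  have i2 : Integrable fun x => R⁻¹ * deriv cutoffBump (R⁻¹ * x) * G x :=
    hGi.bdd_mul hm.aestronglyMeasurable (Eventually.of_forall hb)
  have h := integral_mul_deriv_eq_deriv_mul_of_integrable (u := cutoff R) (v := G)
    (fun x _ => cutoff_hasDerivAt R x) (fun x _ => hG x) (integrable_cutoff_mul hR hGx) i2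
    (integrable_cutoff_mul hR hGc)
  rw [h, abs_neg]
  refine abs_integral_le_integral_abs.trans ?_
  rw [← integral_const_mul]
  refine integral_mono i2.abs (hGi.abs.const_mul _) fun x => ?_
  simp only
  rw [abs_mul]
  exact mul_le_mul_of_nonneg_right (hb x) (abs_nonneg _)

/-- The cutoff makes differentiation under the integral sign legitimate with a majorant `Cb` that is
merely continuous. Its cost is the flux term, which falls on the derivative of the cutoff and is at
most `R⁻¹ C ∫ |G|`. Hence `CG` need only be finite: it disappears as `R → ∞`. -/
theorem integral_le_of_evolution_cutoff {T K₁ K₂ CG C R : ℝ} (hR : 0 < R) (hK₁ : 0 ≤ K₁)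
    (hK₂ : 0 ≤ K₂) (hC0 : 0 ≤ C) (hC : ∀ x, |deriv cutoffBump x| ≤ C)
    {Ψ Ψt G Gx S : ℝ → ℝ → ℝ} {Cb : ℝ → ℝ} (hCb : Continuous Cb)
    (hΨ : ∀ t ∈ Icc 0 T, Continuous (Ψ t)) (hΨt : ∀ t ∈ Icc 0 T, Continuous (Ψt t))
    (hb : ∀ t ∈ Icc 0 T, ∀ x, |Ψ t x| ≤ Cb x ∧ |Ψt t x| ≤ Cb x)
    (hd : ∀ t ∈ Icc 0 T, ∀ x, HasDerivWithinAt (fun s => Ψ s x) (Ψt t x) (Icc 0 T) t)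
    (hG : ∀ t ∈ Icc 0 T, ∀ x, HasDerivAt (G t) (Gx t x) x)
    (hGx : ∀ t ∈ Icc 0 T, Continuous (Gx t))
    (hGi : ∀ t ∈ Icc 0 T, Integrable (G t) ∧ ∫ x, |G t x| ≤ CG)
    (hS : ∀ t ∈ Icc 0 T, Integrable (S t) ∧ ∫ x, |S t x| ≤ K₂)
    (hineq : ∀ t ∈ Icc 0 T, ∀ x, Ψt t x + Gx t x ≤ K₁ * Ψ t x + S t x) :
    ∀ t ∈ Icc 0 T, ∫ x, cutoff R x * Ψ t x ≤
      Real.exp (K₁ * t) * ((∫ x, cutoff R x * Ψ 0 x) + (K₂ + R⁻¹ * C * CG) * t) := by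
  intro t ht
  have h0 : (0 : ℝ) ∈ Icc 0 T := ⟨le_rfl, ht.1.trans ht.2⟩
  have hCG : 0 ≤ CG := (integral_nonneg fun x => abs_nonneg _).trans (hGi 0 h0).2
  set F : ℝ → ℝ := fun s => ∫ x, cutoff R x * Ψ s x with hF
  set F' : ℝ → ℝ := fun s => ∫ x, cutoff R x * Ψt s x with hF'
  have hbi : Integrable fun x => cutoff R x * Cb x := integrable_cutoff_mul hR hCb
  have hFc : ContinuousOn F (Icc 0 T) := by
    refine continuousOn_of_dominated (bound := fun x => cutoff R x * Cb x) ?_ ?_ hbi ?_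
    · exact fun s hs => (integrable_cutoff_mul hR (hΨ s hs)).aestronglyMeasurable
    · refine fun s hs => Eventually.of_forall fun x => ?_
      rw [Real.norm_eq_abs, abs_mul, abs_of_nonneg (cutoff_nonneg R x)]
      exact mul_le_mul_of_nonneg_left (hb s hs x).1 (cutoff_nonneg R x)
    · exact Eventually.of_forall fun x s hs =>
        ((hd s hs x).continuousWithinAt).const_smul (cutoff R x)
  have hFd : ∀ s ∈ Ioo 0 T, HasDerivAt F (F' s) s := by
    intro s hs
    have hn : Ioo 0 T ∈ 𝓝 s := Ioo_mem_nhds hs.1 hs.2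
    refine (hasDerivAt_integral_of_dominated_loc_of_deriv_le (s := Ioo 0 T)
      (F := fun s x => cutoff R x * Ψ s x) (F' := fun s x => cutoff R x * Ψt s x)
      (bound := fun x => cutoff R x * Cb x) hn ?_ ?_ ?_ ?_ hbi ?_).2
    · filter_upwards [hn] with r hr
      exact (integrable_cutoff_mul hR (hΨ r (Ioo_subset_Icc_self hr))).aestronglyMeasurable
    · exact integrable_cutoff_mul hR (hΨ s (Ioo_subset_Icc_self hs))
    · exact (integrable_cutoff_mul hR (hΨt s (Ioo_subset_Icc_self hs))).aestronglyMeasurable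
    · refine Eventually.of_forall fun x r hr => ?_
      rw [Real.norm_eq_abs, abs_mul, abs_of_nonneg (cutoff_nonneg R x)]
      exact mul_le_mul_of_nonneg_left (hb r (Ioo_subset_Icc_self hr) x).2 (cutoff_nonneg R x)
    · refine Eventually.of_forall fun x r hr => ?_
      exact ((hd r (Ioo_subset_Icc_self hr) x).hasDerivAt
        (Icc_mem_nhds hr.1 hr.2)).const_mul (cutoff R x)
  have hF'le : ∀ s ∈ Icc 0 T, F' s ≤ K₁ * F s + (K₂ + R⁻¹ * C * CG) := by
    intro s hs
    have hiS : Integrable fun x => cutoff R x * S s x :=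
      (hS s hs).1.bdd_mul (cutoff_continuous R).aestronglyMeasurable
        (Eventually.of_forall fun x => by
          rw [Real.norm_of_nonneg (cutoff_nonneg R x)]; exact cutoff_le_one R x)
    have hiG := integrable_cutoff_mul hR (hGx s hs)
    have hiΨ := integrable_cutoff_mul hR (hΨ s hs)
    have hiΨt := integrable_cutoff_mul hR (hΨt s hs)
    have e1 : F' s + (∫ x, cutoff R x * Gx s x) ≤ K₁ * F s + ∫ x, cutoff R x * S s x := by
      rw [hF', hF]
      simp only
      rw [← integral_const_mul, ← integral_add hiΨt hiG,
        ← integral_add (hiΨ.const_mul K₁) hiS]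
      refine integral_mono (hiΨt.add hiG) ((hiΨ.const_mul K₁).add hiS) fun x => ?_
      have := mul_le_mul_of_nonneg_left (hineq s hs x) (cutoff_nonneg R x)
      simp only
      linarith
    have e2 : ∫ x, cutoff R x * S s x ≤ K₂ := by
      refine le_trans ?_ (hS s hs).2
      refine integral_mono hiS (hS s hs).1.abs fun x => ?_
      refine (le_abs_self _).trans ?_
      rw [abs_mul, abs_of_nonneg (cutoff_nonneg R x)]
      exact mul_le_of_le_one_left (abs_nonneg _) (cutoff_le_one R x)
    have e3 := abs_integral_cutoff_mul_deriv_le hR hC (hG s hs) (hGx s hs) (hGi s hs).1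
    have e4 : R⁻¹ * C * ∫ x, |G s x| ≤ R⁻¹ * C * CG :=
      mul_le_mul_of_nonneg_left (hGi s hs).2 (mul_nonneg (inv_pos.2 hR).le hC0)
    linarith [neg_abs_le (∫ x, cutoff R x * Gx s x)]
  set A := K₂ + R⁻¹ * C * CG with hA
  have hA0 : 0 ≤ A := by positivity
  -- The integrating factor is at most one since `K₁ ≥ 0`, so the constant source `A` may be
  -- subtracted as `A * s` without being discounted.
  set g : ℝ → ℝ := fun s => Real.exp (-(K₁ * s)) * F s - A * s with hg
  have hgd : ∀ s ∈ Ioo 0 T, HasDerivAt g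
      (Real.exp (-(K₁ * s)) * (F' s - K₁ * F s) - A) s := by
    intro s hs
    have h1 : HasDerivAt (fun r : ℝ => Real.exp (-(K₁ * r))) (Real.exp (-(K₁ * s)) * (-K₁)) s := by
      have : HasDerivAt (fun r : ℝ => -(K₁ * r)) (-K₁) s := by
        simpa using ((hasDerivAt_id s).const_mul K₁).fun_neg
      exact this.exp
    have h2 : HasDerivAt (fun r : ℝ => A * r) A s := by
      simpa using (hasDerivAt_id s).const_mul A
    exact ((h1.fun_mul (hFd s hs)).sub h2).congr_deriv (by ring)
  have hanti : AntitoneOn g (Icc 0 T) := by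
    refine antitoneOn_of_deriv_nonpos (convex_Icc 0 T) ?_ ?_ ?_
    · exact ((Continuous.continuousOn (by fun_prop)).mul hFc).sub
        (Continuous.continuousOn (by fun_prop))
    · rw [interior_Icc]
      exact fun s hs => (hgd s hs).differentiableAt.differentiableWithinAt
    · rw [interior_Icc]
      intro s hs
      rw [(hgd s hs).deriv]
      have h1 := hF'le s (Ioo_subset_Icc_self hs)
      have h2 : Real.exp (-(K₁ * s)) ≤ 1 := Real.exp_le_one_iff.2 (by
        have := mul_nonneg hK₁ hs.1.le; linarith)
      have h3 := Real.exp_pos (-(K₁ * s))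
      have h4 : Real.exp (-(K₁ * s)) * (F' s - K₁ * F s) ≤ Real.exp (-(K₁ * s)) * A :=
        mul_le_mul_of_nonneg_left (by linarith) h3.le
      have h5 : Real.exp (-(K₁ * s)) * A ≤ 1 * A := mul_le_mul_of_nonneg_right h2 hA0
      linarith
  have hfin := hanti h0 ht ht.1
  simp only [hg, mul_zero, neg_zero, Real.exp_zero, one_mul, sub_zero] at hfin
  have h6 : F t = Real.exp (K₁ * t) * (Real.exp (-(K₁ * t)) * F t) := by
    rw [← mul_assoc, ← Real.exp_add]; simp
  change F t ≤ _
  rw [h6]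
  exact mul_le_mul_of_nonneg_left (by linarith) (Real.exp_pos _).le

/-- An abstract Gronwall inequality for the integral of a density satisfying a pointwise
differential inequality up to an exact spatial derivative. -/
theorem integral_le_of_evolution {T K₁ K₂ CG : ℝ} (hK₁ : 0 ≤ K₁) (hK₂ : 0 ≤ K₂)
    {Ψ Ψt G Gx S : ℝ → ℝ → ℝ} {Cb : ℝ → ℝ} (hCb : Continuous Cb)
    (hΨ : ∀ t ∈ Icc 0 T, Continuous (Ψ t)) (hΨt : ∀ t ∈ Icc 0 T, Continuous (Ψt t))
    (hb : ∀ t ∈ Icc 0 T, ∀ x, |Ψ t x| ≤ Cb x ∧ |Ψt t x| ≤ Cb x)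
    (hd : ∀ t ∈ Icc 0 T, ∀ x, HasDerivWithinAt (fun s => Ψ s x) (Ψt t x) (Icc 0 T) t)
    (hint : ∀ t ∈ Icc 0 T, Integrable (Ψ t))
    (hG : ∀ t ∈ Icc 0 T, ∀ x, HasDerivAt (G t) (Gx t x) x)
    (hGx : ∀ t ∈ Icc 0 T, Continuous (Gx t))
    (hGi : ∀ t ∈ Icc 0 T, Integrable (G t) ∧ ∫ x, |G t x| ≤ CG)
    (hS : ∀ t ∈ Icc 0 T, Integrable (S t) ∧ ∫ x, |S t x| ≤ K₂)
    (hineq : ∀ t ∈ Icc 0 T, ∀ x, Ψt t x + Gx t x ≤ K₁ * Ψ t x + S t x) :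
    ∀ t ∈ Icc 0 T, ∫ x, Ψ t x ≤ Real.exp (K₁ * t) * ((∫ x, Ψ 0 x) + K₂ * t) := by
  intro t ht
  have h0 : (0 : ℝ) ∈ Icc 0 T := ⟨le_rfl, ht.1.trans ht.2⟩
  obtain ⟨C, hC0, hC⟩ := exists_bound_deriv_cutoffBump
  have lim : ∀ s ∈ Icc 0 T,
      Tendsto (fun n : ℕ => ∫ x, cutoff (n + 1) x * Ψ s x) atTop (𝓝 (∫ x, Ψ s x)) := by
    intro s hs
    refine tendsto_integral_of_dominated_convergence (fun x => |Ψ s x|) ?_ (hint s hs).abs ?_ ?_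
    · exact fun n => ((cutoff_continuous _).mul (hΨ s hs)).aestronglyMeasurable
    · refine fun n => Eventually.of_forall fun x => ?_
      rw [Real.norm_eq_abs, abs_mul, abs_of_nonneg (cutoff_nonneg _ x)]
      exact mul_le_of_le_one_left (abs_nonneg _) (cutoff_le_one _ x)
    · refine Eventually.of_forall fun x => ?_
      simpa using (cutoff_tendsto x).mul_const (Ψ s x)
  have hinv : Tendsto (fun n : ℕ => ((n : ℝ) + 1)⁻¹) atTop (𝓝 0) := by
    simpa using tendsto_one_div_add_atTop_nhds_zero_nat (𝕜 := ℝ)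
  have lim2 : Tendsto (fun n : ℕ => Real.exp (K₁ * t) * ((∫ x, cutoff (n + 1) x * Ψ 0 x) +
      (K₂ + ((n : ℝ) + 1)⁻¹ * C * CG) * t)) atTop
      (𝓝 (Real.exp (K₁ * t) * ((∫ x, Ψ 0 x) + (K₂ + 0 * C * CG) * t))) :=
    ((lim 0 h0).add ((((hinv.mul_const C).mul_const CG).const_add K₂).mul_const t)).const_mul _
  rw [zero_mul, zero_mul, add_zero] at lim2
  exact le_of_tendsto_of_tendsto' (lim t ht) lim2 fun n =>
    integral_le_of_evolution_cutoff (by positivity) hK₁ hK₂ hC0 hC hCb hΨ hΨt hb hd hG hGx hGi hS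
      hineq t ht

theorem memLp_two_of_sq_le {f : ℝ → ℝ} (hf : Continuous f) {g : ℝ → ℝ} (hg : Integrable g)
    (h : ∀ x, f x ^ 2 ≤ g x) : MemLp f 2 ∧ ∫ x, f x ^ 2 ≤ ∫ x, g x := by
  have i : Integrable fun x => f x ^ 2 := by
    refine hg.mono' (hf.pow 2).aestronglyMeasurable (Eventually.of_forall fun x => ?_)
    rw [Real.norm_of_nonneg (sq_nonneg _)]
    exact h x
  exact ⟨(memLp_two_iff_integrable_sq hf.aestronglyMeasurable).2 i, integral_mono i hg h⟩

theorem IsMollifier.integrable_mul_of_memLp {δ : ℝ} {η g : ℝ → ℝ} (hη : IsMollifier δ η)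
    (hg : MemLp g 2) (x : ℝ) : Integrable fun y => η (x - y) * g y :=
  integrable_kernel_mul hη.smooth.continuous hη.hasCompactSupport
    (hg.locallyIntegrable (by norm_num)) x

theorem IsMollifier.cv_memLp {δ : ℝ} {η g : ℝ → ℝ} (hη : IsMollifier δ η) (hg : MemLp g 2) :
    MemLp (cv η g) 2 ∧ ∫ x, cv η g x ^ 2 ≤ ∫ x, g x ^ 2 := by
  have := FifthOrder.cv_memLp hη.smooth.continuous hη.hasCompactSupport hg
  simpa only [hη.integral_abs, one_pow, one_mul] using this

/-! ### Functions in `H⁴` and the mollified nonlinearity -/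

/-- `f` lies in `H⁴(ℝ)`, and all its weak derivatives up to order four have squared norm at most
`M`. -/
def H4Bound (f : ℝ → ℝ) (M : ℝ) : Prop :=
  MemLp f 2 ∧ ∀ j ≤ 4, IsWeakDeriv j f (weakDeriv j f) ∧ MemLp (weakDeriv j f) 2 ∧
    ∫ x, weakDeriv j f x ^ 2 ≤ M

theorem H4Bound.mono {f : ℝ → ℝ} {M N : ℝ} (h : H4Bound f M) (hMN : M ≤ N) : H4Bound f N :=
  ⟨h.1, fun j hj => ⟨(h.2 j hj).1, (h.2 j hj).2.1, (h.2 j hj).2.2.trans hMN⟩⟩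

theorem isWeakDeriv_zero {f : ℝ → ℝ} (hf : LocallyIntegrable f) : IsWeakDeriv 0 f f :=
  ⟨hf, hf, fun φ _ _ => by simp⟩

theorem weakDeriv_zero_ae {f : ℝ → ℝ} (hf : LocallyIntegrable f) : weakDeriv 0 f =ᵐ[volume] f :=
  (isWeakDeriv_zero hf).weakDeriv_ae_eq

namespace H4Bound

variable {f : ℝ → ℝ} {M : ℝ} (hf : H4Bound f M)
include hf

theorem nonneg : 0 ≤ M := (integral_nonneg fun _ => sq_nonneg _).trans (hf.2 0 (by norm_num)).2.2

theorem locallyIntegrable : LocallyIntegrable f := hf.1.locallyIntegrable (by norm_num)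

variable {δ : ℝ} {η : ℝ → ℝ} (hη : IsMollifier δ η)
include hη

theorem cv_eq {j : ℕ} (hj : j ≤ 4) : cv (iteratedDeriv j η) f = cv η (weakDeriv j f) := by
  have := cv_weakDeriv hη.smooth hη.hasCompactSupport (hf.2 j hj).1 0
  simpa using this

theorem hasDerivAt (j : ℕ) (x : ℝ) :
    HasDerivAt (cv (iteratedDeriv j η) f) (cv (iteratedDeriv (j + 1) η) f x) x :=
  cv_hasDerivAt hη.smooth hη.hasCompactSupport hf.locallyIntegrable j x

theorem memLp (j : ℕ) : MemLp (cv (iteratedDeriv j η) f) 2 :=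
  (cv_memLp (contDiff_iteratedDeriv hη.smooth j).continuous
    (hasCompactSupport_iteratedDeriv hη.hasCompactSupport j) hf.1).1

theorem integral_sq_le_weakDeriv {j : ℕ} (hj : j ≤ 4) :
    ∫ x, cv (iteratedDeriv j η) f x ^ 2 ≤ ∫ x, weakDeriv j f x ^ 2 := by
  rw [hf.cv_eq hη hj]
  have := (cv_memLp hη.smooth.continuous hη.hasCompactSupport (hf.2 j hj).2.1).2
  simpa [hη.integral_abs] using this

theorem integral_sq_le {j : ℕ} (hj : j ≤ 4) : ∫ x, cv (iteratedDeriv j η) f x ^ 2 ≤ M :=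
  (hf.integral_sq_le_weakDeriv hη hj).trans (hf.2 j hj).2.2

theorem sq_le {j : ℕ} (hj : j ≤ 3) (x : ℝ) : cv (iteratedDeriv j η) f x ^ 2 ≤ 2 * M := by
  have h1 := sq_le_integral (hf.hasDerivAt hη j) (hf.memLp hη j) (hf.memLp hη (j + 1)) x
  have h2 := hf.integral_sq_le hη (show j ≤ 4 by omega)
  have h3 := hf.integral_sq_le hη (show j + 1 ≤ 4 by omega)
  linarith

theorem abs_le {j : ℕ} (hj : j ≤ 3) (x : ℝ) :
    |cv (iteratedDeriv j η) f x| ≤ Real.sqrt (2 * M) :=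
  Real.abs_le_sqrt (hf.sq_le hη hj x)

omit hη

/-- The mollifications obey the bound uniformly, and they converge at almost every point. -/
theorem ae_abs_le {j : ℕ} (hj : j ≤ 3) : ∀ᵐ x, |weakDeriv j f x| ≤ Real.sqrt (2 * M) := by
  have h4 : j ≤ 4 := by omega
  filter_upwards [ae_tendsto_cv_moll (hf.2 j h4).1.2.1] with x hx
  refine le_of_tendsto' hx.abs fun n => ?_
  rw [← hf.cv_eq (moll_isMollifier n) h4]
  exact hf.abs_le (moll_isMollifier n) hj x

/-- Weak derivatives of order at most two are Lipschitz off a null set. -/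
theorem lipschitz_of_tendsto {j : ℕ} (hj : j ≤ 2) {y z : ℝ}
    (hy : Tendsto (fun n => cv (moll n) (weakDeriv j f) y) atTop (𝓝 (weakDeriv j f y)))
    (hz : Tendsto (fun n => cv (moll n) (weakDeriv j f) z) atTop (𝓝 (weakDeriv j f z))) :
    |weakDeriv j f y - weakDeriv j f z| ≤ Real.sqrt (2 * M) * |y - z| := by
  refine le_of_tendsto' (hy.sub hz).abs fun n => ?_
  rw [← hf.cv_eq (moll_isMollifier n) (by omega : j ≤ 4)]
  have := (convex_univ (𝕜 := ℝ) (E := ℝ)).norm_image_sub_le_of_norm_hasDerivWithin_le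
    (fun x _ => (hf.hasDerivAt (moll_isMollifier n) j x).hasDerivWithinAt)
    (fun x _ => hf.abs_le (moll_isMollifier n) (by omega : j + 1 ≤ 3) x)
    (mem_univ z) (mem_univ y)
  simpa only [Real.norm_eq_abs] using this

include hη

/-- The kernel averages over points within `δ` of `x`, hence within `2δ` of `y`, and there the
function is Lipschitz with constant `√(2M)`. The exceptional null set consists of the points where
mollification fails to converge and so does not depend on `x`. -/
theorem ae_abs_sub_cv_le {j : ℕ} (hj : j ≤ 2) : ∀ᵐ y, ∀ x, |x - y| < δ →
    |weakDeriv j f y - cv (iteratedDeriv j η) f x| ≤ 2 * δ * Real.sqrt (2 * M) := by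
  have h4 : j ≤ 4 := by omega
  have hl := (hf.2 j h4).1.2.1
  have hae := ae_tendsto_cv_moll hl
  filter_upwards [hae] with y hy x hxy
  rw [hf.cv_eq hη h4]
  have e1 : weakDeriv j f y - cv η (weakDeriv j f) x
      = ∫ z, η (x - z) * (weakDeriv j f y - weakDeriv j f z) := by
    have h1 := hη.cv_const (weakDeriv j f y) x
    have i1 := integrable_kernel_mul hη.smooth.continuous hη.hasCompactSupport
      (locallyIntegrable_const (weakDeriv j f y)) x
    have i2 := integrable_kernel_mul hη.smooth.continuous hη.hasCompactSupport hl x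
    calc weakDeriv j f y - cv η (weakDeriv j f) x
        = cv η (fun _ => weakDeriv j f y) x - cv η (weakDeriv j f) x := by rw [h1]
      _ = ∫ z, (η (x - z) * weakDeriv j f y - η (x - z) * weakDeriv j f z) :=
          (integral_sub i1 i2).symm
      _ = _ := by congr 1; ext z; ring
  rw [e1]
  have e2 : 2 * δ * Real.sqrt (2 * M) = ∫ z, η (x - z) * (2 * δ * Real.sqrt (2 * M)) :=
    (hη.cv_const _ x).symm
  rw [e2, ← Real.norm_eq_abs]
  refine norm_integral_le_of_norm_le (integrable_kernel_mul hη.smooth.continuous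
    hη.hasCompactSupport (locallyIntegrable_const _) x) ?_
  filter_upwards [hae] with z hz
  rw [Real.norm_eq_abs, abs_mul, abs_of_nonneg (hη.nonneg _)]
  by_cases hxz : |x - z| < δ
  · refine mul_le_mul_of_nonneg_left ?_ (hη.nonneg _)
    refine (hf.lipschitz_of_tendsto hj hy hz).trans ?_
    have h3 : |y - z| ≤ 2 * δ := by
      have : y - z = -(x - y) + (x - z) := by ring
      rw [this]
      refine (abs_add_le _ _).trans ?_
      rw [abs_neg]
      linarith
    rw [mul_comm]
    exact mul_le_mul_of_nonneg_right h3 (Real.sqrt_nonneg _)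
  · simp [hη.zero _ (not_lt.1 hxz)]

end H4Bound

/-- Commutator of a mollifier with multiplication by a function close to a constant on the
kernel's support. -/
theorem abs_cv_mul_sub_le {δ ε : ℝ} {η A B : ℝ → ℝ} (hη : IsMollifier δ η)
    (hB : LocallyIntegrable B) (hAB : LocallyIntegrable fun y => A y * B y) (a x : ℝ)
    (h : ∀ᵐ y, |x - y| < δ → |A y - a| ≤ ε) :
    |cv η (fun y => A y * B y) x - a * cv η B x| ≤ ε * cv η (fun y => |B y|) x := by
  have hBa : LocallyIntegrable fun y => |B y| := fun y => by
    obtain ⟨s, hs, h⟩ := hB y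
    exact ⟨s, hs, h.abs⟩
  have i1 := integrable_kernel_mul hη.smooth.continuous hη.hasCompactSupport hAB x
  have i2 := integrable_kernel_mul hη.smooth.continuous hη.hasCompactSupport hB x
  have i3 := integrable_kernel_mul hη.smooth.continuous hη.hasCompactSupport hBa x
  have e1 : cv η (fun y => A y * B y) x - a * cv η B x = ∫ y, η (x - y) * ((A y - a) * B y) := by
    unfold cv
    rw [← integral_const_mul, ← integral_sub i1 (i2.const_mul a)]
    congr 1; ext y; ring
  rw [e1]
  unfold cv
  rw [← integral_const_mul, ← Real.norm_eq_abs]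
  refine norm_integral_le_of_norm_le (i3.const_mul ε) ?_
  filter_upwards [h] with y hy
  rw [Real.norm_eq_abs, abs_mul, abs_of_nonneg (hη.nonneg _), abs_mul]
  by_cases hxy : |x - y| < δ
  · have := mul_le_mul_of_nonneg_right (hy hxy) (abs_nonneg (B y))
    calc η (x - y) * (|A y - a| * |B y|) ≤ η (x - y) * (ε * |B y|) :=
          mul_le_mul_of_nonneg_left this (hη.nonneg _)
      _ = _ := by ring
  · simp [hη.zero _ (not_lt.1 hxy)]

/-- The nonlinearity as a function of the values of a function and its derivatives. -/
def nl (b₁ b₂ b₃ v₀ v₁ v₂ v₃ : ℝ) : ℝ := b₁ * v₀ * v₃ + b₂ * v₁ * v₂ + b₃ * v₀ ^ 2 * v₁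

namespace H4Bound

variable {f : ℝ → ℝ} {M : ℝ} (hf : H4Bound f M)
include hf

theorem ae_abs_self_le : ∀ᵐ x, |f x| ≤ Real.sqrt (2 * M) := by
  filter_upwards [hf.ae_abs_le (j := 0) (by norm_num), weakDeriv_zero_ae hf.locallyIntegrable]
    with x hx h0
  rwa [h0] at hx

omit hf in
theorem memLp_mul_of_ae_le {A B : ℝ → ℝ} {C : ℝ} (hA : AEStronglyMeasurable A volume)
    (hAC : ∀ᵐ x, |A x| ≤ C) (hB : MemLp B 2) : MemLp (fun x => A x * B x) 2 := by
  refine (hB.norm.const_mul C).mono' (hA.mul hB.1) ?_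
  filter_upwards [hAC] with x hx
  rw [Real.norm_eq_abs, abs_mul]
  exact mul_le_mul_of_nonneg_right hx (abs_nonneg _)

theorem memLp_products : MemLp (fun x => f x * weakDeriv 3 f x) 2 ∧
    MemLp (fun x => weakDeriv 1 f x * weakDeriv 2 f x) 2 ∧
    MemLp (fun x => f x ^ 2 * weakDeriv 1 f x) 2 := by
  refine ⟨memLp_mul_of_ae_le hf.1.1 hf.ae_abs_self_le (hf.2 3 (by norm_num)).2.1,
    memLp_mul_of_ae_le (hf.2 1 (by norm_num)).2.1.1 (hf.ae_abs_le (by norm_num))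
      (hf.2 2 (by norm_num)).2.1,
    memLp_mul_of_ae_le (C := 2 * M) (hf.1.1.pow 2) ?_ (hf.2 1 (by norm_num)).2.1⟩
  filter_upwards [hf.ae_abs_self_le] with x hx
  have h0 := hf.nonneg
  rw [abs_pow]
  calc |f x| ^ 2 ≤ Real.sqrt (2 * M) ^ 2 := by gcongr
    _ = 2 * M := Real.sq_sqrt (by positivity)

omit hf in
theorem nonlinearTerm_eq (b₁ b₂ b₃ : ℝ) : nonlinearTerm b₁ b₂ b₃ f = fun x =>
    b₁ * (f x * weakDeriv 3 f x) + b₂ * (weakDeriv 1 f x * weakDeriv 2 f x) +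
      b₃ * (f x ^ 2 * weakDeriv 1 f x) := by
  ext x
  unfold nonlinearTerm
  ring

theorem memLp_nonlinearTerm (b₁ b₂ b₃ : ℝ) : MemLp (nonlinearTerm b₁ b₂ b₃ f) 2 := by
  rw [nonlinearTerm_eq]
  obtain ⟨h1, h2, h3⟩ := hf.memLp_products
  exact ((h1.const_mul b₁).add (h2.const_mul b₂)).add (h3.const_mul b₃)

/-- The `L²` bound for the nonlinear term. -/
theorem integral_nonlinearTerm_sq_le (b₁ b₂ b₃ : ℝ) :
    ∫ x, nonlinearTerm b₁ b₂ b₃ f x ^ 2 ≤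
      3 * (b₁ ^ 2 * (2 * M) + b₂ ^ 2 * (2 * M) + b₃ ^ 2 * (2 * M) ^ 2) * M := by
  have i3 := (hf.2 3 (by norm_num)).2
  have i2 := (hf.2 2 (by norm_num)).2
  have i1 := (hf.2 1 (by norm_num)).2
  have h0 := hf.nonneg
  set s := Real.sqrt (2 * M)
  have hs : s ^ 2 = 2 * M := Real.sq_sqrt (by positivity)
  have j1 := i1.1.integrable_sq.const_mul (3 * (b₃ ^ 2 * (2 * M) ^ 2))
  have j2 := i2.1.integrable_sq.const_mul (3 * (b₂ ^ 2 * (2 * M)))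
  have j3 := i3.1.integrable_sq.const_mul (3 * (b₁ ^ 2 * (2 * M)))
  have j32 := j3.fun_add j2
  have e : ∫ x, nonlinearTerm b₁ b₂ b₃ f x ^ 2 ≤
      ∫ x, ((3 * (b₁ ^ 2 * (2 * M)) * weakDeriv 3 f x ^ 2 +
        3 * (b₂ ^ 2 * (2 * M)) * weakDeriv 2 f x ^ 2) +
        3 * (b₃ ^ 2 * (2 * M) ^ 2) * weakDeriv 1 f x ^ 2) := by
    refine integral_mono_ae (hf.memLp_nonlinearTerm b₁ b₂ b₃).integrable_sq (j32.fun_add j1) ?_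
    filter_upwards [hf.ae_abs_self_le, hf.ae_abs_le (j := 1) (by norm_num)] with x hx hx1
    have q0 : f x ^ 2 ≤ 2 * M := by rw [← sq_abs, ← hs]; gcongr
    have q1 : weakDeriv 1 f x ^ 2 ≤ 2 * M := by rw [← sq_abs, ← hs]; gcongr
    have q00 : (f x ^ 2) ^ 2 ≤ (2 * M) ^ 2 := by gcongr
    have t1 := mul_le_mul_of_nonneg_right q0
      (mul_nonneg (sq_nonneg b₁) (sq_nonneg (weakDeriv 3 f x)))
    have t2 := mul_le_mul_of_nonneg_right q1
      (mul_nonneg (sq_nonneg b₂) (sq_nonneg (weakDeriv 2 f x)))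
    have t3 := mul_le_mul_of_nonneg_right q00
      (mul_nonneg (sq_nonneg b₃) (sq_nonneg (weakDeriv 1 f x)))
    unfold nonlinearTerm
    set X := b₁ * f x * weakDeriv 3 f x with hX
    set Y := b₂ * weakDeriv 1 f x * weakDeriv 2 f x with hY
    set Z := b₃ * f x ^ 2 * weakDeriv 1 f x with hZ
    have eX : X ^ 2 = f x ^ 2 * (b₁ ^ 2 * weakDeriv 3 f x ^ 2) := by rw [hX]; ring
    have eY : Y ^ 2 = weakDeriv 1 f x ^ 2 * (b₂ ^ 2 * weakDeriv 2 f x ^ 2) := by rw [hY]; ring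
    have eZ : Z ^ 2 = (f x ^ 2) ^ 2 * (b₃ ^ 2 * weakDeriv 1 f x ^ 2) := by rw [hZ]; ring
    have hsum : (X + Y + Z) ^ 2 ≤ 3 * (X ^ 2 + Y ^ 2 + Z ^ 2) := by
      linarith [sq_nonneg (X - Y), sq_nonneg (Y - Z), sq_nonneg (X - Z)]
    rw [eX, eY, eZ] at hsum
    linarith
  refine e.trans ?_
  rw [integral_add j32 j1, integral_add j3 j2, integral_const_mul, integral_const_mul,
    integral_const_mul]
  have t1 := mul_le_mul_of_nonneg_left i3.2 (show 0 ≤ 3 * (b₁ ^ 2 * (2 * M)) by positivity)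
  have t2 := mul_le_mul_of_nonneg_left i2.2 (show 0 ≤ 3 * (b₂ ^ 2 * (2 * M)) by positivity)
  have t3 := mul_le_mul_of_nonneg_left i1.2 (show 0 ≤ 3 * (b₃ ^ 2 * (2 * M) ^ 2) by positivity)
  linarith

variable {δ : ℝ} {η : ℝ → ℝ} (hη : IsMollifier δ η)
include hη

/-- In each product the factor of lower order, `f`, `∂f` or `f²`, is frozen at its mollified value.
It is Lipschitz and so varies by `O(δ)` on the kernel's support, while the remaining factor is used
only through its `L²` norm. For `f²` the extra factor `2√(2M)` bounds the sum in the difference of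
two squares. -/
theorem commutator_bounds :
    (∀ x, |cv η (fun y => f y * weakDeriv 3 f y) x
      - cv (iteratedDeriv 0 η) f x * cv (iteratedDeriv 3 η) f x| ≤
        (2 * δ * Real.sqrt (2 * M)) * cv η (fun x => |weakDeriv 3 f x|) x) ∧
    (∀ x, |cv η (fun y => weakDeriv 1 f y * weakDeriv 2 f y) x
      - cv (iteratedDeriv 1 η) f x * cv (iteratedDeriv 2 η) f x| ≤
        (2 * δ * Real.sqrt (2 * M)) * cv η (fun x => |weakDeriv 2 f x|) x) ∧
    ∀ x, |cv η (fun y => f y ^ 2 * weakDeriv 1 f y) x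
      - cv (iteratedDeriv 0 η) f x ^ 2 * cv (iteratedDeriv 1 η) f x| ≤
        (2 * δ * Real.sqrt (2 * M) * (2 * Real.sqrt (2 * M))) *
          cv η (fun x => |weakDeriv 1 f x|) x := by
  have hδ := hη.pos
  obtain ⟨p1, p2, p3⟩ := hf.memLp_products
  have l3 := (hf.2 3 (by norm_num)).1.2.1
  have l2 := (hf.2 2 (by norm_num)).1.2.1
  have l1 := (hf.2 1 (by norm_num)).1.2.1
  set s := Real.sqrt (2 * M)
  have hs0 : 0 ≤ s := Real.sqrt_nonneg _
  set g3 := cv η (fun x => |weakDeriv 3 f x|)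
  set g2 := cv η (fun x => |weakDeriv 2 f x|)
  set g1 := cv η (fun x => |weakDeriv 1 f x|)
  have k1 : ∀ x, |cv η (fun y => f y * weakDeriv 3 f y) x
      - cv (iteratedDeriv 0 η) f x * cv (iteratedDeriv 3 η) f x| ≤ (2 * δ * s) * g3 x := by
    intro x
    rw [hf.cv_eq hη (by norm_num : 3 ≤ 4)]
    refine abs_cv_mul_sub_le hη l3 (p1.locallyIntegrable (by norm_num)) _ x ?_
    filter_upwards [hf.ae_abs_sub_cv_le hη (j := 0) (by norm_num),
      weakDeriv_zero_ae hf.locallyIntegrable] with y hy hy0 hxy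
    rw [← hy0]
    exact hy x hxy
  have k2 : ∀ x, |cv η (fun y => weakDeriv 1 f y * weakDeriv 2 f y) x
      - cv (iteratedDeriv 1 η) f x * cv (iteratedDeriv 2 η) f x| ≤ (2 * δ * s) * g2 x := by
    intro x
    rw [hf.cv_eq hη (by norm_num : 2 ≤ 4)]
    refine abs_cv_mul_sub_le hη l2 (p2.locallyIntegrable (by norm_num)) _ x ?_
    filter_upwards [hf.ae_abs_sub_cv_le hη (j := 1) (by norm_num)] with y hy hxy
    exact hy x hxy
  have k3 : ∀ x, |cv η (fun y => f y ^ 2 * weakDeriv 1 f y) x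
      - cv (iteratedDeriv 0 η) f x ^ 2 * cv (iteratedDeriv 1 η) f x| ≤
        (2 * δ * s * (2 * s)) * g1 x := by
    intro x
    rw [hf.cv_eq hη (by norm_num : 1 ≤ 4)]
    refine abs_cv_mul_sub_le hη l1 (p3.locallyIntegrable (by norm_num)) _ x ?_
    filter_upwards [hf.ae_abs_sub_cv_le hη (j := 0) (by norm_num),
      weakDeriv_zero_ae hf.locallyIntegrable, hf.ae_abs_self_le] with y hy hy0 hys hxy
    have h1 := hy x hxy
    rw [hy0] at h1
    have h2 := hf.abs_le hη (j := 0) (by norm_num) x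
    have : f y ^ 2 - cv (iteratedDeriv 0 η) f x ^ 2 =
      (f y - cv (iteratedDeriv 0 η) f x) * (f y + cv (iteratedDeriv 0 η) f x) := by ring
    rw [this, abs_mul]
    refine mul_le_mul h1 ((abs_add_le _ _).trans (by linarith)) (abs_nonneg _) (by positivity)
  exact ⟨k1, k2, k3⟩

theorem cv_nonlinearTerm (b₁ b₂ b₃ x : ℝ) :
      cv (iteratedDeriv 0 η) (nonlinearTerm b₁ b₂ b₃ f) x =
      b₁ * cv η (fun y => f y * weakDeriv 3 f y) x +
      b₂ * cv η (fun y => weakDeriv 1 f y * weakDeriv 2 f y) x +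
      b₃ * cv η (fun y => f y ^ 2 * weakDeriv 1 f y) x := by
    obtain ⟨p1, p2, p3⟩ := hf.memLp_products
    have q := fun {g : ℝ → ℝ} (hg : MemLp g 2) => hη.integrable_mul_of_memLp hg x
    rw [nonlinearTerm_eq, iteratedDeriv_zero]
    unfold cv
    have r1 := (q p1).const_mul b₁
    have r2 := (q p2).const_mul b₂
    have r3 := (q p3).const_mul b₃
    have r12 := r1.fun_add r2
    rw [← integral_const_mul, ← integral_const_mul, ← integral_const_mul, ← integral_add r1 r2,
      ← integral_add r12 r3]
    congr 1; ext y
    ring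

/-- Mollification commutes with the nonlinearity up to an `L²` error of size `δ`. -/
theorem mollified_error (b₁ b₂ b₃ : ℝ) :
    MemLp (fun x => nl b₁ b₂ b₃ (cv (iteratedDeriv 0 η) f x) (cv (iteratedDeriv 1 η) f x)
      (cv (iteratedDeriv 2 η) f x) (cv (iteratedDeriv 3 η) f x) -
        cv (iteratedDeriv 0 η) (nonlinearTerm b₁ b₂ b₃ f) x) 2 ∧
    ∫ x, (nl b₁ b₂ b₃ (cv (iteratedDeriv 0 η) f x) (cv (iteratedDeriv 1 η) f x)
      (cv (iteratedDeriv 2 η) f x) (cv (iteratedDeriv 3 η) f x) -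
        cv (iteratedDeriv 0 η) (nonlinearTerm b₁ b₂ b₃ f) x) ^ 2 ≤
      δ ^ 2 * (24 * (b₁ ^ 2 + b₂ ^ 2 + 8 * M * b₃ ^ 2) * M ^ 2) := by
  have h0 := hf.nonneg
  have hδ := hη.pos
  set s := Real.sqrt (2 * M)
  have hs0 : 0 ≤ s := Real.sqrt_nonneg _
  have hs : s ^ 2 = 2 * M := Real.sq_sqrt (by positivity)
  have m3 := (hf.2 3 (by norm_num)).2
  have m2 := (hf.2 2 (by norm_num)).2
  have m1 := (hf.2 1 (by norm_num)).2
  have l3 := (hf.2 3 (by norm_num)).1.2.1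
  have l2 := (hf.2 2 (by norm_num)).1.2.1
  have l1 := (hf.2 1 (by norm_num)).1.2.1
  have c3 : MemLp (fun x => |weakDeriv 3 f x|) 2 := m3.1.norm
  have c2 : MemLp (fun x => |weakDeriv 2 f x|) 2 := m2.1.norm
  have c1 : MemLp (fun x => |weakDeriv 1 f x|) 2 := m1.1.norm
  have w := fun {g : ℝ → ℝ} (hg : MemLp g 2) => hη.cv_memLp hg
  set g3 := cv η (fun x => |weakDeriv 3 f x|)
  set g2 := cv η (fun x => |weakDeriv 2 f x|)
  set g1 := cv η (fun x => |weakDeriv 1 f x|)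
  obtain ⟨k1, k2, k3⟩ := hf.commutator_bounds hη
  have hN := hf.cv_nonlinearTerm hη b₁ b₂ b₃
  have j1 := (w c1).1.integrable_sq.const_mul (3 * (b₃ * (2 * δ * s * (2 * s))) ^ 2)
  have j2 := (w c2).1.integrable_sq.const_mul (3 * (b₂ * (2 * δ * s)) ^ 2)
  have j3 := (w c3).1.integrable_sq.const_mul (3 * (b₁ * (2 * δ * s)) ^ 2)
  have j32 := j3.fun_add j2
  have hcont : Continuous fun x => nl b₁ b₂ b₃ (cv (iteratedDeriv 0 η) f x)
      (cv (iteratedDeriv 1 η) f x) (cv (iteratedDeriv 2 η) f x) (cv (iteratedDeriv 3 η) f x) -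
        cv (iteratedDeriv 0 η) (nonlinearTerm b₁ b₂ b₃ f) x := by
    have hv := fun j => hasDerivAt_continuous (hf.hasDerivAt hη j)
    have hn := cv_continuous (contDiff_iteratedDeriv hη.smooth 0).continuous
      (hasCompactSupport_iteratedDeriv hη.hasCompactSupport 0)
      ((hf.memLp_nonlinearTerm b₁ b₂ b₃).locallyIntegrable (by norm_num))
    have := hv 0
    have := hv 1
    have := hv 2
    have := hv 3
    unfold nl
    fun_prop
  have key := memLp_two_of_sq_le hcont (j32.fun_add j1) fun x => by
    rw [hN x]
    unfold nl
    have t1 := k1 x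
    have t2 := k2 x
    have t3 := k3 x
    set X := cv η (fun y => f y * weakDeriv 3 f y) x
      - cv (iteratedDeriv 0 η) f x * cv (iteratedDeriv 3 η) f x with hX
    set Y := cv η (fun y => weakDeriv 1 f y * weakDeriv 2 f y) x
      - cv (iteratedDeriv 1 η) f x * cv (iteratedDeriv 2 η) f x with hY
    set Z := cv η (fun y => f y ^ 2 * weakDeriv 1 f y) x
      - cv (iteratedDeriv 0 η) f x ^ 2 * cv (iteratedDeriv 1 η) f x with hZ
    have s1 : X ^ 2 ≤ ((2 * δ * s) * g3 x) ^ 2 := by rw [← sq_abs X]; gcongr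
    have s2 : Y ^ 2 ≤ ((2 * δ * s) * g2 x) ^ 2 := by rw [← sq_abs Y]; gcongr
    have s3 : Z ^ 2 ≤ ((2 * δ * s * (2 * s)) * g1 x) ^ 2 := by rw [← sq_abs Z]; gcongr
    have u1 := mul_le_mul_of_nonneg_left s1 (sq_nonneg b₁)
    have u2 := mul_le_mul_of_nonneg_left s2 (sq_nonneg b₂)
    have u3 := mul_le_mul_of_nonneg_left s3 (sq_nonneg b₃)
    have e : ∀ p q r p' q' r' : ℝ, p = b₁ * X + p' → q = b₂ * Y + q' → r = b₃ * Z + r' →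
        (p' + q' + r' - (p + q + r)) ^ 2 ≤ 3 * (b₁ ^ 2 * X ^ 2 + b₂ ^ 2 * Y ^ 2 + b₃ ^ 2 * Z ^ 2) := by
      rintro p q r p' q' r' rfl rfl rfl
      linarith [sq_nonneg (b₁ * X - b₂ * Y), sq_nonneg (b₂ * Y - b₃ * Z),
        sq_nonneg (b₁ * X - b₃ * Z)]
    refine (e _ _ _ _ _ _ ?_ ?_ ?_).trans (b := 3 * (b₁ ^ 2 * X ^ 2 + b₂ ^ 2 * Y ^ 2 +
      b₃ ^ 2 * Z ^ 2)) ?_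
    · rw [hX]; ring
    · rw [hY]; ring
    · rw [hZ]; ring
    · linarith
  refine ⟨key.1, key.2.trans ?_⟩
  rw [integral_add j32 j1, integral_add j3 j2, integral_const_mul, integral_const_mul, integral_const_mul]
  have a3 := (w c3).2
  have a2 := (w c2).2
  have a1 := (w c1).2
  simp only [sq_abs] at a1 a2 a3
  have b3' := a3.trans m3.2
  have b2' := a2.trans m2.2
  have b1' := a1.trans m1.2
  have t1 := mul_le_mul_of_nonneg_left b3' (show 0 ≤ 3 * (b₁ * (2 * δ * s)) ^ 2 by positivity)
  have t2 := mul_le_mul_of_nonneg_left b2' (show 0 ≤ 3 * (b₂ * (2 * δ * s)) ^ 2 by positivity)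
  have t3 := mul_le_mul_of_nonneg_left b1'
    (show 0 ≤ 3 * (b₃ * (2 * δ * s * (2 * s))) ^ 2 by positivity)
  refine (add_le_add (add_le_add t1 t2) t3).trans (le_of_eq ?_)
  have : ∀ S : ℝ, S = s ^ 2 → 3 * (b₁ * (2 * δ * s)) ^ 2 * M + 3 * (b₂ * (2 * δ * s)) ^ 2 * M +
      3 * (b₃ * (2 * δ * s * (2 * s))) ^ 2 * M =
      3 * 4 * δ ^ 2 * S * M * (b₁ ^ 2 + b₂ ^ 2 + 4 * S * b₃ ^ 2) := by
    rintro S rfl; ring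
  rw [this _ hs.symm]
  ring

end H4Bound

/-! ### Sobolev norms and their continuity in time -/

theorem ofReal_integral_sq {f : ℝ → ℝ} (hf : MemLp f 2) :
    ENNReal.ofReal (∫ x, f x ^ 2) = eLpNorm f 2 volume ^ 2 := by
  rw [hf.eLpNorm_eq_integral_rpow_norm (by norm_num) (by norm_num)]
  rw [← ENNReal.ofReal_pow (by positivity), ← Real.rpow_natCast, ← Real.rpow_mul (by positivity)]
  simp

theorem integral_sq_eq_toReal {f : ℝ → ℝ} (hf : MemLp f 2) :
    ∫ x, f x ^ 2 = (eLpNorm f 2 volume).toReal ^ 2 := by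
  rw [← ENNReal.toReal_pow, ← ofReal_integral_sq hf,
    ENNReal.toReal_ofReal (integral_nonneg fun _ => sq_nonneg _)]

/-- A family which is continuous in `L²` has continuous squared norm. -/
theorem continuousOn_integral_sq {F : ℝ → ℝ → ℝ} {s : Set ℝ} (hF : ∀ t ∈ s, MemLp (F t) 2)
    (h : ∀ t ∈ s, Tendsto (fun r => eLpNorm (F r - F t) 2 volume) (𝓝[s] t) (𝓝 0)) :
    ContinuousOn (fun t => ∫ x, F t x ^ 2) s := by
  have key : ContinuousOn (fun t => (eLpNorm (F t) 2 volume).toReal) s := by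
    intro t ht
    have h1 : Tendsto (fun r => (eLpNorm (F r - F t) 2 volume).toReal) (𝓝[s] t) (𝓝 0) := by
      rw [← ENNReal.toReal_zero]
      exact (ENNReal.tendsto_toReal ENNReal.zero_ne_top).comp (h t ht)
    refine tendsto_iff_norm_sub_tendsto_zero.2 (squeeze_zero' ?_ ?_ h1)
    · exact Eventually.of_forall fun r => norm_nonneg _
    · filter_upwards [self_mem_nhdsWithin] with r hr
      have hr' := hF r hr
      have ht' := hF t ht
      have hs := (hr'.sub ht').2.ne
      have a1 : eLpNorm (F r) 2 volume ≤ eLpNorm (F r - F t) 2 volume + eLpNorm (F t) 2 volume := by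
        have := eLpNorm_add_le (hr'.sub ht').1 ht'.1 (p := 2) (by norm_num)
        rwa [sub_add_cancel] at this
      have a2 : eLpNorm (F t) 2 volume ≤ eLpNorm (F r - F t) 2 volume + eLpNorm (F r) 2 volume := by
        have := eLpNorm_add_le (ht'.sub hr').1 hr'.1 (p := 2) (by norm_num)
        rwa [sub_add_cancel, eLpNorm_sub_comm] at this
      have b1 := ENNReal.toReal_mono (ENNReal.add_ne_top.2 ⟨hs, ht'.2.ne⟩) a1
      have b2 := ENNReal.toReal_mono (ENNReal.add_ne_top.2 ⟨hs, hr'.2.ne⟩) a2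
      rw [ENNReal.toReal_add hs ht'.2.ne] at b1
      rw [ENNReal.toReal_add hs hr'.2.ne] at b2
      rw [Real.norm_eq_abs, abs_le]
      constructor <;> linarith
  exact (key.pow 2).congr fun t ht => integral_sq_eq_toReal (hF t ht)

theorem eLpNorm_weakDeriv_le_sobolevNorm {j m : ℕ} (hj : j ≤ m) (f : ℝ → ℝ) :
    eLpNorm (weakDeriv j f) 2 volume ≤ sobolevNorm m f := by
  unfold sobolevNorm
  have h1 : eLpNorm (weakDeriv j f) 2 volume ^ 2 ≤
      ∑ i ∈ Finset.range (m + 1), eLpNorm (weakDeriv i f) 2 volume ^ 2 :=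
    Finset.single_le_sum (f := fun i => eLpNorm (weakDeriv i f) 2 volume ^ 2)
      (fun _ _ => zero_le) (Finset.mem_range.2 (by omega))
  calc eLpNorm (weakDeriv j f) 2 volume
      = (eLpNorm (weakDeriv j f) 2 volume ^ 2) ^ (1 / 2 : ℝ) := by
        rw [← ENNReal.rpow_natCast, ← ENNReal.rpow_mul]; norm_num
    _ ≤ _ := ENNReal.rpow_le_rpow h1 (by norm_num)

theorem MemH.isWeakDeriv {m : ℕ} {f : ℝ → ℝ} (hf : MemH m f) {j : ℕ} (hj : j ≤ m) :
    IsWeakDeriv j f (weakDeriv j f) ∧ MemLp (weakDeriv j f) 2 := by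
  obtain ⟨g, hg, hw⟩ := hf.2 j hj
  have h := hw.weakDeriv_ae_eq
  have hm : MemLp (weakDeriv j f) 2 := (memLp_congr_ae h).2 hg
  refine ⟨⟨hw.1, hm.locallyIntegrable (by norm_num), fun φ h1 h2 => ?_⟩, hm⟩
  rw [hw.2.2 φ h1 h2]
  congr 1
  refine integral_congr_ae ?_
  filter_upwards [h] with x hx
  rw [hx]

theorem IsWeakDeriv.sub {j : ℕ} {f g f' g' : ℝ → ℝ} (hf : IsWeakDeriv j f f')
    (hg : IsWeakDeriv j g g') : IsWeakDeriv j (f - g) (f' - g') := by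
  refine ⟨hf.1.sub hg.1, hf.2.1.sub hg.2.1, fun φ h1 h2 => ?_⟩
  have hc := hasCompactSupport_iteratedDeriv h2 j
  have hs := (contDiff_iteratedDeriv h1 j).continuous
  have i1 : Integrable fun x => f x * iteratedDeriv j φ x := by
    simpa [mul_comm] using hf.1.integrable_smul_right_of_hasCompactSupport hs hc
  have i2 : Integrable fun x => g x * iteratedDeriv j φ x := by
    simpa [mul_comm] using hg.1.integrable_smul_right_of_hasCompactSupport hs hc
  have i3 : Integrable fun x => f' x * φ x := by
    simpa [mul_comm] using hf.2.1.integrable_smul_right_of_hasCompactSupport h1.continuous h2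
  have i4 : Integrable fun x => g' x * φ x := by
    simpa [mul_comm] using hg.2.1.integrable_smul_right_of_hasCompactSupport h1.continuous h2
  simp only [Pi.sub_apply, sub_mul]
  rw [integral_sub i1 i2, integral_sub i3 i4, hf.2.2 φ h1 h2, hg.2.2 φ h1 h2]
  ring

/-- Since `|x| ≤ 1 + |x|²`, both solutions may be treated in the same class, and four derivatives
with the weight `|x|` are all that the estimates use. -/
theorem ContHWeighted.of_eight {T : ℝ} {u : ℝ → ℝ → ℝ} (h : ContHWeighted 8 2 T u) :
    ContHWeighted 4 1 T u := by
  have hw : ∀ (f : ℝ → ℝ) x, ‖|x| ^ 1 * f x‖ ≤ ‖‖f x‖ + ‖|x| ^ 2 * f x‖‖ := by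
    intro f x
    rw [Real.norm_of_nonneg (add_nonneg (norm_nonneg _) (norm_nonneg _)), norm_mul, norm_mul,
      norm_pow, norm_pow]
    simp only [Real.norm_eq_abs, abs_abs]
    have h1 : |x| ^ 1 ≤ 1 + |x| ^ 2 := by nlinarith [sq_nonneg (|x| - 1), abs_nonneg x]
    nlinarith [mul_le_mul_of_nonneg_right h1 (abs_nonneg (f x))]
  have hm : ∀ f : ℝ → ℝ, sobolevNorm 4 f ≤ sobolevNorm 8 f := by
    intro f
    unfold sobolevNorm
    refine ENNReal.rpow_le_rpow ?_ (by norm_num)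
    exact Finset.sum_le_sum_of_subset (Finset.range_mono (by norm_num))
  refine ⟨fun t ht => ⟨⟨(h.1 t ht).1.1, fun j hj => (h.1 t ht).1.2 j (by omega)⟩, ?_⟩,
    fun t ht => ⟨?_, ?_⟩⟩
  · have h1 := (h.1 t ht).1.1
    have h2 := (h.1 t ht).2
    refine (h1.norm.add h2.norm).mono
      ((continuous_abs.pow 1).aestronglyMeasurable.mul h1.1) (Eventually.of_forall fun x => ?_)
    exact hw (u t) x
  · exact tendsto_of_tendsto_of_tendsto_of_le_of_le tendsto_const_nhds (h.2 t ht).1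
      (fun _ => zero_le) fun s => hm _
  · have h1 := (h.2 t ht).1.add (h.2 t ht).2
    rw [add_zero] at h1
    refine tendsto_of_tendsto_of_tendsto_of_le_of_le' tendsto_const_nhds h1
      (Eventually.of_forall fun _ => zero_le) ?_
    filter_upwards [self_mem_nhdsWithin] with s hs
    have m1 := (h.1 s hs).1.1.sub (h.1 t ht).1.1
    have m2 : MemLp (fun x => |x| ^ 2 * (u s - u t) x) 2 := by
      refine ((h.1 s hs).2.sub (h.1 t ht).2).ae_eq (Eventually.of_forall fun x => ?_)
      simp only [Pi.sub_apply]
      ring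
    unfold weightedNorm
    refine (eLpNorm_mono (hw (u s - u t))).trans ((eLpNorm_add_le m1.norm.1 m2.norm.1
      (by norm_num)).trans (add_le_add ?_ (le_of_eq (eLpNorm_norm _))))
    refine (le_of_eq (eLpNorm_norm _)).trans ?_
    refine le_trans (le_of_eq ?_) (eLpNorm_weakDeriv_le_sobolevNorm (show 0 ≤ 8 by norm_num) _)
    exact eLpNorm_congr_ae (weakDeriv_zero_ae (m1.locallyIntegrable (by norm_num))).symm

/-- The weight `(1 + x²)^{1/2}`. -/
noncomputable def jb (x : ℝ) : ℝ := Real.sqrt (1 + x ^ 2)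

theorem jb_sq (x : ℝ) : jb x ^ 2 = 1 + x ^ 2 := Real.sq_sqrt (by positivity)
theorem one_le_jb (x : ℝ) : 1 ≤ jb x := Real.one_le_sqrt.2 (by nlinarith [sq_nonneg x])
theorem jb_pos (x : ℝ) : 0 < jb x := one_pos.trans_le (one_le_jb x)
theorem jb_continuous : Continuous jb := by unfold jb; fun_prop

theorem abs_le_jb (x : ℝ) : |x| ≤ jb x := by
  rw [← Real.sqrt_sq_eq_abs]
  exact Real.sqrt_le_sqrt (by linarith)

theorem jb_le_two_mul {δ x y : ℝ} (hδ : δ ≤ 1) (h : |x - y| ≤ δ) : jb x ≤ 2 * jb y := by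
  have h1 : jb x ≤ Real.sqrt ((2 * jb y) ^ 2) := by
    refine Real.sqrt_le_sqrt ?_
    rw [mul_pow, jb_sq]
    have h2 : |x - y| ≤ 1 := h.trans hδ
    have h3 : (x - y) ^ 2 ≤ 1 := by rw [← sq_abs]; nlinarith [abs_nonneg (x - y)]
    nlinarith [sq_nonneg (y - (x - y))]
  rwa [Real.sqrt_sq (by have := jb_pos y; positivity)] at h1

theorem ContHWeighted.continuousOn {T : ℝ} {u : ℝ → ℝ → ℝ} (h : ContHWeighted 4 1 T u) :
    (∀ j ≤ 4, ContinuousOn (fun t => ∫ x, weakDeriv j (u t) x ^ 2) (Icc 0 T)) ∧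
      ContinuousOn (fun t => ∫ x, (|x| ^ 1 * u t x) ^ 2) (Icc 0 T) := by
  constructor
  · intro j hj
    refine continuousOn_integral_sq (fun t ht => ((h.1 t ht).1.isWeakDeriv hj).2) fun t ht => ?_
    refine tendsto_of_tendsto_of_tendsto_of_le_of_le' tendsto_const_nhds (h.2 t ht).1
      (Eventually.of_forall fun _ => zero_le) ?_
    filter_upwards [self_mem_nhdsWithin] with s hs
    refine le_trans (le_of_eq (eLpNorm_congr_ae ?_)) (eLpNorm_weakDeriv_le_sobolevNorm hj _)
    exact (((h.1 s hs).1.isWeakDeriv hj).1.sub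
      ((h.1 t ht).1.isWeakDeriv hj).1).weakDeriv_ae_eq.symm
  · refine continuousOn_integral_sq (F := fun t x => |x| ^ 1 * u t x)
      (fun t ht => (h.1 t ht).2) fun t ht => ?_
    refine (h.2 t ht).2.congr fun s => ?_
    unfold weightedNorm
    congr 1
    ext x
    simp only [Pi.sub_apply]
    ring

/-- A qualitative bound, from compactness of the time interval. It may depend on the individual
solution and must not survive in the final constant. -/
theorem ContHWeighted.exists_bound {T : ℝ} {u : ℝ → ℝ → ℝ} (h : ContHWeighted 4 1 T u) :
    ∃ M, ∀ t ∈ Icc 0 T, H4Bound (u t) M ∧ MemLp (fun x => jb x * u t x) 2 ∧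
      ∫ x, (jb x * u t x) ^ 2 ≤ M := by
  obtain ⟨h1, h2⟩ := h.continuousOn
  have hb : ∀ j, ∃ C, ∀ t ∈ Icc 0 T, j ≤ 4 → ∫ x, weakDeriv j (u t) x ^ 2 ≤ C := by
    intro j
    by_cases hj : j ≤ 4
    · obtain ⟨C, hC⟩ := isCompact_Icc.exists_bound_of_continuousOn (h1 j hj)
      exact ⟨C, fun t ht _ => (le_abs_self _).trans (hC t ht)⟩
    · exact ⟨0, fun t _ h => absurd h hj⟩
  choose C hC using hb
  obtain ⟨D, hD⟩ := isCompact_Icc.exists_bound_of_continuousOn h2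
  refine ⟨(∑ j ∈ Finset.range 5, |C j|) + |D|, fun t ht => ⟨⟨(h.1 t ht).1.1, fun j hj => ?_⟩, ?_⟩⟩
  · obtain ⟨a, b⟩ := (h.1 t ht).1.isWeakDeriv hj
    refine ⟨a, b, (hC j t ht hj).trans ((le_abs_self _).trans ?_)⟩
    have := Finset.single_le_sum (f := fun j => |C j|) (fun _ _ => abs_nonneg _)
      (Finset.mem_range.2 (show j < 5 by omega))
    have := abs_nonneg D
    linarith
  · have m1 := (h.1 t ht).1.1
    have m2 := (h.1 t ht).2
    have hm : AEStronglyMeasurable (fun x => jb x * u t x) volume :=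
      jb_continuous.aestronglyMeasurable.mul m1.1
    have e : (fun x => (jb x * u t x) ^ 2) = fun x => u t x ^ 2 + (|x| ^ 1 * u t x) ^ 2 := by
      ext x
      rw [mul_pow, jb_sq, mul_pow, pow_one, sq_abs]
      ring
    refine ⟨(memLp_two_iff_integrable_sq hm).2 (by
      rw [e]; exact m1.integrable_sq.fun_add m2.integrable_sq), ?_⟩
    rw [e, integral_add m1.integrable_sq m2.integrable_sq]
    have e0 : ∫ x, u t x ^ 2 = ∫ x, weakDeriv 0 (u t) x ^ 2 := by
      refine integral_congr_ae ?_
      filter_upwards [weakDeriv_zero_ae (m1.locallyIntegrable (by norm_num))] with x hx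
      rw [hx]
    have e1 := hC 0 t ht (by norm_num)
    have e2 := (le_abs_self _).trans (hD t ht)
    have := Finset.single_le_sum (f := fun j => |C j|) (fun _ _ => abs_nonneg _)
      (Finset.mem_range.2 (show 0 < 5 by omega))
    have := le_abs_self (C 0)
    have := le_abs_self D
    linarith

/-! ### Mollified solutions as smooth evolutions -/

/-- `v j` and `n j` are the `j`-th space derivatives of a smooth function and of a forcing term
related by `∂ₜ v = ∂ₓ⁵ v - n`, with all derivatives bounded in `L²` uniformly in time. -/
structure SmoothEvolution (T : ℝ) (v n : ℕ → ℝ → ℝ → ℝ) : Prop where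
  hasDerivAt : ∀ j, ∀ t ∈ Icc 0 T, ∀ x, HasDerivAt (v j t) (v (j + 1) t x) x
  hasDerivAt' : ∀ j, ∀ t ∈ Icc 0 T, ∀ x, HasDerivAt (n j t) (n (j + 1) t x) x
  evol : ∀ j, ∀ t ∈ Icc 0 T, ∀ x,
    HasDerivWithinAt (fun s => v j s x) (v (j + 5) t x - n j t x) (Icc 0 T) t
  bound : ∀ j, ∃ C, ∀ t ∈ Icc 0 T, MemLp (v j t) 2 ∧ ∫ x, v j t x ^ 2 ≤ C
  bound' : ∀ j, ∃ C, ∀ t ∈ Icc 0 T, MemLp (n j t) 2 ∧ ∫ x, n j t x ^ 2 ≤ C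

/-- The space derivatives of the mollification of `u`. -/
noncomputable def mv (η : ℝ → ℝ) (u : ℝ → ℝ → ℝ) (j : ℕ) (t : ℝ) : ℝ → ℝ :=
  cv (iteratedDeriv j η) (u t)

/-- The space derivatives of the mollification of the nonlinear term. -/
noncomputable def mn (b₁ b₂ b₃ : ℝ) (η : ℝ → ℝ) (u : ℝ → ℝ → ℝ) (j : ℕ) (t : ℝ) : ℝ → ℝ :=
  cv (iteratedDeriv j η) (nonlinearTerm b₁ b₂ b₃ (u t))

/-- Testing with the reflected kernel turns the distributional equation into a differential equation
in `t` at each fixed `x`. The five reflections in `∂⁵` produce the sign that makes the linear term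
positive. -/
theorem IsSolution.hasDerivWithinAt_mv {b₁ b₂ b₃ T : ℝ} {u : ℝ → ℝ → ℝ}
    (hs : IsSolution b₁ b₂ b₃ T u) {δ : ℝ} {η : ℝ → ℝ} (hη : IsMollifier δ η) (j : ℕ) {t : ℝ}
    (ht : t ∈ Icc 0 T) (x : ℝ) :
    HasDerivWithinAt (fun s => mv η u j s x) (mv η u (j + 5) t x - mn b₁ b₂ b₃ η u j t x)
      (Icc 0 T) t := by
  have h := hs (fun y => iteratedDeriv j η (x - y))
    ((contDiff_iteratedDeriv hη.smooth j).comp (contDiff_const.sub contDiff_id))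
    ((hasCompactSupport_iteratedDeriv hη.hasCompactSupport j).comp_homeomorph
      (Homeomorph.subLeft x)) t ht
  have h2 : iteratedDeriv 5 (iteratedDeriv j η) = iteratedDeriv (j + 5) η := by
    rw [iteratedDeriv_eq_iterate, iteratedDeriv_eq_iterate, iteratedDeriv_eq_iterate, add_comm j 5,
      Function.iterate_add_apply]
  rw [iteratedDeriv_comp_const_sub, h2] at h
  refine (h.congr_deriv ?_).congr_of_eventuallyEq ?_ ?_
  · unfold mv mn cv
    rw [← integral_neg]
    congr 1
    · exact integral_congr_ae (Eventually.of_forall fun y => by simp only [smul_eq_mul]; ring)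
    · exact integral_congr_ae (Eventually.of_forall fun y => mul_comm _ _)
  · refine Eventually.of_forall fun s => ?_
    exact integral_congr_ae (Eventually.of_forall fun y => mul_comm _ _)
  · exact integral_congr_ae (Eventually.of_forall fun y => mul_comm _ _)

/-- Mollifying a solution gives a smooth evolution. -/
theorem smoothEvolution_mollify {b₁ b₂ b₃ T M : ℝ} {u : ℝ → ℝ → ℝ}
    (hu : ∀ t ∈ Icc 0 T, H4Bound (u t) M) (hs : IsSolution b₁ b₂ b₃ T u)
    {δ : ℝ} {η : ℝ → ℝ} (hη : IsMollifier δ η) :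
    SmoothEvolution T (mv η u) (mn b₁ b₂ b₃ η u) where
  hasDerivAt j t ht x := (hu t ht).hasDerivAt hη j x
  hasDerivAt' j t ht x := cv_hasDerivAt hη.smooth hη.hasCompactSupport
    (((hu t ht).memLp_nonlinearTerm b₁ b₂ b₃).locallyIntegrable (by norm_num)) j x
  evol j t ht x := hs.hasDerivWithinAt_mv hη j ht x
  bound j := by
    refine ⟨(∫ y, |iteratedDeriv j η y|) ^ 2 * M, fun t ht => ?_⟩
    have h := cv_memLp (contDiff_iteratedDeriv hη.smooth j).continuous
      (hasCompactSupport_iteratedDeriv hη.hasCompactSupport j) (hu t ht).1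
    refine ⟨h.1, h.2.trans (mul_le_mul_of_nonneg_left ?_ (sq_nonneg _))⟩
    have e0 : ∫ x, u t x ^ 2 = ∫ x, weakDeriv 0 (u t) x ^ 2 := by
      refine integral_congr_ae ?_
      filter_upwards [weakDeriv_zero_ae (hu t ht).locallyIntegrable] with x hx
      rw [hx]
    rw [e0]
    exact ((hu t ht).2 0 (by norm_num)).2.2
  bound' j := by
    refine ⟨(∫ y, |iteratedDeriv j η y|) ^ 2 *
      (3 * (b₁ ^ 2 * (2 * M) + b₂ ^ 2 * (2 * M) + b₃ ^ 2 * (2 * M) ^ 2) * M), fun t ht => ?_⟩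
    have h := cv_memLp (contDiff_iteratedDeriv hη.smooth j).continuous
      (hasCompactSupport_iteratedDeriv hη.hasCompactSupport j)
      ((hu t ht).memLp_nonlinearTerm b₁ b₂ b₃)
    exact ⟨h.1, h.2.trans (mul_le_mul_of_nonneg_left
      ((hu t ht).integral_nonlinearTerm_sq_le b₁ b₂ b₃) (sq_nonneg _))⟩

/-! ### Domination of fluxes by an integrable function -/

/-- `|G| ≤ K Q` on `[0,T] × ℝ` for some constant `K`. -/
def Dom (T : ℝ) (Q G : ℝ → ℝ → ℝ) : Prop :=
  ∃ K, 0 ≤ K ∧ ∀ t ∈ Icc 0 T, ∀ x, |G t x| ≤ K * Q t x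

/-- Uniform boundedness on `[0,T] × ℝ`. -/
abbrev Bdd (T : ℝ) (c : ℝ → ℝ → ℝ) : Prop := Dom T (fun _ _ => 1) c

namespace Dom

variable {T : ℝ} {Q G H c : ℝ → ℝ → ℝ}

theorem add (hG : Dom T Q G) (hH : Dom T Q H) : Dom T Q fun t x => G t x + H t x := by
  obtain ⟨K, hK, h⟩ := hG
  obtain ⟨L, hL, h'⟩ := hH
  refine ⟨K + L, by positivity, fun t ht x => (abs_add_le _ _).trans ?_⟩
  linarith [h t ht x, h' t ht x]

theorem neg (hG : Dom T Q G) : Dom T Q fun t x => -G t x := by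
  obtain ⟨K, hK, h⟩ := hG
  exact ⟨K, hK, fun t ht x => by rw [abs_neg]; exact h t ht x⟩

theorem sub (hG : Dom T Q G) (hH : Dom T Q H) : Dom T Q fun t x => G t x - H t x := by
  simpa only [sub_eq_add_neg] using hG.add hH.neg

theorem bdd_mul (hc : Bdd T c) (hG : Dom T Q G) : Dom T Q fun t x => c t x * G t x := by
  obtain ⟨K, hK, h⟩ := hc
  obtain ⟨L, hL, h'⟩ := hG
  refine ⟨K * L, by positivity, fun t ht x => ?_⟩
  rw [abs_mul, mul_assoc]
  refine mul_le_mul ?_ (h' t ht x) (abs_nonneg _) hK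
  simpa using h t ht x

theorem mul_bdd (hG : Dom T Q G) (hc : Bdd T c) : Dom T Q fun t x => G t x * c t x := by
  simpa only [mul_comm] using bdd_mul hc hG

theorem const (a : ℝ) : Bdd T fun _ _ => a := ⟨|a|, abs_nonneg a, fun t _ x => by simp⟩

theorem const_mul (a : ℝ) (hG : Dom T Q G) : Dom T Q fun t x => a * G t x :=
  bdd_mul (const a) hG

theorem pow_bdd (hc : Bdd T c) (k : ℕ) : Bdd T fun t x => c t x ^ k := by
  induction k with
  | zero => simpa using const (T := T) 1
  | succ k ih => simpa only [pow_succ] using mul_bdd ih hc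

theorem integral_le (hG : Dom T Q G) (hc : ∀ t ∈ Icc 0 T, Continuous (G t)) {C : ℝ}
    (hQ : ∀ t ∈ Icc 0 T, Integrable (Q t) ∧ ∫ x, Q t x ≤ C) :
    ∃ CG, ∀ t ∈ Icc 0 T, Integrable (G t) ∧ ∫ x, |G t x| ≤ CG := by
  obtain ⟨K, hK, h⟩ := hG
  refine ⟨K * C, fun t ht => ?_⟩
  have i : Integrable (G t) := ((hQ t ht).1.const_mul K).mono' (hc t ht).aestronglyMeasurable
    (Eventually.of_forall fun x => h t ht x)
  refine ⟨i, (integral_mono i.abs ((hQ t ht).1.const_mul K) fun x => h t ht x).trans ?_⟩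
  rw [integral_const_mul]
  exact mul_le_mul_of_nonneg_left (hQ t ht).2 hK

theorem mul_of_sq_le {a b : ℝ → ℝ → ℝ} (ha : ∀ t ∈ Icc 0 T, ∀ x, a t x ^ 2 ≤ Q t x)
    (hb : ∀ t ∈ Icc 0 T, ∀ x, b t x ^ 2 ≤ Q t x) : Dom T Q fun t x => a t x * b t x := by
  refine ⟨1, zero_le_one, fun t ht x => ?_⟩
  rw [abs_mul, one_mul]
  have h1 := ha t ht x
  have h2 := hb t ht x
  nlinarith [sq_nonneg (|a t x| - |b t x|), sq_abs (a t x), sq_abs (b t x)]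

end Dom

/-! ### Growth of the `L²` norm and of the modified `H²` energy -/

namespace SmoothEvolution

variable {T : ℝ} {v n : ℕ → ℝ → ℝ → ℝ} (h : SmoothEvolution T v n)
include h

theorem continuous (j : ℕ) {t : ℝ} (ht : t ∈ Icc 0 T) : Continuous (v j t) :=
  hasDerivAt_continuous (h.hasDerivAt j t ht)

theorem continuous' (j : ℕ) {t : ℝ} (ht : t ∈ Icc 0 T) : Continuous (n j t) :=
  hasDerivAt_continuous (h.hasDerivAt' j t ht)

theorem memLp (j : ℕ) {t : ℝ} (ht : t ∈ Icc 0 T) : MemLp (v j t) 2 :=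
  ((h.bound j).choose_spec t ht).1

theorem bdd (j : ℕ) : Bdd T (v j) := by
  obtain ⟨C, hC⟩ := h.bound j
  obtain ⟨D, hD⟩ := h.bound (j + 1)
  refine ⟨Real.sqrt (C + D), Real.sqrt_nonneg _, fun t ht x => ?_⟩
  rw [mul_one]
  refine Real.abs_le_sqrt ?_
  have := sq_le_integral (h.hasDerivAt j t ht) (hC t ht).1 (hD t ht).1 x
  linarith [(hC t ht).2, (hD t ht).2]

theorem bdd' (j : ℕ) : Bdd T (n j) := by
  obtain ⟨C, hC⟩ := h.bound' j
  obtain ⟨D, hD⟩ := h.bound' (j + 1)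
  refine ⟨Real.sqrt (C + D), Real.sqrt_nonneg _, fun t ht x => ?_⟩
  rw [mul_one]
  refine Real.abs_le_sqrt ?_
  have := sq_le_integral (h.hasDerivAt' j t ht) (hC t ht).1 (hD t ht).1 x
  linarith [(hC t ht).2, (hD t ht).2]

/-- The square function dominating the fluxes below. -/
theorem exists_sq_dominant : ∃ (Q : ℝ → ℝ → ℝ) (C : ℝ),
    (∀ t ∈ Icc 0 T, Integrable (Q t) ∧ ∫ x, Q t x ≤ C) ∧
    (∀ j < 7, ∀ t ∈ Icc 0 T, ∀ x, v j t x ^ 2 ≤ Q t x) ∧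
    ∀ j < 7, ∀ t ∈ Icc 0 T, ∀ x, n j t x ^ 2 ≤ Q t x := by
  choose C hC using h.bound
  choose D hD using h.bound'
  -- Orders up to six suffice: the highest derivative in the fluxes below is the one in `v 2 * v 6`.
  refine ⟨fun t x => ∑ j ∈ Finset.range 7, (v j t x ^ 2 + n j t x ^ 2),
    ∑ j ∈ Finset.range 7, (C j + D j), fun t ht => ⟨?_, ?_⟩, fun j hj t ht x => ?_,
    fun j hj t ht x => ?_⟩
  · exact integrable_finsetSum _ fun j _ =>
      (hC j t ht).1.integrable_sq.fun_add (hD j t ht).1.integrable_sq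
  · rw [integral_finsetSum _ fun j _ =>
      (hC j t ht).1.integrable_sq.fun_add (hD j t ht).1.integrable_sq]
    refine Finset.sum_le_sum fun j _ => ?_
    rw [integral_add (hC j t ht).1.integrable_sq (hD j t ht).1.integrable_sq]
    exact add_le_add (hC j t ht).2 (hD j t ht).2
  · have := Finset.single_le_sum (f := fun j => v j t x ^ 2 + n j t x ^ 2)
      (fun _ _ => by positivity) (Finset.mem_range.2 hj)
    linarith [sq_nonneg (n j t x)]
  · have := Finset.single_le_sum (f := fun j => v j t x ^ 2 + n j t x ^ 2)
      (fun _ _ => by positivity) (Finset.mem_range.2 hj)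
    linarith [sq_nonneg (v j t x)]

theorem integral_one_sq_le {B : ℝ} {t : ℝ} (ht : t ∈ Icc 0 T)
    (hB : (∫ x, v 0 t x ^ 2) + ∫ x, v 2 t x ^ 2 ≤ B) : ∫ x, v 1 t x ^ 2 ≤ B / 2 := by
  have := integral_deriv_sq_le (h.hasDerivAt 0 t ht) (h.hasDerivAt 1 t ht)
    (h.memLp 0 ht) (h.memLp 1 ht) (h.memLp 2 ht)
  simp only [zero_add, Nat.reduceAdd] at this
  linarith

theorem sq_le_of_bound {B : ℝ} {t : ℝ} (ht : t ∈ Icc 0 T)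
    (hB : (∫ x, v 0 t x ^ 2) + ∫ x, v 2 t x ^ 2 ≤ B) (x : ℝ) :
    v 0 t x ^ 2 ≤ 2 * B ∧ v 1 t x ^ 2 ≤ 2 * B := by
  have h1 := h.integral_one_sq_le ht hB
  have p0 : 0 ≤ ∫ x, v 0 t x ^ 2 := integral_nonneg fun _ => sq_nonneg _
  have p1 : 0 ≤ ∫ x, v 1 t x ^ 2 := integral_nonneg fun _ => sq_nonneg _
  have p2 : 0 ≤ ∫ x, v 2 t x ^ 2 := integral_nonneg fun _ => sq_nonneg _
  have a0 := sq_le_integral (h.hasDerivAt 0 t ht) (h.memLp 0 ht) (h.memLp 1 ht) x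
  have a1 := sq_le_integral (h.hasDerivAt 1 t ht) (h.memLp 1 ht) (h.memLp 2 ht) x
  simp only [zero_add, Nat.reduceAdd] at a0 a1
  constructor <;> linarith

/-- Growth of the `L²` norm. -/
theorem integral_sq_growth {b₁ b₂ b₃ B ε : ℝ} (hε : 0 < ε)
    (hB : ∀ t ∈ Icc 0 T, (∫ x, v 0 t x ^ 2) + ∫ x, v 2 t x ^ 2 ≤ B)
    {e : ℝ → ℝ → ℝ} (he : ∀ t ∈ Icc 0 T, ∀ x,
      e t x = nl b₁ b₂ b₃ (v 0 t x) (v 1 t x) (v 2 t x) (v 3 t x) - n 0 t x)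
    (heε : ∀ t ∈ Icc 0 T, MemLp (e t) 2 ∧ ∫ x, e t x ^ 2 ≤ ε ^ 2) :
    ∀ t ∈ Icc 0 T, ∫ x, v 0 t x ^ 2 ≤ (∫ x, v 0 0 x ^ 2) +
      (|2 * b₁ - b₂| * Real.sqrt (2 * B) * (B / 2) + ε * (B + 1)) * t := by
  intro t ht
  have h0T : (0 : ℝ) ∈ Icc 0 T := ⟨le_rfl, ht.1.trans ht.2⟩
  have hB0 : 0 ≤ B := by
    have p0 : 0 ≤ ∫ x, v 0 0 x ^ 2 := integral_nonneg fun _ => sq_nonneg _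
    have p2 : 0 ≤ ∫ x, v 2 0 x ^ 2 := integral_nonneg fun _ => sq_nonneg _
    linarith [hB 0 h0T]
  set K₂ := |2 * b₁ - b₂| * Real.sqrt (2 * B) * (B / 2) + ε * (B + 1) with hK₂
  have d := h.bdd
  obtain ⟨Q, C, hQ, hv, hn⟩ := h.exists_sq_dominant
  have q : ∀ i < 7, ∀ j < 7, Dom T Q fun t x => v i t x * v j t x := fun i hi j hj =>
    Dom.mul_of_sq_le (hv i hi) (hv j hj)
  -- Modulo the exact derivative of `G`, the expression `2 v ∂ₜv` reduces to `-(2b₁ - b₂)(∂ₓv)³ + 2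
  -- v e`. With `Gx := S - Ψt` the differential inequality becomes an identity, and the algebra is
  -- in checking that `Gx` is the derivative of `G`.
  set G : ℝ → ℝ → ℝ := fun t x => -(2 * (v 0 t x * v 4 t x) - 2 * (v 1 t x * v 3 t x)
    + v 2 t x * v 2 t x - 2 * b₁ * (v 0 t x * (v 0 t x * v 2 t x))
    + (2 * b₁ - b₂) * (v 0 t x * (v 1 t x * v 1 t x))
    - b₃ / 2 * (v 0 t x ^ 2 * (v 0 t x * v 0 t x))) with hG
  have cv := fun j => @SmoothEvolution.continuous _ _ _ h j
  have hGdom : Dom T Q G :=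
    ((((((q 0 (by simp) 4 (by simp)).const_mul 2).sub
      ((q 1 (by simp) 3 (by simp)).const_mul 2)).add (q 2 (by simp) 2 (by simp))).sub
      (((d 0).bdd_mul (q 0 (by simp) 2 (by simp))).const_mul (2 * b₁))).add
      (((d 0).bdd_mul (q 1 (by simp) 1 (by simp))).const_mul (2 * b₁ - b₂)) |>.sub
      ((((d 0).pow_bdd 2).bdd_mul (q 0 (by simp) 0 (by simp))).const_mul (b₃ / 2))).neg
  have hGc : ∀ t ∈ Icc 0 T, Continuous (G t) := by
    intro t ht
    have := cv 0 ht; have := cv 1 ht; have := cv 2 ht; have := cv 3 ht; have := cv 4 ht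
    simp only [hG]
    fun_prop
  obtain ⟨CG, hCG⟩ := hGdom.integral_le hGc hQ
  set S : ℝ → ℝ → ℝ := fun t x => -(2 * b₁ - b₂) * v 1 t x ^ 3 + 2 * v 0 t x * e t x with hS
  set Ψt : ℝ → ℝ → ℝ := fun t x => 2 * v 0 t x * (v 5 t x - n 0 t x) with hΨt
  have bΨ : Bdd T fun t x => v 0 t x ^ 2 := (d 0).pow_bdd 2
  have bΨt : Bdd T Ψt := ((d 0).const_mul 2).mul_bdd ((d 5).sub (h.bdd' 0))
  obtain ⟨k1, hk1, hk1'⟩ := bΨ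
  obtain ⟨k2, hk2, hk2'⟩ := bΨt
  have hfin := integral_le_of_evolution (T := T) (K₁ := 0) (K₂ := K₂) (CG := CG) le_rfl
    (by positivity) (Ψ := fun t x => v 0 t x ^ 2) (Ψt := Ψt) (G := G)
    (Gx := fun t x => S t x - Ψt t x) (S := S) (Cb := fun _ => k1 + k2)
    continuous_const ?_ ?_ ?_ ?_ ?_ ?_ ?_ hCG ?_ ?_ t ht
  · simpa using hfin
  · intro t ht
    exact (cv 0 ht).pow 2
  · intro t ht
    have := cv 0 ht; have := cv 5 ht; have := h.continuous' 0 ht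
    simp only [hΨt]
    fun_prop
  · intro t ht x
    have := hk1' t ht x
    have := hk2' t ht x
    constructor <;> linarith
  · intro t ht x
    refine ((h.evol 0 t ht x).fun_pow 2).congr_deriv ?_
    simp only [hΨt]
    push_cast; ring
  · intro t ht
    exact (h.memLp 0 ht).integrable_sq
  · intro t ht x
    have e0 := h.hasDerivAt 0 t ht x
    have e1 := h.hasDerivAt 1 t ht x
    have e2 := h.hasDerivAt 2 t ht x
    have e3 := h.hasDerivAt 3 t ht x
    have e4 := h.hasDerivAt 4 t ht x
    refine (((((((e0.fun_mul e4).const_mul 2).fun_sub ((e1.fun_mul e3).const_mul 2)).fun_add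
      (e2.fun_mul e2)).fun_sub ((e0.fun_mul (e0.fun_mul e2)).const_mul (2 * b₁))).fun_add
      ((e0.fun_mul (e1.fun_mul e1)).const_mul (2 * b₁ - b₂))).fun_sub
      (((e0.fun_pow 2).fun_mul (e0.fun_mul e0)).const_mul (b₃ / 2))).fun_neg.congr_deriv ?_
    simp only [hS, hΨt, he t ht x, nl]
    push_cast; ring
  · intro t ht
    have : Continuous (e t) := by
      have := cv 0 ht; have := cv 1 ht; have := cv 2 ht; have := cv 3 ht; have := h.continuous' 0 ht
      rw [show e t = fun x => _ from funext (he t ht)]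
      unfold nl
      fun_prop
    have := cv 0 ht; have := cv 1 ht; have := cv 5 ht; have := h.continuous' 0 ht
    simp only [hS, hΨt]
    fun_prop
  · intro t ht
    have m1 := (h.memLp 1 ht).integrable_sq
    have m0 := (h.memLp 0 ht).integrable_sq
    have me := (heε t ht).1.integrable_sq
    have hb : ∀ x, |S t x| ≤ (|2 * b₁ - b₂| * Real.sqrt (2 * B)) * v 1 t x ^ 2 +
        (ε * v 0 t x ^ 2 + ε⁻¹ * e t x ^ 2) := by
      intro x
      simp only [hS]
      refine (abs_add_le _ _).trans (add_le_add ?_ ?_)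
      · rw [abs_mul, abs_neg, mul_assoc, pow_succ' (v 1 t x) 2, abs_mul, abs_of_nonneg
          (sq_nonneg (v 1 t x))]
        refine mul_le_mul_of_nonneg_left (mul_le_mul_of_nonneg_right ?_ (sq_nonneg _))
          (abs_nonneg _)
        exact Real.abs_le_sqrt (h.sq_le_of_bound ht (hB t ht) x).2
      -- Young's inequality balanced so that both terms are `O(ε)` after integration, because `∫ e²
      -- ≤ ε²`.
      · have h1 : 0 ≤ ε⁻¹ * (ε * |v 0 t x| - |e t x|) ^ 2 := by positivity
        have h2 : ε⁻¹ * (ε * |v 0 t x| - |e t x|) ^ 2 =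
            ε * |v 0 t x| ^ 2 + ε⁻¹ * |e t x| ^ 2 - 2 * |v 0 t x| * |e t x| := by
          field_simp; ring
        rw [abs_mul, abs_mul, abs_two]
        rw [sq_abs, sq_abs] at h2
        linarith
    have i2 : Integrable fun x => ε * v 0 t x ^ 2 + ε⁻¹ * e t x ^ 2 :=
      (m0.const_mul ε).fun_add (me.const_mul ε⁻¹)
    have i1 : Integrable fun x => (|2 * b₁ - b₂| * Real.sqrt (2 * B)) * v 1 t x ^ 2 +
        (ε * v 0 t x ^ 2 + ε⁻¹ * e t x ^ 2) := (m1.const_mul _).fun_add i2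
    have iS : Integrable (S t) := by
      have hm : AEStronglyMeasurable (S t) volume := by
        have := (cv 1 ht).aestronglyMeasurable (μ := volume)
        have := (cv 0 ht).aestronglyMeasurable (μ := volume)
        have := (heε t ht).1.1
        simp only [hS]
        fun_prop
      exact i1.mono' hm (Eventually.of_forall hb)
    refine ⟨iS, (integral_mono iS.abs i1 hb).trans ?_⟩
    rw [integral_add (m1.const_mul _) i2, integral_add (m0.const_mul ε) (me.const_mul ε⁻¹),
      integral_const_mul, integral_const_mul, integral_const_mul]
    have t1 := mul_le_mul_of_nonneg_left (h.integral_one_sq_le ht (hB t ht))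
      (show 0 ≤ |2 * b₁ - b₂| * Real.sqrt (2 * B) by positivity)
    have t2 : ε * ∫ x, v 0 t x ^ 2 ≤ ε * B := by
      refine mul_le_mul_of_nonneg_left ?_ hε.le
      have p2 : 0 ≤ ∫ x, v 2 t x ^ 2 := integral_nonneg fun _ => sq_nonneg _
      linarith [hB t ht]
    have t3 : ε⁻¹ * ∫ x, e t x ^ 2 ≤ ε := by
      have := mul_le_mul_of_nonneg_left (heε t ht).2 (inv_pos.2 hε).le
      refine this.trans (le_of_eq ?_)
      field_simp
    rw [hK₂]
    linarith
  · intro t ht x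
    simp

set_option maxHeartbeats 1600000 in
/-- Growth of the modified energy `∫ (∂ₓ²v)² + c v (∂ₓv)²`, where `5 c = b₁ + 2 b₂`. -/
theorem modified_energy_growth {b₁ b₂ b₃ c B B₄ ε : ℝ} (hc : 5 * c = b₁ + 2 * b₂) (hε : 0 < ε)
    (hB : ∀ t ∈ Icc 0 T, (∫ x, v 0 t x ^ 2) + ∫ x, v 2 t x ^ 2 ≤ B)
    (hB₄ : ∀ t ∈ Icc 0 T, ∫ x, v 4 t x ^ 2 ≤ B₄)
    {e : ℝ → ℝ → ℝ} (he : ∀ t ∈ Icc 0 T, ∀ x,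
      e t x = nl b₁ b₂ b₃ (v 0 t x) (v 1 t x) (v 2 t x) (v 3 t x) - n 0 t x)
    (heε : ∀ t ∈ Icc 0 T, MemLp (e t) 2 ∧ ∫ x, e t x ^ 2 ≤ ε ^ 2) :
    ∀ t ∈ Icc 0 T, ∫ x, (v 2 t x ^ 2 + c * v 0 t x * v 1 t x ^ 2) ≤
      (∫ x, (v 2 0 x ^ 2 + c * v 0 0 x * v 1 0 x ^ 2)) +
      ((|10 * b₃ + 4 * b₁ * c - 2 * b₂ * c| * (2 * B) + |b₃ * c| * (2 * B * (1 + 2 * B))) * B +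
        (|b₃ * c| * (4 * B * (1 + 2 * B))) * (B / 2) +
        ε * (12 * B₄ + 6 * c ^ 2 * B * (B / 2) + 24 * c ^ 2 * B * B + 1)) * t := by
  intro t ht
  have h0T : (0 : ℝ) ∈ Icc 0 T := ⟨le_rfl, ht.1.trans ht.2⟩
  have hB0 : 0 ≤ B := by
    have p0 : 0 ≤ ∫ x, v 0 0 x ^ 2 := integral_nonneg fun _ => sq_nonneg _
    have p2 : 0 ≤ ∫ x, v 2 0 x ^ 2 := integral_nonneg fun _ => sq_nonneg _
    linarith [hB 0 h0T]
  have hB₄0 : 0 ≤ B₄ := (integral_nonneg fun _ => sq_nonneg _).trans (hB₄ 0 h0T)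
  set α := |10 * b₃ + 4 * b₁ * c - 2 * b₂ * c| with hα
  set β := |b₃ * c| with hβ
  have hα0 : 0 ≤ α := abs_nonneg _
  have hβ0 : 0 ≤ β := abs_nonneg _
  set K₂ := (α * (2 * B) + β * (2 * B * (1 + 2 * B))) * B +
        (β * (4 * B * (1 + 2 * B))) * (B / 2) +
        ε * (12 * B₄ + 6 * c ^ 2 * B * (B / 2) + 24 * c ^ 2 * B * B + 1) with hK₂
  have hK₂0 : 0 ≤ K₂ := by positivity
  have d := h.bdd
  obtain ⟨Q, C, hQ, hv, hn⟩ := h.exists_sq_dominant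
  have q : ∀ i < 7, ∀ j < 7, Dom T Q fun t x => v i t x * v j t x := fun i hi j hj =>
    Dom.mul_of_sq_le (hv i hi) (hv j hj)
  have qn : ∀ i < 7, ∀ j < 7, Dom T Q fun t x => v i t x * n j t x := fun i hi j hj =>
    Dom.mul_of_sq_le (hv i hi) (hn j hj)
  have cv := fun j => @SmoothEvolution.continuous _ _ _ h j
  have cn := fun j => @SmoothEvolution.continuous' _ _ _ h j
  -- Three fluxes: `G₁` belongs to the evolution of `(∂ₓ²v)²` with the forcing kept abstract, `G₂`
  -- to that of `c v (∂ₓv)²`, and `G₃` to the terms that appear once the forcing is written as the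
  -- nonlinearity minus `e`.
  set G₁ : ℝ → ℝ → ℝ := fun t x => 2 * (v 2 t x * v 6 t x) - 2 * (v 3 t x * v 5 t x)
    + v 4 t x * v 4 t x - 2 * (v 2 t x * n 1 t x) + 2 * (v 3 t x * n 0 t x) with hG₁
  set G₂ : ℝ → ℝ → ℝ := fun t x => (2 * c) * (v 0 t x * (v 1 t x * v 5 t x))
    - c * (v 1 t x * (v 1 t x * v 4 t x)) + (4 * c) * (v 1 t x * (v 2 t x * v 3 t x))
    - (4 / 3 * c) * (v 2 t x * (v 2 t x * v 2 t x)) - (2 * c) * (v 0 t x * (v 2 t x * v 4 t x))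
    + c * (v 0 t x * (v 3 t x * v 3 t x)) - (2 * c) * (v 0 t x * (v 1 t x * n 0 t x)) with hG₂
  set G₃ : ℝ → ℝ → ℝ := fun t x => -b₁ * (v 0 t x * (v 3 t x * v 3 t x))
    - (2 * b₂) * (v 1 t x * (v 2 t x * v 3 t x)) + (2 / 3 * b₂) * (v 2 t x * (v 2 t x * v 2 t x))
    - (2 * b₃) * (v 0 t x ^ 2 * (v 1 t x * v 3 t x))
    + (4 * b₃ + b₁ * c) * ((v 0 t x * v 1 t x) * (v 1 t x * v 2 t x))
    + (b₃ + b₁ * c) * (v 0 t x ^ 2 * (v 2 t x * v 2 t x))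
    + (b₂ * c / 4 - b₃ - b₁ * c / 4) * (v 1 t x ^ 2 * (v 1 t x * v 1 t x)) with hG₃
  have hG₁dom : Dom T Q G₁ :=
    (((((q 2 (by simp) 6 (by simp)).const_mul 2).sub
      ((q 3 (by simp) 5 (by simp)).const_mul 2)).add (q 4 (by simp) 4 (by simp))).sub
      ((qn 2 (by simp) 1 (by simp)).const_mul 2)).add ((qn 3 (by simp) 0 (by simp)).const_mul 2)
  have hG₂dom : Dom T Q G₂ :=
    (((((((d 0).bdd_mul (q 1 (by simp) 5 (by simp))).const_mul (2 * c)).sub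
      (((d 1).bdd_mul (q 1 (by simp) 4 (by simp))).const_mul c)).add
      (((d 1).bdd_mul (q 2 (by simp) 3 (by simp))).const_mul (4 * c))).sub
      (((d 2).bdd_mul (q 2 (by simp) 2 (by simp))).const_mul (4 / 3 * c))).sub
      (((d 0).bdd_mul (q 2 (by simp) 4 (by simp))).const_mul (2 * c))).add
      (((d 0).bdd_mul (q 3 (by simp) 3 (by simp))).const_mul c) |>.sub
      (((d 0).bdd_mul (qn 1 (by simp) 0 (by simp))).const_mul (2 * c))
  have hG₃dom : Dom T Q G₃ :=
    (((((((d 0).bdd_mul (q 3 (by simp) 3 (by simp))).const_mul (-b₁)).sub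
      (((d 1).bdd_mul (q 2 (by simp) 3 (by simp))).const_mul (2 * b₂))).add
      (((d 2).bdd_mul (q 2 (by simp) 2 (by simp))).const_mul (2 / 3 * b₂))).sub
      ((((d 0).pow_bdd 2).bdd_mul (q 1 (by simp) 3 (by simp))).const_mul (2 * b₃))).add
      ((((d 0).mul_bdd (d 1)).bdd_mul (q 1 (by simp) 2 (by simp))).const_mul
        (4 * b₃ + b₁ * c))).add
      ((((d 0).pow_bdd 2).bdd_mul (q 2 (by simp) 2 (by simp))).const_mul (b₃ + b₁ * c)) |>.add
      ((((d 1).pow_bdd 2).bdd_mul (q 1 (by simp) 1 (by simp))).const_mul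
        (b₂ * c / 4 - b₃ - b₁ * c / 4))
  set G : ℝ → ℝ → ℝ := fun t x => -(G₁ t x + G₂ t x + G₃ t x) with hG
  have hGdom : Dom T Q G := ((hG₁dom.add hG₂dom).add hG₃dom).neg
  have hGc : ∀ t ∈ Icc 0 T, Continuous (G t) := by
    intro t ht
    have := cv 0 ht; have := cv 1 ht; have := cv 2 ht; have := cv 3 ht; have := cv 4 ht
    have := cv 5 ht; have := cv 6 ht; have := cn 0 ht; have := cn 1 ht
    simp only [hG, hG₁, hG₂, hG₃]
    fun_prop
  obtain ⟨CG, hCG⟩ := hGdom.integral_le hGc hQ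
  set P : ℝ → ℝ → ℝ := fun t x =>
    -(10 * b₃ + 4 * b₁ * c - 2 * b₂ * c) * (v 0 t x * v 1 t x) * v 2 t x ^ 2
      + b₃ * c * (v 0 t x ^ 2 * v 1 t x ^ 3 + 2 * v 0 t x ^ 3 * v 1 t x * v 2 t x) with hP
  -- The variational derivative of the modified energy: the error `e` enters the equation
  -- additively, so it contributes `∫ e z`. The term `2 v 4` is the reason for the hypothesis on the
  -- fourth derivative.
  set z : ℝ → ℝ → ℝ := fun t x =>
    2 * v 4 t x - c * (v 1 t x ^ 2 + 2 * v 0 t x * v 2 t x) with hz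
  set S : ℝ → ℝ → ℝ := fun t x => P t x + e t x * z t x with hS
  set Ψt : ℝ → ℝ → ℝ := fun t x => 2 * v 2 t x * (v 7 t x - n 2 t x) +
    ((c * (v 5 t x - n 0 t x)) * v 1 t x ^ 2 +
      (c * v 0 t x) * (2 * v 1 t x * (v 6 t x - n 1 t x))) with hΨt
  have bΨ : Bdd T fun t x => v 2 t x ^ 2 + c * v 0 t x * v 1 t x ^ 2 :=
    ((d 2).pow_bdd 2).add (((d 0).const_mul c).mul_bdd ((d 1).pow_bdd 2))
  have bΨt : Bdd T Ψt := (((d 2).const_mul 2).mul_bdd ((d 7).sub (h.bdd' 2))).add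
    (((((d 5).sub (h.bdd' 0)).const_mul c).mul_bdd ((d 1).pow_bdd 2)).add
      (((d 0).const_mul c).mul_bdd (((d 1).const_mul 2).mul_bdd ((d 6).sub (h.bdd' 1)))))
  obtain ⟨k1, hk1, hk1'⟩ := bΨ
  obtain ⟨k2, hk2, hk2'⟩ := bΨt
  have hec : ∀ t ∈ Icc 0 T, Continuous (e t) := by
    intro t ht
    have := cv 0 ht; have := cv 1 ht; have := cv 2 ht; have := cv 3 ht; have := cn 0 ht
    rw [show e t = fun x => _ from funext (he t ht)]
    unfold nl
    fun_prop
  have hSc : ∀ t ∈ Icc 0 T, Continuous (S t) := by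
    intro t ht
    have := cv 0 ht; have := cv 1 ht; have := cv 2 ht; have := cv 4 ht; have := hec t ht
    simp only [hS, hP, hz]
    fun_prop
  have hΨtc : ∀ t ∈ Icc 0 T, Continuous (Ψt t) := by
    intro t ht
    have := cv 0 ht; have := cv 1 ht; have := cv 2 ht; have := cv 5 ht; have := cv 6 ht
    have := cv 7 ht; have := cn 0 ht; have := cn 1 ht; have := cn 2 ht
    simp only [hΨt]
    fun_prop
  have hfin := integral_le_of_evolution (T := T) (K₁ := 0) (K₂ := K₂) (CG := CG) le_rfl
    hK₂0 (Ψ := fun t x => v 2 t x ^ 2 + c * v 0 t x * v 1 t x ^ 2) (Ψt := Ψt) (G := G)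
    (Gx := fun t x => S t x - Ψt t x) (S := S) (Cb := fun _ => k1 + k2)
    continuous_const ?_ hΨtc ?_ ?_ ?_ ?_ ?_ hCG ?_ ?_ t ht
  · simpa using hfin
  · intro t ht
    have := cv 0 ht; have := cv 1 ht; have := cv 2 ht
    fun_prop
  · intro t ht x
    have := hk1' t ht x
    have := hk2' t ht x
    constructor <;> linarith
  · intro t ht x
    have e0 := h.evol 0 t ht x
    have e1 := h.evol 1 t ht x
    have e2 := h.evol 2 t ht x
    refine ((e2.fun_pow 2).fun_add ((e0.const_mul c).fun_mul (e1.fun_pow 2))).congr_deriv ?_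
    simp only [hΨt]
    push_cast; ring
  · intro t ht
    have m2 := (h.memLp 2 ht).integrable_sq
    obtain ⟨k, hk, hk'⟩ := (d 0).const_mul c
    have m1 := (h.memLp 1 ht).integrable_sq.bdd_mul (c := k) (f := fun x => c * v 0 t x)
      ((continuous_const.mul (cv 0 ht)).aestronglyMeasurable)
      (Eventually.of_forall fun x => by simpa using hk' t ht x)
    exact m2.fun_add m1
  · intro t ht x
    have e0 := h.hasDerivAt 0 t ht x
    have e1 := h.hasDerivAt 1 t ht x
    have e2 := h.hasDerivAt 2 t ht x
    have e3 := h.hasDerivAt 3 t ht x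
    have e4 := h.hasDerivAt 4 t ht x
    have e5 := h.hasDerivAt 5 t ht x
    have e6 := h.hasDerivAt 6 t ht x
    have f0 := h.hasDerivAt' 0 t ht x
    have f1 := h.hasDerivAt' 1 t ht x
    have g₁ : HasDerivAt (G₁ t) _ x := ((((e2.fun_mul e6).const_mul 2).fun_sub
      ((e3.fun_mul e5).const_mul 2)).fun_add (e4.fun_mul e4)).fun_sub
      ((e2.fun_mul f1).const_mul 2) |>.fun_add ((e3.fun_mul f0).const_mul 2)
    have g₂ : HasDerivAt (G₂ t) _ x :=
      ((((((e0.fun_mul (e1.fun_mul e5)).const_mul (2 * c)).fun_sub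
      ((e1.fun_mul (e1.fun_mul e4)).const_mul c)).fun_add
      ((e1.fun_mul (e2.fun_mul e3)).const_mul (4 * c))).fun_sub
      ((e2.fun_mul (e2.fun_mul e2)).const_mul (4 / 3 * c))).fun_sub
      ((e0.fun_mul (e2.fun_mul e4)).const_mul (2 * c))).fun_add
      ((e0.fun_mul (e3.fun_mul e3)).const_mul c) |>.fun_sub
      ((e0.fun_mul (e1.fun_mul f0)).const_mul (2 * c))
    have g₃ : HasDerivAt (G₃ t) _ x :=
      (((((((e0.fun_mul (e3.fun_mul e3)).const_mul (-b₁)).fun_sub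
      ((e1.fun_mul (e2.fun_mul e3)).const_mul (2 * b₂))).fun_add
      ((e2.fun_mul (e2.fun_mul e2)).const_mul (2 / 3 * b₂))).fun_sub
      (((e0.fun_pow 2).fun_mul (e1.fun_mul e3)).const_mul (2 * b₃))).fun_add
      (((e0.fun_mul e1).fun_mul (e1.fun_mul e2)).const_mul (4 * b₃ + b₁ * c))).fun_add
      (((e0.fun_pow 2).fun_mul (e2.fun_mul e2)).const_mul (b₃ + b₁ * c))) |>.fun_add
      (((e1.fun_pow 2).fun_mul (e1.fun_mul e1)).const_mul (b₂ * c / 4 - b₃ - b₁ * c / 4))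
    refine ((g₁.fun_add g₂).fun_add g₃).fun_neg.congr_deriv ?_
    -- This relation makes the two terms in `∂ₓv (∂ₓ³v)²` cancel: `b₁ + 2b₂` from the quadratic part
    -- of the energy and `-5c` from its cubic part.
    obtain rfl : b₁ = 5 * c - 2 * b₂ := by linarith
    simp only [hS, hP, hz, hΨt, he t ht x, nl]
    push_cast; ring
  · intro t ht
    exact (hSc t ht).sub (hΨtc t ht)
  · intro t ht
    have m4 := (h.memLp 4 ht).integrable_sq
    have m2 := (h.memLp 2 ht).integrable_sq
    have m1 := (h.memLp 1 ht).integrable_sq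
    have me := (heε t ht).1.integrable_sq
    have hb : ∀ x, |S t x| ≤ ((α * (2 * B) + β * (2 * B * (1 + 2 * B)) +
        ε * (24 * c ^ 2 * B)) * v 2 t x ^ 2 +
        (β * (4 * B * (1 + 2 * B)) + ε * (6 * c ^ 2 * B)) * v 1 t x ^ 2) +
        ((ε * 12) * v 4 t x ^ 2 + ε⁻¹ * e t x ^ 2) := by
      intro x
      obtain ⟨s0, s1⟩ := h.sq_le_of_bound ht (hB t ht) x
      simp only [hS, hP, hz]
      set p := v 0 t x
      set r := v 1 t x
      set w := v 2 t x
      set y := v 4 t x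
      have a01 : |p * r| ≤ 2 * B := by
        rw [abs_mul]; nlinarith [sq_nonneg (|p| - |r|), sq_abs p, sq_abs r]
      have ap : |p| ≤ (1 + 2 * B) := by nlinarith [sq_nonneg (|p| - 1), sq_abs p, abs_nonneg p]
      have ar : |r| ≤ (1 + 2 * B) := by nlinarith [sq_nonneg (|r| - 1), sq_abs r, abs_nonneg r]
      have t1 : |-(10 * b₃ + 4 * b₁ * c - 2 * b₂ * c) * (p * r) * w ^ 2| ≤
          α * (2 * B) * w ^ 2 := by
        rw [abs_mul, abs_mul, abs_neg, abs_of_nonneg (sq_nonneg w)]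
        exact mul_le_mul_of_nonneg_right (mul_le_mul_of_nonneg_left a01 hα0) (sq_nonneg _)
      have t2 : |b₃ * c * (p ^ 2 * r ^ 3 + 2 * p ^ 3 * r * w)| ≤
          β * (2 * B * (1 + 2 * B) * (2 * r ^ 2 + w ^ 2)) := by
        rw [abs_mul]
        refine mul_le_mul_of_nonneg_left ((abs_add_le _ _).trans ?_) hβ0
        have u1 : |p ^ 2 * r ^ 3| ≤ 2 * B * (1 + 2 * B) * r ^ 2 := by
          have : p ^ 2 * r ^ 3 = p ^ 2 * r * r ^ 2 := by ring
          rw [this, abs_mul, abs_mul, abs_of_nonneg (sq_nonneg p), abs_of_nonneg (sq_nonneg r)]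
          exact mul_le_mul_of_nonneg_right (mul_le_mul s0 ar (abs_nonneg _) (by positivity))
            (sq_nonneg _)
        have u2 : |2 * p ^ 3 * r * w| ≤ 2 * B * (1 + 2 * B) * (r ^ 2 + w ^ 2) := by
          have : 2 * p ^ 3 * r * w = p ^ 2 * p * (2 * r * w) := by ring
          rw [this, abs_mul, abs_mul, abs_of_nonneg (sq_nonneg p)]
          refine mul_le_mul (mul_le_mul s0 ap (abs_nonneg _) (by positivity)) ?_ (abs_nonneg _)
            (by positivity)
          rw [abs_le]
          constructor <;> nlinarith [sq_nonneg (r - w), sq_nonneg (r + w)]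
        linarith
      have hz2 : (2 * y - c * (r ^ 2 + 2 * p * w)) ^ 2 ≤
          12 * y ^ 2 + 6 * c ^ 2 * B * r ^ 2 + 24 * c ^ 2 * B * w ^ 2 := by
        have g : (2 * y - c * (r ^ 2 + 2 * p * w)) ^ 2 ≤
            3 * ((2 * y) ^ 2 + (c * r ^ 2) ^ 2 + (2 * c * p * w) ^ 2) := by
          linarith [sq_nonneg (2 * y + c * r ^ 2), sq_nonneg (2 * y + 2 * c * p * w),
            sq_nonneg (c * r ^ 2 - 2 * c * p * w)]
        have g1 := mul_le_mul_of_nonneg_right s1 (show 0 ≤ c ^ 2 * r ^ 2 by positivity)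
        have g2 := mul_le_mul_of_nonneg_right s0 (show 0 ≤ c ^ 2 * w ^ 2 by positivity)
        linarith
      have t3 : |e t x * (2 * y - c * (r ^ 2 + 2 * p * w))| ≤ ε⁻¹ * e t x ^ 2 +
          ε * (2 * y - c * (r ^ 2 + 2 * p * w)) ^ 2 := by
        set Z := 2 * y - c * (r ^ 2 + 2 * p * w)
        have h1 : 0 ≤ ε⁻¹ * (ε * |Z| - |e t x|) ^ 2 := by positivity
        have h2 : ε⁻¹ * (ε * |Z| - |e t x|) ^ 2 =
            ε * |Z| ^ 2 + ε⁻¹ * |e t x| ^ 2 - 2 * (|e t x| * |Z|) := by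
          field_simp; ring
        have h3 : 0 ≤ |e t x| * |Z| := by positivity
        rw [abs_mul]
        rw [sq_abs, sq_abs] at h2
        linarith
      have t4 := mul_le_mul_of_nonneg_left hz2 hε.le
      have := abs_add_le (-(10 * b₃ + 4 * b₁ * c - 2 * b₂ * c) * (p * r) * w ^ 2 +
        b₃ * c * (p ^ 2 * r ^ 3 + 2 * p ^ 3 * r * w)) (e t x * (2 * y - c * (r ^ 2 + 2 * p * w)))
      have := abs_add_le (-(10 * b₃ + 4 * b₁ * c - 2 * b₂ * c) * (p * r) * w ^ 2)
        (b₃ * c * (p ^ 2 * r ^ 3 + 2 * p ^ 3 * r * w))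
      linarith
    have i1 := (m2.const_mul (α * (2 * B) + β * (2 * B * (1 + 2 * B)) +
        ε * (24 * c ^ 2 * B))).fun_add
        (m1.const_mul (β * (4 * B * (1 + 2 * B)) + ε * (6 * c ^ 2 * B)))
    have i2 := (m4.const_mul (ε * 12)).fun_add (me.const_mul ε⁻¹)
    have i3 := i1.fun_add i2
    have iS : Integrable (S t) :=
      i3.mono' (hSc t ht).aestronglyMeasurable (Eventually.of_forall hb)
    refine ⟨iS, (integral_mono iS.abs i3 hb).trans ?_⟩
    rw [integral_add i1 i2, integral_add (m2.const_mul _) (m1.const_mul _),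
      integral_add (m4.const_mul _) (me.const_mul _),
      integral_const_mul, integral_const_mul, integral_const_mul, integral_const_mul]
    have p0 : 0 ≤ ∫ x, v 0 t x ^ 2 := integral_nonneg fun _ => sq_nonneg _
    have t1 := mul_le_mul_of_nonneg_left (h.integral_one_sq_le ht (hB t ht))
      (show 0 ≤ β * (4 * B * (1 + 2 * B)) + ε * (6 * c ^ 2 * B) by positivity)
    have t2 := mul_le_mul_of_nonneg_left (show ∫ x, v 2 t x ^ 2 ≤ B by linarith [hB t ht])
      (show 0 ≤ α * (2 * B) + β * (2 * B * (1 + 2 * B)) + ε * (24 * c ^ 2 * B) by positivity)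
    have t4 := mul_le_mul_of_nonneg_left (hB₄ t ht) (show 0 ≤ ε * 12 by positivity)
    have t3 : ε⁻¹ * ∫ x, e t x ^ 2 ≤ ε := by
      have := mul_le_mul_of_nonneg_left (heε t ht).2 (inv_pos.2 hε).le
      refine this.trans (le_of_eq ?_)
      field_simp
    rw [hK₂]
    linarith
  · intro t ht x
    simp

end SmoothEvolution

/-! ### The a priori `H²` bound for short times -/

/-- The product of the two norms is kept, rather than their sum, so that the cubic part of the
energy grows only like the power `5/8` of its quadratic part. -/
theorem sq_le_two_mul_sqrt {f f' : ℝ → ℝ} (h : ∀ x, HasDerivAt f (f' x) x)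
    (hf : MemLp f 2) (hf' : MemLp f' 2) (x : ℝ) :
    f x ^ 2 ≤ 2 * Real.sqrt ((∫ y, f y ^ 2) * ∫ y, f' y ^ 2) := by
  have i1 : Integrable fun y => f y * f' y := hf.integrable_mul hf'
  have h1 := abs_le_integral_abs_deriv (F := fun y => f y ^ 2) (F' := fun y => 2 * (f y * f' y))
    (fun y => ((h y).fun_pow 2).congr_deriv (by push_cast; ring)) hf.integrable_sq
    (i1.const_mul 2) x
  have h2 : ∫ y, |2 * (f y * f' y)| = 2 * ∫ y, |f y| * |f' y| := by
    rw [← integral_const_mul]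
    exact integral_congr_ae (Eventually.of_forall fun y => by simp [abs_mul])
  have h3 := sq_integral_mul_le hf.norm hf'.norm
  simp only [Real.norm_eq_abs, sq_abs] at h3
  have h4 := Real.abs_le_sqrt h3
  rw [h2, abs_of_nonneg (sq_nonneg _)] at h1
  linarith [le_abs_self (∫ y, |f y| * |f' y|)]

/-- The cubic part of the modified energy is controlled by its quadratic part. -/
theorem cubic_le {c : ℝ} {f f' f'' : ℝ → ℝ} (h : ∀ x, HasDerivAt f (f' x) x)
    (h' : ∀ x, HasDerivAt f' (f'' x) x) (hf : MemLp f 2) (hf' : MemLp f' 2) (hf'' : MemLp f'' 2) :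
    |∫ x, c * f x * f' x ^ 2| ≤
      (∫ x, f'' x ^ 2) / 4 + 1 + 2 ^ 14 * c ^ 8 * (∫ x, f x ^ 2) ^ 7 := by
  set Y := ∫ x, f x ^ 2
  set D := ∫ x, f' x ^ 2
  set X := ∫ x, f'' x ^ 2
  have hY : 0 ≤ Y := integral_nonneg fun _ => sq_nonneg _
  have hD : 0 ≤ D := integral_nonneg fun _ => sq_nonneg _
  have hX : 0 ≤ X := integral_nonneg fun _ => sq_nonneg _
  have hDX : D ^ 2 ≤ Y * X := integral_deriv_sq_sq_le h h' hf hf' hf''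
  set s := Real.sqrt (2 * Real.sqrt (Y * D))
  have hs0 : 0 ≤ s := Real.sqrt_nonneg _
  have hs8 : s ^ 8 = 16 * (Y * D) ^ 2 := by
    have a : s ^ 2 = 2 * Real.sqrt (Y * D) := Real.sq_sqrt (by positivity)
    have b : Real.sqrt (Y * D) ^ 2 = Y * D := Real.sq_sqrt (by positivity)
    calc s ^ 8 = (s ^ 2) ^ 4 := by ring
      _ = 16 * (Real.sqrt (Y * D) ^ 2) ^ 2 := by rw [a]; ring
      _ = _ := by rw [b]
  have hs : ∀ x, |f x| ≤ s := fun x => Real.abs_le_sqrt (sq_le_two_mul_sqrt h hf hf' x)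
  have hZ : |∫ x, c * f x * f' x ^ 2| ≤ |c| * s * D := by
    rw [← integral_const_mul, ← Real.norm_eq_abs]
    refine norm_integral_le_of_norm_le (hf'.integrable_sq.const_mul _)
      (Eventually.of_forall fun x => ?_)
    rw [Real.norm_eq_abs, abs_mul, abs_mul, abs_of_nonneg (sq_nonneg (f' x))]
    exact mul_le_mul_of_nonneg_right (mul_le_mul_of_nonneg_left (hs x) (abs_nonneg _))
      (sq_nonneg _)
  refine hZ.trans ?_
  set L := 2 ^ 14 * c ^ 8 * Y ^ 7
  have hL : 0 ≤ L := by positivity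
  -- Eighth powers clear the nested roots: with `D² ≤ Y X` the left side is at most `16 c⁸ Y⁷ X⁵`,
  -- and `16 * 4 ^ 5 = 2 ^ 14` turns `X` into `X / 4`.
  have h8 : (|c| * s * D) ^ 8 ≤ (X / 4 + 1 + L) ^ 8 := by
    have c8 : |c| ^ 8 = c ^ 8 := by rw [show |c| ^ 8 = (|c| ^ 2) ^ 4 by ring, sq_abs]; ring
    have e1 : (|c| * s * D) ^ 8 = 16 * c ^ 8 * Y ^ 2 * (D ^ 2) ^ 5 := by
      rw [mul_pow, mul_pow, hs8, c8]; ring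
    have e2 : (D ^ 2) ^ 5 ≤ (Y * X) ^ 5 := pow_le_pow_left₀ (by positivity) hDX 5
    have e3 : 16 * c ^ 8 * Y ^ 2 * (Y * X) ^ 5 = (X / 4) ^ 5 * (1 * L) := by
      simp only [L]; ring
    have e4 : (X / 4) ^ 5 ≤ (X / 4 + 1 + L) ^ 5 := pow_le_pow_left₀ (by positivity) (by linarith) 5
    have e5 : (1 : ℝ) ≤ (X / 4 + 1 + L) ^ 2 := one_le_pow₀ (by linarith)
    calc (|c| * s * D) ^ 8 ≤ 16 * c ^ 8 * Y ^ 2 * (Y * X) ^ 5 := by rw [e1]; gcongr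
      _ = (X / 4) ^ 5 * (1 * L) := e3
      _ ≤ (X / 4 + 1 + L) ^ 5 * ((X / 4 + 1 + L) ^ 2 * (X / 4 + 1 + L)) := by
          gcongr
          linarith
      _ = _ := by ring
  exact le_of_pow_le_pow_left₀ (by norm_num) (by positivity) h8

/-- A quantity that improves a bound whenever it satisfies it never leaves the bound. -/
theorem le_of_bootstrap {T B : ℝ} {S : ℝ → ℝ} (hS : ContinuousOn S (Icc 0 T)) (h0 : S 0 < B)
    (h : ∀ τ ∈ Icc 0 T, (∀ t ∈ Icc 0 τ, S t ≤ B) → S τ < B) : ∀ t ∈ Icc 0 T, S t ≤ B := by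
  intro t₁ ht₁
  by_contra! hlt
  have hcl : IsCompact (Icc 0 T ∩ S ⁻¹' Ici B) :=
    isCompact_Icc.of_isClosed_subset (hS.preimage_isClosed_of_isClosed isClosed_Icc isClosed_Ici)
      inter_subset_left
  obtain ⟨t₀, ⟨ht₀, hB₀⟩, hmin⟩ := hcl.exists_isLeast ⟨t₁, ht₁, hlt.le⟩
  refine absurd (h t₀ ht₀ fun t ht => ?_) (not_lt.2 hB₀)
  rcases ht.2.lt_or_eq with hlt | rfl
  · by_contra! hc
    exact absurd (hmin ⟨⟨ht.1, ht.2.trans ht₀.2⟩, hc.le⟩) (not_le.2 hlt)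
  -- At the first time in the set `S ≥ B`, the intermediate value theorem gives a time where `S =
  -- B`. By minimality it is that same first time, so `S ≤ B` holds up to and including it.
  · obtain ⟨r, hr, hrB⟩ := intermediate_value_Icc ht₀.1
      (hS.mono (Icc_subset_Icc le_rfl ht₀.2)) ⟨h0.le, hB₀⟩
    have : t ≤ r := hmin ⟨⟨hr.1, hr.2.trans ht₀.2⟩, hrB.ge⟩
    rw [le_antisymm this hr.2, hrB]

/-- Fatou's lemma for mollifications, with a weight. -/
theorem integral_weight_sq_le_of_moll {f ψ : ℝ → ℝ} (hf : LocallyIntegrable f)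
    (hψf : MemLp (fun x => ψ x * f x) 2)
    (hm : ∀ k, MemLp (fun x => ψ x * cv (moll k) f x) 2) {F : ℕ → ℝ} {L : ℝ}
    (h : ∀ k, ∫ x, (ψ x * cv (moll k) f x) ^ 2 ≤ F k) (hF : Tendsto F atTop (𝓝 L)) :
    ∫ x, (ψ x * f x) ^ 2 ≤ L := by
  have h0 : ∀ k, 0 ≤ F k := fun k => (integral_nonneg fun _ => sq_nonneg _).trans (h k)
  have hL : 0 ≤ L := ge_of_tendsto' hF h0
  have h1 : ENNReal.ofReal (∫ x, (ψ x * f x) ^ 2) ≤ ENNReal.ofReal L := by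
    rw [ofReal_integral_eq_lintegral_ofReal hψf.integrable_sq
      (Eventually.of_forall fun _ => sq_nonneg _)]
    have h2 : ∫⁻ x, ENNReal.ofReal ((ψ x * f x) ^ 2) ≤
        liminf (fun k => ∫⁻ x, ENNReal.ofReal ((ψ x * cv (moll k) f x) ^ 2)) atTop := by
      refine le_trans (le_of_eq (lintegral_congr_ae ?_)) (lintegral_liminf_le' fun k =>
        ((hm k).1.aemeasurable.pow_const 2).ennreal_ofReal)
      filter_upwards [ae_tendsto_cv_moll hf] with x hx
      exact (((ENNReal.continuous_ofReal.tendsto _).comp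
        ((hx.const_mul (ψ x)).pow 2)).liminf_eq).symm
    refine h2.trans ?_
    rw [← ((ENNReal.continuous_ofReal.tendsto _).comp hF).liminf_eq]
    refine liminf_le_liminf (Eventually.of_forall fun k => ?_)
    rw [← ofReal_integral_eq_lintegral_ofReal (hm k).integrable_sq
      (Eventually.of_forall fun _ => sq_nonneg _)]
    exact ENNReal.ofReal_le_ofReal (h k)
  exact (ENNReal.ofReal_le_ofReal_iff hL).1 h1

theorem integral_sq_le_of_moll {f : ℝ → ℝ} (hf : MemLp f 2) {F : ℕ → ℝ} {L : ℝ}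
    (h : ∀ k, ∫ x, cv (moll k) f x ^ 2 ≤ F k) (hF : Tendsto F atTop (𝓝 L)) :
    ∫ x, f x ^ 2 ≤ L := by
  have := integral_weight_sq_le_of_moll (ψ := fun _ => 1) (hf.locallyIntegrable (by norm_num))
    (by simpa only [one_mul] using hf)
    (fun k => by simpa only [one_mul] using ((moll_isMollifier k).cv_memLp hf).1)
    (by simpa only [one_mul] using h) hF
  simpa only [one_mul] using this

theorem IsSolution.mono {b₁ b₂ b₃ T τ : ℝ} {u : ℝ → ℝ → ℝ} (h : IsSolution b₁ b₂ b₃ T u)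
    (hτ : τ ≤ T) : IsSolution b₁ b₂ b₃ τ u := fun φ hφ hc t ht =>
  (h φ hφ hc t ⟨ht.1, ht.2.trans hτ⟩).mono (Icc_subset_Icc le_rfl hτ)

/-- Growth of the first two Sobolev quantities of a solution as long as they are bounded by `B`. -/
theorem sobolev_growth {b₁ b₂ b₃ c B M τ m : ℝ} {u : ℝ → ℝ → ℝ} (hc : 5 * c = b₁ + 2 * b₂)
    (hu : ∀ t ∈ Icc 0 τ, H4Bound (u t) M) (hs : IsSolution b₁ b₂ b₃ τ u) (hτ : 0 ≤ τ)
    (hB : ∀ t ∈ Icc 0 τ, (∫ x, weakDeriv 0 (u t) x ^ 2) + ∫ x, weakDeriv 2 (u t) x ^ 2 ≤ B)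
    (hm : (∫ x, weakDeriv 0 (u 0) x ^ 2) + ∫ x, weakDeriv 2 (u 0) x ^ 2 ≤ m) :
    ∫ x, weakDeriv 0 (u τ) x ^ 2 ≤ m + (|2 * b₁ - b₂| * Real.sqrt (2 * B) * (B / 2)) * τ ∧
    ∫ x, weakDeriv 2 (u τ) x ^ 2 ≤ 4 / 3 * ((5 / 4 * m + 1 + 2 ^ 14 * c ^ 8 * m ^ 7 +
      (((|10 * b₃ + 4 * b₁ * c - 2 * b₂ * c| * (2 * B) + |b₃ * c| * (2 * B * (1 + 2 * B))) * B +
        (|b₃ * c| * (4 * B * (1 + 2 * B))) * (B / 2)) * τ)) + (1 + 2 ^ 14 * c ^ 8 *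
      (m + (|2 * b₁ - b₂| * Real.sqrt (2 * B) * (B / 2)) * τ) ^ 7)) := by
  have h0τ : (0 : ℝ) ∈ Icc 0 τ := ⟨le_rfl, hτ⟩
  have hττ : τ ∈ Icc 0 τ := ⟨hτ, le_rfl⟩
  have hM : 0 ≤ M := (hu 0 h0τ).nonneg
  -- The commutator error per unit of kernel width, from `mollified_error`; the `1` makes it
  -- positive. It depends on `M` but is multiplied by `1 / (k + 1)` and vanishes in the limit.
  set C := Real.sqrt (24 * (b₁ ^ 2 + b₂ ^ 2 + 8 * M * b₃ ^ 2) * M ^ 2) + 1 with hC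
  have hC1 : 0 < C := by have := Real.sqrt_nonneg (24 * (b₁ ^ 2 + b₂ ^ 2 + 8 * M * b₃ ^ 2) * M ^ 2)
                         linarith
  have hCsq : 24 * (b₁ ^ 2 + b₂ ^ 2 + 8 * M * b₃ ^ 2) * M ^ 2 ≤ C ^ 2 := by
    have := Real.sq_sqrt (show 0 ≤ 24 * (b₁ ^ 2 + b₂ ^ 2 + 8 * M * b₃ ^ 2) * M ^ 2 by positivity)
    have := Real.sqrt_nonneg (24 * (b₁ ^ 2 + b₂ ^ 2 + 8 * M * b₃ ^ 2) * M ^ 2)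
    nlinarith
  set ε : ℕ → ℝ := fun k => 1 / ((k : ℝ) + 1) * C with hε
  have hε0 : ∀ k, 0 < ε k := fun k => by positivity
  have hεt : Tendsto ε atTop (𝓝 0) := by
    simpa only [zero_mul] using (tendsto_one_div_add_atTop_nhds_zero_nat (𝕜 := ℝ)).mul_const C
  have ev := fun k => smoothEvolution_mollify hu hs (moll_isMollifier k)
  have hj : ∀ k, ∀ t ∈ Icc 0 τ, ∀ j ≤ 4, ∫ x, mv (moll k) u j t x ^ 2 ≤
      ∫ x, weakDeriv j (u t) x ^ 2 := fun k t ht j hj =>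
    (hu t ht).integral_sq_le_weakDeriv (moll_isMollifier k) hj
  have hB' : ∀ k, ∀ t ∈ Icc 0 τ, (∫ x, mv (moll k) u 0 t x ^ 2) + ∫ x, mv (moll k) u 2 t x ^ 2 ≤ B :=
    fun k t ht => (add_le_add (hj k t ht 0 (by simp)) (hj k t ht 2 (by simp))).trans (hB t ht)
  have hm' : ∀ k, (∫ x, mv (moll k) u 0 0 x ^ 2) + ∫ x, mv (moll k) u 2 0 x ^ 2 ≤ m :=
    fun k => (add_le_add (hj k 0 h0τ 0 (by simp)) (hj k 0 h0τ 2 (by simp))).trans hm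
  have hB₄ : ∀ k, ∀ t ∈ Icc 0 τ, ∫ x, mv (moll k) u 4 t x ^ 2 ≤ M := fun k t ht =>
    (hu t ht).integral_sq_le (moll_isMollifier k) (by simp)
  set e : ℕ → ℝ → ℝ → ℝ := fun k t x => nl b₁ b₂ b₃ (mv (moll k) u 0 t x) (mv (moll k) u 1 t x)
    (mv (moll k) u 2 t x) (mv (moll k) u 3 t x) - mn b₁ b₂ b₃ (moll k) u 0 t x with he
  have heε : ∀ k, ∀ t ∈ Icc 0 τ, MemLp (e k t) 2 ∧ ∫ x, e k t x ^ 2 ≤ ε k ^ 2 := by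
    intro k t ht
    obtain ⟨a, b⟩ := (hu t ht).mollified_error (moll_isMollifier k) b₁ b₂ b₃
    refine ⟨a, b.trans ?_⟩
    rw [hε, mul_pow]
    exact mul_le_mul_of_nonneg_left hCsq (sq_nonneg _)
  set KY := |2 * b₁ - b₂| * Real.sqrt (2 * B) * (B / 2) with hKY
  set KE := (|10 * b₃ + 4 * b₁ * c - 2 * b₂ * c| * (2 * B) + |b₃ * c| * (2 * B * (1 + 2 * B))) * B +
        (|b₃ * c| * (4 * B * (1 + 2 * B))) * (B / 2) with hKE
  have hY : ∀ k, ∫ x, mv (moll k) u 0 τ x ^ 2 ≤ m + (KY + ε k * (B + 1)) * τ := by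
    intro k
    refine ((ev k).integral_sq_growth (hε0 k) (hB' k) (fun t _ x => rfl) (heε k) τ hττ).trans ?_
    have p2 : 0 ≤ ∫ x, mv (moll k) u 2 0 x ^ 2 := integral_nonneg fun _ => sq_nonneg _
    rw [← hKY]
    linarith [hm' k]
  -- `cubic_le` costs a quarter of the quadratic part at each end: at time `τ` it leaves `3/4`,
  -- hence the factor `4/3`, and at time `0` it gives `5/4 * m`.
  have hX : ∀ k, ∫ x, mv (moll k) u 2 τ x ^ 2 ≤ 4 / 3 * ((5 / 4 * m + 1 + 2 ^ 14 * c ^ 8 * m ^ 7 +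
      ((KE + ε k * (12 * M + 6 * c ^ 2 * B * (B / 2) + 24 * c ^ 2 * B * B + 1)) * τ)) +
      (1 + 2 ^ 14 * c ^ 8 * (m + (KY + ε k * (B + 1)) * τ) ^ 7)) := by
    intro k
    have g := (ev k).modified_energy_growth hc (hε0 k) (hB' k) (hB₄ k) (fun t _ x => rfl)
      (heε k) τ hττ
    have cub : ∀ t ∈ Icc 0 τ, |∫ x, c * mv (moll k) u 0 t x * mv (moll k) u 1 t x ^ 2| ≤
        (∫ x, mv (moll k) u 2 t x ^ 2) / 4 + 1 + 2 ^ 14 * c ^ 8 *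
          (∫ x, mv (moll k) u 0 t x ^ 2) ^ 7 := fun t ht =>
      cubic_le ((ev k).hasDerivAt 0 t ht) ((ev k).hasDerivAt 1 t ht) ((ev k).memLp 0 ht)
        ((ev k).memLp 1 ht) ((ev k).memLp 2 ht)
    have spl : ∀ t ∈ Icc 0 τ, ∫ x, (mv (moll k) u 2 t x ^ 2 +
        c * mv (moll k) u 0 t x * mv (moll k) u 1 t x ^ 2) = (∫ x, mv (moll k) u 2 t x ^ 2) +
        ∫ x, c * mv (moll k) u 0 t x * mv (moll k) u 1 t x ^ 2 := by
      intro t ht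
      obtain ⟨K, hK, hK'⟩ := ((ev k).bdd 0).const_mul c
      exact integral_add ((ev k).memLp 2 ht).integrable_sq
        (((ev k).memLp 1 ht).integrable_sq.bdd_mul (c := K)
          (f := fun x => c * mv (moll k) u 0 t x)
          ((continuous_const.mul ((ev k).continuous 0 ht)).aestronglyMeasurable)
          (Eventually.of_forall fun x => by simpa using hK' t ht x))
    rw [spl τ hττ, spl 0 h0τ, ← hKE] at g
    have c1 := neg_abs_le (∫ x, c * mv (moll k) u 0 τ x * mv (moll k) u 1 τ x ^ 2)
    have c2 := cub τ hττ
    have c3 := le_abs_self (∫ x, c * mv (moll k) u 0 0 x * mv (moll k) u 1 0 x ^ 2)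
    have c4 := cub 0 h0τ
    have p0 : 0 ≤ ∫ x, mv (moll k) u 0 0 x ^ 2 := integral_nonneg fun _ => sq_nonneg _
    have p2 : 0 ≤ ∫ x, mv (moll k) u 2 0 x ^ 2 := integral_nonneg fun _ => sq_nonneg _
    have p0τ : 0 ≤ ∫ x, mv (moll k) u 0 τ x ^ 2 := integral_nonneg fun _ => sq_nonneg _
    have q0 : (∫ x, mv (moll k) u 0 0 x ^ 2) ^ 7 ≤ m ^ 7 :=
      pow_le_pow_left₀ p0 (by linarith [hm' k]) 7
    have q1 : (∫ x, mv (moll k) u 0 τ x ^ 2) ^ 7 ≤ (m + (KY + ε k * (B + 1)) * τ) ^ 7 :=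
      pow_le_pow_left₀ p0τ (hY k) 7
    have q0' := mul_le_mul_of_nonneg_left q0 (show 0 ≤ 2 ^ 14 * c ^ 8 by positivity)
    have q1' := mul_le_mul_of_nonneg_left q1 (show 0 ≤ 2 ^ 14 * c ^ 8 by positivity)
    have q2 : ∫ x, mv (moll k) u 2 0 x ^ 2 ≤ m := by linarith [hm' k]
    generalize 2 ^ 14 * c ^ 8 * (∫ x, mv (moll k) u 0 0 x ^ 2) ^ 7 = z₁ at *
    generalize 2 ^ 14 * c ^ 8 * (∫ x, mv (moll k) u 0 τ x ^ 2) ^ 7 = z₂ at *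
    generalize 2 ^ 14 * c ^ 8 * (m + (KY + ε k * (B + 1)) * τ) ^ 7 = z₃ at *
    generalize 2 ^ 14 * c ^ 8 * m ^ 7 = z₄ at *
    generalize (KE + ε k * (12 * M + 6 * c ^ 2 * B * (B / 2) + 24 * c ^ 2 * B * B + 1)) * τ = z₅ at *
    linarith only [g, c1, c2, c3, c4, q0', q1', q2]
  constructor
  · refine integral_sq_le_of_moll ((hu τ hττ).2 0 (by simp)).2.1
      (F := fun k => m + (KY + ε k * (B + 1)) * τ) (fun k => ?_) ?_
    · rw [← (hu τ hττ).cv_eq (moll_isMollifier k) (by simp)]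
      exact hY k
    · have : Continuous fun r : ℝ => m + (KY + r * (B + 1)) * τ := by fun_prop
      have h := (this.tendsto 0).comp hεt
      simp only [zero_mul, add_zero] at h
      exact h
  · refine integral_sq_le_of_moll ((hu τ hττ).2 2 (by simp)).2.1
      (F := fun k => 4 / 3 * ((5 / 4 * m + 1 + 2 ^ 14 * c ^ 8 * m ^ 7 +
      ((KE + ε k * (12 * M + 6 * c ^ 2 * B * (B / 2) + 24 * c ^ 2 * B * B + 1)) * τ)) +
      (1 + 2 ^ 14 * c ^ 8 * (m + (KY + ε k * (B + 1)) * τ) ^ 7))) (fun k => ?_) ?_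
    · rw [← (hu τ hττ).cv_eq (moll_isMollifier k) (by simp)]
      exact hX k
    · have : Continuous fun r : ℝ => 4 / 3 * ((5 / 4 * m + 1 + 2 ^ 14 * c ^ 8 * m ^ 7 +
        ((KE + r * (12 * M + 6 * c ^ 2 * B * (B / 2) + 24 * c ^ 2 * B * B + 1)) * τ)) +
        (1 + 2 ^ 14 * c ^ 8 * (m + (KY + r * (B + 1)) * τ) ^ 7)) := by fun_prop
      have h := (this.tendsto 0).comp hεt
      simp only [zero_mul, add_zero] at h
      exact h

/-- The a priori bound in `H²` on a time interval that depends only on the size of the datum. -/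
theorem exists_time_sobolev_bound (b₁ b₂ b₃ : ℝ) {m : ℝ} (hm : 0 ≤ m) :
    ∃ T₀ B : ℝ, 0 < T₀ ∧ ∀ (T : ℝ) (u : ℝ → ℝ → ℝ), 0 < T → T ≤ T₀ → ContHWeighted 4 1 T u →
      IsSolution b₁ b₂ b₃ T u →
      (∫ x, weakDeriv 0 (u 0) x ^ 2) + ∫ x, weakDeriv 2 (u 0) x ^ 2 ≤ m →
      ∀ t ∈ Icc 0 T, (∫ x, weakDeriv 0 (u t) x ^ 2) + ∫ x, weakDeriv 2 (u t) x ^ 2 ≤ B := by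
  obtain ⟨c, hc⟩ : ∃ c : ℝ, 5 * c = b₁ + 2 * b₂ := ⟨(b₁ + 2 * b₂) / 5, by ring⟩
  -- The value of the bounds in `sobolev_growth` when both growth terms are at most one, plus one to
  -- make the improvement strict. The growth rates `KY` and `KE` depend on `B`, and the time is
  -- chosen after them.
  set B := (m + 1) + 4 / 3 * ((5 / 4 * m + 1 + 2 ^ 14 * c ^ 8 * m ^ 7 + 1) +
    (1 + 2 ^ 14 * c ^ 8 * (m + 1) ^ 7)) + 1 with hBdef
  have hB0 : 0 ≤ B := by positivity
  set KY := |2 * b₁ - b₂| * Real.sqrt (2 * B) * (B / 2) with hKY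
  set KE := (|10 * b₃ + 4 * b₁ * c - 2 * b₂ * c| * (2 * B) + |b₃ * c| * (2 * B * (1 + 2 * B))) * B +
        (|b₃ * c| * (4 * B * (1 + 2 * B))) * (B / 2) with hKE
  have hKY0 : 0 ≤ KY := by positivity
  have hKE0 : 0 ≤ KE := by positivity
  refine ⟨1 / (KY + KE + 1), B, by positivity, fun T u hT0 hT hu hs h0 => ?_⟩
  obtain ⟨M, hM⟩ := hu.exists_bound
  have hcont := hu.continuousOn.1
  refine le_of_bootstrap ((hcont 0 (by simp)).add (hcont 2 (by simp))) ?_ fun τ hτ hB => ?_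
  · have : 0 ≤ 4 / 3 * ((5 / 4 * m + 1 + 2 ^ 14 * c ^ 8 * m ^ 7 + 1) +
      (1 + 2 ^ 14 * c ^ 8 * (m + 1) ^ 7)) := by positivity
    linarith only [this, hBdef, h0]
  have hτT : (KY + KE + 1) * τ ≤ 1 := by
    have h1 : τ ≤ 1 / (KY + KE + 1) := hτ.2.trans hT
    rw [le_div_iff₀ (by positivity)] at h1
    linarith
  obtain ⟨g0, g2⟩ := sobolev_growth hc (fun t ht => (hM t ⟨ht.1, ht.2.trans hτ.2⟩).1)
    (hs.mono hτ.2) hτ.1 hB h0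
  rw [← hKY] at g0 g2
  rw [← hKE] at g2
  have k1 : KY * τ ≤ 1 := by
    have := mul_nonneg hKE0 hτ.1
    linarith [hτ.1]
  have k2 : KE * τ ≤ 1 := by
    have := mul_nonneg hKY0 hτ.1
    linarith [hτ.1]
  have k3 : (m + KY * τ) ^ 7 ≤ (m + 1) ^ 7 :=
    pow_le_pow_left₀ (by have := mul_nonneg hKY0 hτ.1; linarith) (by linarith) 7
  have k4 := mul_le_mul_of_nonneg_left k3 (show 0 ≤ 2 ^ 14 * c ^ 8 by positivity)
  generalize 2 ^ 14 * c ^ 8 * (m + KY * τ) ^ 7 = z₁ at *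
  generalize 2 ^ 14 * c ^ 8 * (m + 1) ^ 7 = z₂ at *
  generalize 2 ^ 14 * c ^ 8 * m ^ 7 = z₃ at *
  linarith only [g0, g2, k1, k2, k4, hBdef]

/-! ### Pointwise bounds for the lower-order terms of the weighted identity -/

open Asymptotics

/-- The coefficients in the weighted energy identity at one point: `q j` stands for the derivatives
of the logarithmic slope of the weight, `s`, `s₁` for the mean of two solutions and its derivative,
`w` for their difference, and `b j` for an auxiliary weight and its derivatives. -/
structure Jet where
  (q q₁ q₂ q₃ q₄ s s₁ w b b' b'' : ℝ)

namespace Jet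

variable (p : Jet) (b₁ b₂ b₃ l : ℝ)

/-- The weight in the auxiliary integration by parts. -/
def B : ℝ := p.q ^ 2 + p.q + p.b

/-- The first derivative of `B`. -/
def B₁ : ℝ := 2 * p.q * p.q₁ + p.q₁ + p.b'

/-- The second derivative of `B`. -/
def B₂ : ℝ := 2 * p.q₁ ^ 2 + 2 * p.q * p.q₂ + p.q₂ + p.b''

/-- The coefficient of `(∂ₓw)²`, before the auxiliary integration by parts. -/
noncomputable def c₁₁ : ℝ := 7 * (p.q * p.q₁) + 5 * p.q₂ - b₁ * (p.q * p.s + p.s₁) - 4 * b₁ * p.s₁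
  + 2 * b₂ * p.s₁

/-- The coefficient of `w ∂ₓw`. -/
noncomputable def c₀₁ : ℝ := -(8 * b₁) * (p.s₁ * p.q) + 2 * b₂ * (p.s₁ * p.q)
  + 2 * b₃ * (p.s ^ 2 + 1 / 12 * p.w ^ 2)

/-- The coefficient of `w ∂ₓ²w`. -/
noncomputable def c₀₂ : ℝ := 2 * b₁ * (p.q * p.s + p.s₁) - 4 * b₁ * p.s₁ - l * p.B

/-- The coefficient of `w²`, without the terms of the fifth order in `q`. -/
noncomputable def c₀₀ : ℝ := 15 / 2 * (p.q ^ 3 * p.q₁) - 10 * (p.q ^ 3 * p.q₁) - 10 * (p.q ^ 2 * p.q₂)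
  + 15 / 2 * (p.q ^ 2 * p.q₂) - 5 * (p.q * p.q₃) - 10 * (p.q₁ * p.q₂) - p.q₄
  - 2 * b₁ * (p.s₁ * (p.q ^ 2 + p.q₁))
  + 1 / 2 * l * (p.B * (p.q ^ 2 + p.q₁) + 2 * (p.B₁ * p.q) + p.B₂)
  + 2 * b₃ * (p.q * (p.s ^ 2 + 1 / 12 * p.w ^ 2))

/-- The lower order part of the weighted energy identity. -/
noncomputable def R (w₁ w₂ : ℝ) : ℝ := (p.c₁₁ b₁ b₂ - l * p.B) * w₁ ^ 2 + p.c₀₀ b₁ b₃ l * p.w ^ 2 +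
  p.c₀₁ b₁ b₂ b₃ * (p.w * w₁) + p.c₀₂ b₁ l * (p.w * w₂)

/-- The jets occurring where the weight grows. -/
def Far (A : ℝ) : Set Jet := {p | 0 ≤ p.q ∧ |p.q₁| ≤ A * p.q ∧ |p.q₂| ≤ A * p.q ∧
  |p.q₃| ≤ A * p.q ∧ |p.q₄| ≤ A * p.q ∧ |p.s| ≤ p.b ∧ |p.s₁| ≤ p.b ∧ |p.w| ≤ p.b ∧ 0 ≤ p.b ∧
  p.b ≤ A ∧ p.b ^ 2 ≤ A * p.q ∧ |p.b'| ≤ A * p.b ∧ |p.b''| ≤ A * p.b}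

/-- The jets occurring where the weight is bounded. -/
def Near (A : ℝ) : Set Jet := {p | |p.q| ≤ A ∧ |p.q₁| ≤ A ∧ |p.q₂| ≤ A ∧
  |p.q₃| ≤ A ∧ |p.q₄| ≤ A ∧ |p.s| ≤ A ∧ |p.s₁| ≤ A ∧ |p.w| ≤ A ∧ |p.b| ≤ A ∧
  |p.b'| ≤ A ∧ |p.b''| ≤ A}

theorem isBigO_of_abs_le {α : Type*} {S : Set α} {f g : α → ℝ} {C : ℝ}
    (h : ∀ p ∈ S, |f p| ≤ C * |g p|) : f =O[𝓟 S] g :=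
  isBigO_principal.2 ⟨C, h⟩

theorem exists_bound_of_isBigO {α : Type*} {S : Set α} {f g : α → ℝ} (h : f =O[𝓟 S] g)
    (hg : ∀ p ∈ S, 0 ≤ g p) : ∃ C, 0 ≤ C ∧ ∀ p ∈ S, |f p| ≤ C * g p := by
  obtain ⟨C, hC⟩ := isBigO_principal.1 h
  refine ⟨|C|, abs_nonneg _, fun p hp => (hC p hp).trans ?_⟩
  rw [Real.norm_of_nonneg (hg p hp)]
  exact mul_le_mul_of_nonneg_right (le_abs_self _) (hg p hp)

theorem exists_near_bound (A : ℝ) :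
    ∃ C, 0 ≤ C ∧ ∀ p ∈ Near A, ∀ w₁ w₂, p.R b₁ b₂ b₃ l w₁ w₂ ≤ C * (p.w ^ 2 + w₁ ^ 2 + w₂ ^ 2) := by
  have one : ∀ f : Jet → ℝ, (∀ p ∈ Near A, |f p| ≤ A) → f =O[𝓟 (Near A)] fun _ => (1 : ℝ) :=
    fun f h => isBigO_of_abs_le (C := A) fun p hp => by simpa using h p hp
  have q := one Jet.q fun p h => h.1
  have q₁ := one Jet.q₁ fun p h => h.2.1
  have q₂ := one Jet.q₂ fun p h => h.2.2.1
  have q₃ := one Jet.q₃ fun p h => h.2.2.2.1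
  have q₄ := one Jet.q₄ fun p h => h.2.2.2.2.1
  have s := one Jet.s fun p h => h.2.2.2.2.2.1
  have s₁ := one Jet.s₁ fun p h => h.2.2.2.2.2.2.1
  have w := one Jet.w fun p h => h.2.2.2.2.2.2.2.1
  have b := one Jet.b fun p h => h.2.2.2.2.2.2.2.2.1
  have b' := one Jet.b' fun p h => h.2.2.2.2.2.2.2.2.2.1
  have b'' := one Jet.b'' fun p h => h.2.2.2.2.2.2.2.2.2.2
  have mul : ∀ {f g : Jet → ℝ}, (f =O[𝓟 (Near A)] fun _ => (1 : ℝ)) →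
      (g =O[𝓟 (Near A)] fun _ => (1 : ℝ)) → (fun p => f p * g p) =O[𝓟 (Near A)] fun _ => (1 : ℝ) :=
    fun hf hg => by simpa using hf.mul hg
  have pow : ∀ {f : Jet → ℝ} (k : ℕ), (f =O[𝓟 (Near A)] fun _ => (1 : ℝ)) →
      (fun p => f p ^ k) =O[𝓟 (Near A)] fun _ => (1 : ℝ) :=
    fun k hf => by simpa using hf.pow k
  have hB : Jet.B =O[𝓟 (Near A)] fun _ => (1 : ℝ) := ((pow 2 q).add q).add b
  have hB₁ : Jet.B₁ =O[𝓟 (Near A)] fun _ => (1 : ℝ) :=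
    ((mul (q.const_mul_left 2) q₁).add q₁).add b'
  have hB₂ : Jet.B₂ =O[𝓟 (Near A)] fun _ => (1 : ℝ) :=
    ((((pow 2 q₁).const_mul_left 2).add (mul (q.const_mul_left 2) q₂)).add q₂).add b''
  have hss : (fun p : Jet => p.s ^ 2 + 1 / 12 * p.w ^ 2) =O[𝓟 (Near A)] fun _ => (1 : ℝ) :=
    (pow 2 s).add ((pow 2 w).const_mul_left _)
  have h11 : (fun p => c₁₁ p b₁ b₂ - l * p.B) =O[𝓟 (Near A)] fun _ => (1 : ℝ) :=
    ((((((mul q q₁).const_mul_left 7).add (q₂.const_mul_left 5)).sub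
      (((mul q s).add s₁).const_mul_left b₁)).sub (s₁.const_mul_left (4 * b₁))).add
      (s₁.const_mul_left (2 * b₂))).sub (hB.const_mul_left l)
  have h01 : (fun p => c₀₁ p b₁ b₂ b₃) =O[𝓟 (Near A)] fun _ => (1 : ℝ) :=
    (((mul s₁ q).const_mul_left (-(8 * b₁))).add ((mul s₁ q).const_mul_left (2 * b₂))).add
      (hss.const_mul_left (2 * b₃))
  have h02 : (fun p => c₀₂ p b₁ l) =O[𝓟 (Near A)] fun _ => (1 : ℝ) :=
    ((((mul q s).add s₁).const_mul_left (2 * b₁)).sub (s₁.const_mul_left (4 * b₁))).sub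
      (hB.const_mul_left l)
  have hq2 : (fun p : Jet => p.q ^ 2 + p.q₁) =O[𝓟 (Near A)] fun _ => (1 : ℝ) := (pow 2 q).add q₁
  have h00 : (fun p => c₀₀ p b₁ b₃ l) =O[𝓟 (Near A)] fun _ => (1 : ℝ) :=
    (((((((((mul (pow 3 q) q₁).const_mul_left (15 / 2)).sub
      ((mul (pow 3 q) q₁).const_mul_left 10)).sub
      ((mul (pow 2 q) q₂).const_mul_left 10)).add ((mul (pow 2 q) q₂).const_mul_left (15 / 2))).sub
      ((mul q q₃).const_mul_left 5)).sub ((mul q₁ q₂).const_mul_left 10)).sub q₄).sub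
      ((mul s₁ hq2).const_mul_left (2 * b₁))).add
      ((((mul hB hq2).add ((mul hB₁ q).const_mul_left 2)).add hB₂).const_mul_left (1 / 2 * l)) |>.add
      ((mul q hss).const_mul_left (2 * b₃))
  obtain ⟨C₁₁, p₁₁, e₁₁⟩ := exists_bound_of_isBigO h11 fun _ _ => zero_le_one
  obtain ⟨C₀₁, p₀₁, e₀₁⟩ := exists_bound_of_isBigO h01 fun _ _ => zero_le_one
  obtain ⟨C₀₂, p₀₂, e₀₂⟩ := exists_bound_of_isBigO h02 fun _ _ => zero_le_one
  obtain ⟨C₀₀, p₀₀, e₀₀⟩ := exists_bound_of_isBigO h00 fun _ _ => zero_le_one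
  refine ⟨C₁₁ + C₀₁ + C₀₂ + C₀₀, by positivity, fun p hp w₁ w₂ => ?_⟩
  have f₁₁ := (le_abs_self _).trans (e₁₁ p hp)
  have f₀₁ := e₀₁ p hp
  have f₀₂ := e₀₂ p hp
  have f₀₀ := (le_abs_self _).trans (e₀₀ p hp)
  simp only [mul_one] at f₁₁ f₀₁ f₀₂ f₀₀
  have g : ∀ {c C x y : ℝ}, |c| ≤ C → c * (x * y) ≤ C * (x ^ 2 + y ^ 2) := by
    intro c C x y h
    refine (le_abs_self _).trans ?_
    rw [abs_mul]
    refine mul_le_mul h ?_ (abs_nonneg _) ((abs_nonneg _).trans h)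
    rw [abs_le]
    constructor <;> nlinarith [sq_nonneg (x - y), sq_nonneg (x + y)]
  have g₀₁ := g (x := p.w) (y := w₁) f₀₁
  have g₀₂ := g (x := p.w) (y := w₂) f₀₂
  have g₁₁ := mul_le_mul_of_nonneg_right f₁₁ (sq_nonneg w₁)
  have g₀₀ := mul_le_mul_of_nonneg_right f₀₀ (sq_nonneg p.w)
  unfold R
  have := mul_nonneg p₁₁ (sq_nonneg p.w)
  have := mul_nonneg p₁₁ (sq_nonneg w₂)
  have := mul_nonneg p₀₁ (sq_nonneg w₂)
  have := mul_nonneg p₀₂ (sq_nonneg w₁)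
  have := mul_nonneg p₀₀ (sq_nonneg w₁)
  have := mul_nonneg p₀₀ (sq_nonneg w₂)
  linarith

theorem mul_le_of_sq_le {c q r x y : ℝ} (hq : 0 ≤ q) (hr : 0 ≤ r) (h : c ^ 2 ≤ 4 * q * r) :
    c * (x * y) ≤ q * y ^ 2 + r * x ^ 2 := by
  have h1 : (c * (x * y)) ^ 2 ≤ (q * y ^ 2 + r * x ^ 2) ^ 2 := by
    have := mul_le_mul_of_nonneg_right h (sq_nonneg (x * y))
    nlinarith [sq_nonneg (q * y ^ 2 - r * x ^ 2)]
  exact (abs_le_of_sq_le_sq' h1 (by positivity)).2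

/-- The fraction `1/8` is the slack between the `9/16` lost in the main identity and the `11/16`
gained from the decrease of `a`. -/
theorem quartic_le_quintic {C q : ℝ} (hC : 0 ≤ C) (hq : 0 ≤ q) :
    C * q ^ 4 ≤ q ^ 5 / 8 + C * (8 * C) ^ 4 := by
  rcases le_total q (8 * C) with h | h
  · have := mul_le_mul_of_nonneg_left (pow_le_pow_left₀ hq h 4) hC
    have : 0 ≤ q ^ 5 := by positivity
    linarith
  · have := mul_le_mul_of_nonneg_right h (show 0 ≤ q ^ 4 by positivity)
    have : 0 ≤ C * (8 * C) ^ 4 := by positivity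
    nlinarith

/-- Each term has its own absorber. A large `l` makes `-l B (∂ₓw)²` dominate the first-derivative
terms, `q (∂ₓ²w)²` absorbs the mixed term `w ∂ₓ²w`, and the coefficient of `w²` is of order at most
four in `q`, hence below `q⁵ / 8` up to a constant. -/
theorem exists_far_bound {A : ℝ} (hA : 0 ≤ A) :
    ∃ l C, 0 ≤ C ∧ ∀ p ∈ Far A, ∀ w₁ w₂,
      p.R b₁ b₂ b₃ l w₁ w₂ ≤ (C + p.q ^ 5 / 8) * p.w ^ 2 + p.q * w₂ ^ 2 := by
  have Bnn : ∀ p ∈ Far A, 0 ≤ p.B := fun p h => by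
    have := h.1; have := h.2.2.2.2.2.2.2.2.1
    unfold B; positivity
  have hq : ∀ f : Jet → ℝ, (∀ p ∈ Far A, |f p| ≤ A * p.q) → f =O[𝓟 (Far A)] Jet.q :=
    fun f h => isBigO_of_abs_le (C := A) fun p hp => by rw [abs_of_nonneg hp.1]; exact h p hp
  have q : Jet.q =O[𝓟 (Far A)] Jet.q := isBigO_refl _ _
  have q₁ := hq Jet.q₁ fun p h => h.2.1
  have q₂ := hq Jet.q₂ fun p h => h.2.2.1
  have q₃ := hq Jet.q₃ fun p h => h.2.2.2.1
  have q₄ := hq Jet.q₄ fun p h => h.2.2.2.2.1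
  have hb : ∀ (D : ℝ) (f : Jet → ℝ), (∀ p ∈ Far A, |f p| ≤ D * p.b) → f =O[𝓟 (Far A)] Jet.b :=
    fun D f h => isBigO_of_abs_le (C := D) fun p hp => by
      rw [abs_of_nonneg hp.2.2.2.2.2.2.2.2.1]; exact h p hp
  have s := hb 1 Jet.s fun p h => by rw [one_mul]; exact h.2.2.2.2.2.1
  have s₁ := hb 1 Jet.s₁ fun p h => by rw [one_mul]; exact h.2.2.2.2.2.2.1
  have w := hb 1 Jet.w fun p h => by rw [one_mul]; exact h.2.2.2.2.2.2.2.1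
  have b' := hb A Jet.b' fun p h => h.2.2.2.2.2.2.2.2.2.2.2.1
  have b'' := hb A Jet.b'' fun p h => h.2.2.2.2.2.2.2.2.2.2.2.2
  have b1 : Jet.b =O[𝓟 (Far A)] fun _ => (1 : ℝ) := isBigO_of_abs_le (C := A) fun p hp => by
    rw [abs_of_nonneg hp.2.2.2.2.2.2.2.2.1]; simpa using hp.2.2.2.2.2.2.2.2.2.1
  have bb : (fun p : Jet => p.b ^ 2) =O[𝓟 (Far A)] Jet.q := isBigO_of_abs_le (C := A) fun p hp => by
    rw [abs_of_nonneg (sq_nonneg _), abs_of_nonneg hp.1]; exact hp.2.2.2.2.2.2.2.2.2.2.1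
  have qB : Jet.q =O[𝓟 (Far A)] Jet.B := isBigO_of_abs_le (C := 1) fun p hp => by
    rw [abs_of_nonneg hp.1, abs_of_nonneg (Bnn p hp), one_mul]
    have := hp.2.2.2.2.2.2.2.2.1
    unfold B; nlinarith [sq_nonneg p.q]
  have qqB : (fun p : Jet => p.q * p.q) =O[𝓟 (Far A)] Jet.B :=
    isBigO_of_abs_le (C := 1) fun p hp => by
      rw [abs_of_nonneg (mul_self_nonneg _), abs_of_nonneg (Bnn p hp), one_mul]
      have := hp.2.2.2.2.2.2.2.2.1; have := hp.1
      unfold B; nlinarith [sq_nonneg p.q]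
  have bB : Jet.b =O[𝓟 (Far A)] Jet.B := isBigO_of_abs_le (C := 1) fun p hp => by
    rw [abs_of_nonneg hp.2.2.2.2.2.2.2.2.1, abs_of_nonneg (Bnn p hp), one_mul]
    have := hp.1
    unfold B; nlinarith [sq_nonneg p.q]
  have qs : (fun p : Jet => p.q * p.s) =O[𝓟 (Far A)] Jet.q := by
    simpa using q.mul (s.trans b1)
  have sq : (fun p : Jet => p.s₁ * p.q) =O[𝓟 (Far A)] Jet.q := by
    simpa using (s₁.trans b1).mul q
  have qsB := (qs.trans qB).add (s₁.trans bB)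
  have hss : (fun p : Jet => p.s ^ 2 + 1 / 12 * p.w ^ 2) =O[𝓟 (Far A)] Jet.q :=
    ((s.pow 2).trans bb).add (((w.pow 2).trans bb).const_mul_left _)
  have h11 : (fun p => c₁₁ p b₁ b₂) =O[𝓟 (Far A)] Jet.B :=
    (((((((q.mul q₁).trans qqB).const_mul_left 7).add ((q₂.trans qB).const_mul_left 5)).sub
      (qsB.const_mul_left b₁)).sub ((s₁.trans bB).const_mul_left (4 * b₁))).add
      ((s₁.trans bB).const_mul_left (2 * b₂)))
  have h01 : (fun p => c₀₁ p b₁ b₂ b₃) =O[𝓟 (Far A)] Jet.B :=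
    ((((sq.const_mul_left (-(8 * b₁))).add (sq.const_mul_left (2 * b₂))).add
      (hss.const_mul_left (2 * b₃)))).trans qB
  obtain ⟨C₁₁, p₁₁, e₁₁⟩ := exists_bound_of_isBigO h11 Bnn
  obtain ⟨C₀₁, p₀₁, e₀₁⟩ := exists_bound_of_isBigO h01 Bnn
  -- The coefficients `c₁₁` and `c₀₁` do not involve `l`, so it can be fixed here. The constants for
  -- `c₀₂` and `c₀₀`, which do involve it, are chosen afterwards.
  set l := C₁₁ + C₀₁ with hl
  have h02 : (fun p => c₀₂ p b₁ l) =O[𝓟 (Far A)] Jet.B :=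
    ((qsB.const_mul_left (2 * b₁)).sub ((s₁.trans bB).const_mul_left (4 * b₁))).sub
      ((isBigO_refl _ _).const_mul_left l)
  obtain ⟨C₀₂, p₀₂, e₀₂⟩ := exists_bound_of_isBigO h02 Bnn
  have Qnn : ∀ p ∈ Far A, 0 ≤ 1 + p.q ^ 4 := fun p h => by positivity
  have mono : ∀ k ≤ 4, (fun p : Jet => p.q ^ k) =O[𝓟 (Far A)] fun p => 1 + p.q ^ 4 :=
    fun k hk => isBigO_of_abs_le (C := 1) fun p hp => by
      have h0 := hp.1
      rw [abs_of_nonneg (by positivity), abs_of_nonneg (by positivity), one_mul]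
      rcases le_total p.q 1 with h | h
      · have := pow_le_one₀ h0 h (n := k)
        have : 0 ≤ p.q ^ 4 := by positivity
        linarith
      · have := pow_le_pow_right₀ h hk
        linarith
  have one : (fun _ : Jet => (1 : ℝ)) =O[𝓟 (Far A)] fun p => 1 + p.q ^ 4 := by
    simpa using mono 0 (by simp)
  have mq : ∀ {f : Jet → ℝ} {k : ℕ}, k ≤ 3 → f =O[𝓟 (Far A)] Jet.q →
      (fun p => p.q ^ k * f p) =O[𝓟 (Far A)] fun p => 1 + p.q ^ 4 := fun {f k} hk hf =>
    ((isBigO_refl (fun p : Jet => p.q ^ k) _).mul hf).trans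
      (by simpa only [pow_succ] using mono (k + 1) (by omega))
  have mq1 : ∀ {f : Jet → ℝ}, f =O[𝓟 (Far A)] Jet.q →
      (fun p => p.q * f p) =O[𝓟 (Far A)] fun p => 1 + p.q ^ 4 := fun hf => by
    simpa using mq (k := 1) (by simp) hf
  have mq0 : ∀ {f : Jet → ℝ}, f =O[𝓟 (Far A)] Jet.q → f =O[𝓟 (Far A)] fun p => 1 + p.q ^ 4 :=
    fun hf => by simpa using mq (k := 0) (by simp) hf
  have hq2 : (fun p : Jet => p.q ^ 2 + p.q₁) =O[𝓟 (Far A)] fun p => p.q ^ 2 + p.q := by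
    refine ((isBigO_refl _ _).trans (isBigO_of_abs_le (C := 1) fun p hp => ?_)).add
      (q₁.trans (isBigO_of_abs_le (C := 1) fun p hp => ?_))
    · have := hp.1
      rw [abs_of_nonneg (by positivity), abs_of_nonneg (by positivity)]; linarith
    · have := hp.1
      rw [abs_of_nonneg (by positivity), abs_of_nonneg (by positivity)]
      linarith [sq_nonneg p.q]
  have q2one : (fun p : Jet => p.q ^ 2 + p.q) =O[𝓟 (Far A)] fun p => 1 + p.q ^ 4 :=
    (mono 2 (by simp)).add (mq0 q)
  have hB' : Jet.B =O[𝓟 (Far A)] fun p => 1 + p.q ^ 2 := by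
    have h1 : (fun p : Jet => p.q) =O[𝓟 (Far A)] fun p => 1 + p.q ^ 2 :=
      isBigO_of_abs_le (C := 1) fun p hp => by
        have := hp.1
        rw [abs_of_nonneg (by positivity), abs_of_nonneg (by positivity)]
        nlinarith [sq_nonneg (p.q - 1)]
    have h2 : (fun p : Jet => p.q ^ 2) =O[𝓟 (Far A)] fun p => 1 + p.q ^ 2 :=
      isBigO_of_abs_le (C := 1) fun p hp => by
        rw [abs_of_nonneg (by positivity), abs_of_nonneg (by positivity)]; linarith
    have h3 : (fun p : Jet => (1 : ℝ)) =O[𝓟 (Far A)] fun p => 1 + p.q ^ 2 :=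
      isBigO_of_abs_le (C := 1) fun p hp => by
        rw [abs_of_nonneg (by positivity), abs_of_nonneg (by positivity)]
        linarith [sq_nonneg p.q]
    exact (h2.add h1).add (b1.trans h3)
  have hBq : (fun p : Jet => p.B * (p.q ^ 2 + p.q₁)) =O[𝓟 (Far A)] fun p => 1 + p.q ^ 4 := by
    refine (hB'.mul hq2).trans (isBigO_of_abs_le (C := 4) fun p hp => ?_)
    have := hp.1
    rw [abs_of_nonneg (by positivity), abs_of_nonneg (by positivity)]
    nlinarith [sq_nonneg (p.q ^ 2 - 1), sq_nonneg (p.q - 1), sq_nonneg (p.q ^ 2 - p.q)]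
  have hB₁q : (fun p : Jet => p.B₁ * p.q) =O[𝓟 (Far A)] fun p => 1 + p.q ^ 4 := by
    have e : (fun p : Jet => p.B₁ * p.q) = fun p : Jet => 2 * (p.q ^ 2 * p.q₁) + p.q * p.q₁ +
      p.b' * p.q := by
      funext p; unfold B₁; ring
    rw [e]
    exact (((mq (k := 2) (by simp) q₁).const_mul_left 2).add (mq1 q₁)).add
      (mq0 (by simpa using (b'.trans b1).mul q))
  have hB₂ : Jet.B₂ =O[𝓟 (Far A)] fun p => 1 + p.q ^ 4 :=
    (((((q₁.pow 2).trans (mono 2 (by simp))).const_mul_left 2).add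
      (by simpa only [mul_assoc] using (mq1 q₂).const_mul_left 2)).add (mq0 q₂)).add
      ((b''.trans b1).trans one)
  -- Derivatives of `q` count as one power of `q`, and `b` counts as bounded; no product here then
  -- exceeds the fourth power.
  have h00 : (fun p => c₀₀ p b₁ b₃ l) =O[𝓟 (Far A)] fun p => 1 + p.q ^ 4 :=
    (((((((((mq (k := 3) (by simp) q₁).const_mul_left (15 / 2)).sub
      ((mq (k := 3) (by simp) q₁).const_mul_left 10)).sub
      ((mq (k := 2) (by simp) q₂).const_mul_left 10)).add
      ((mq (k := 2) (by simp) q₂).const_mul_left (15 / 2))).sub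
      ((mq1 q₃).const_mul_left 5)).sub
      (((q₁.mul q₂).trans (mq1 q)).const_mul_left 10)).sub (mq0 q₄)).sub
      ((((s₁.trans b1).mul (hq2.trans q2one)).trans
        (by simpa using isBigO_refl _ _)).const_mul_left (2 * b₁))).add
      (((hBq.add (hB₁q.const_mul_left 2)).add hB₂).const_mul_left (1 / 2 * l)) |>.add
      ((mq1 hss).const_mul_left (2 * b₃))
  obtain ⟨C₀₀, p₀₀, e₀₀⟩ := exists_bound_of_isBigO h00 Qnn
  set D := C₀₀ + C₀₁ * (2 + A) + C₀₂ ^ 2 * (3 * (2 + A)) with hD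
  have hD0 : 0 ≤ D := by positivity
  refine ⟨l, D + D * (8 * D) ^ 4, by positivity, fun p hp w₁ w₂ => ?_⟩
  have q0 := hp.1
  have b0 := hp.2.2.2.2.2.2.2.2.1
  have hbq := hp.2.2.2.2.2.2.2.2.2.1
  have hbb := hp.2.2.2.2.2.2.2.2.2.2.1
  have B0 := Bnn p hp
  have f₁₁ := mul_le_mul_of_nonneg_right ((le_abs_self _).trans (e₁₁ p hp)) (sq_nonneg w₁)
  have f₀₀ := mul_le_mul_of_nonneg_right ((le_abs_self _).trans (e₀₀ p hp)) (sq_nonneg p.w)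
  have u1 : p.q ≤ 1 + p.q ^ 4 := by nlinarith [sq_nonneg (p.q ^ 2 - 1), sq_nonneg (p.q - 1)]
  have u2 : p.q ^ 2 ≤ 1 + p.q ^ 4 := by nlinarith [sq_nonneg (p.q ^ 2 - 1)]
  have u3 : p.q ^ 3 ≤ 1 + p.q ^ 4 := by
    nlinarith [sq_nonneg (p.q ^ 2 - p.q), sq_nonneg (p.q ^ 2 - 1)]
  have u4 : A ≤ A * (1 + p.q ^ 4) := by
    have : 0 ≤ A * p.q ^ 4 := by positivity
    linarith
  have BQ : p.B ≤ (2 + A) * (1 + p.q ^ 4) := by unfold B; linarith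
  have f₀₁ : p.c₀₁ b₁ b₂ b₃ * (p.w * w₁) ≤
      C₀₁ * p.B * w₁ ^ 2 + C₀₁ * ((2 + A) * (1 + p.q ^ 4)) * p.w ^ 2 := by
    have h1 : p.c₀₁ b₁ b₂ b₃ * (p.w * w₁) ≤ C₀₁ * p.B * (p.w ^ 2 + w₁ ^ 2) := by
      refine (le_abs_self _).trans ?_
      rw [abs_mul]
      refine mul_le_mul (e₀₁ p hp) ?_ (abs_nonneg _) (by positivity)
      rw [abs_le]
      constructor <;> nlinarith [sq_nonneg (p.w - w₁), sq_nonneg (p.w + w₁)]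
    have h2 := mul_le_mul_of_nonneg_right (mul_le_mul_of_nonneg_left BQ p₀₁) (sq_nonneg p.w)
    linarith
  have f₀₂ : p.c₀₂ b₁ l * (p.w * w₂) ≤
      p.q * w₂ ^ 2 + C₀₂ ^ 2 * (3 * (2 + A)) * (1 + p.q ^ 4) * p.w ^ 2 := by
    -- A discriminant condition: the mixed term is absorbed by `q (∂ₓ²w)²` only if `c₀₂²` carries a
    -- factor `q`. In `B²` this is clear except for `b²`, where it is the hypothesis `b² ≤ A q`.
    have h1 : p.c₀₂ b₁ l ^ 2 ≤ 4 * p.q * (C₀₂ ^ 2 * (3 * (p.q ^ 3 + p.q + A))) := by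
      have h2 : p.c₀₂ b₁ l ^ 2 ≤ (C₀₂ * p.B) ^ 2 := by
        rw [← sq_abs]; exact pow_le_pow_left₀ (abs_nonneg _) (e₀₂ p hp) 2
      have h3 : p.B ^ 2 ≤ 3 * p.q * (p.q ^ 3 + p.q + A) := by
        unfold B
        linarith [sq_nonneg (p.q ^ 2 - p.q), sq_nonneg (p.q ^ 2 - p.b), sq_nonneg (p.q - p.b)]
      have h4 := mul_le_mul_of_nonneg_left h3 (sq_nonneg C₀₂)
      have h5 : 0 ≤ C₀₂ ^ 2 * (p.q * (p.q ^ 3 + p.q + A)) := by positivity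
      linarith
    refine (mul_le_of_sq_le q0 (by positivity) h1).trans ?_
    have h2 : p.q ^ 3 + p.q + A ≤ (2 + A) * (1 + p.q ^ 4) := by linarith
    have h3 := mul_le_mul_of_nonneg_right (mul_le_mul_of_nonneg_left h2
      (show 0 ≤ C₀₂ ^ 2 * 3 by positivity)) (sq_nonneg p.w)
    linarith
  have f := mul_le_mul_of_nonneg_right (quartic_le_quintic hD0 q0) (sq_nonneg p.w)
  have e : D * p.q ^ 4 * p.w ^ 2 = C₀₀ * p.q ^ 4 * p.w ^ 2 + C₀₁ * ((2 + A) * p.q ^ 4) * p.w ^ 2 +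
      C₀₂ ^ 2 * (3 * (2 + A)) * p.q ^ 4 * p.w ^ 2 := by rw [hD]; ring
  have e' : D * p.w ^ 2 = C₀₀ * p.w ^ 2 + C₀₁ * (2 + A) * p.w ^ 2 +
      C₀₂ ^ 2 * (3 * (2 + A)) * p.w ^ 2 := by rw [hD]; ring
  have e'' : l * p.B * w₁ ^ 2 = C₁₁ * p.B * w₁ ^ 2 + C₀₁ * p.B * w₁ ^ 2 := by rw [hl]; ring
  unfold R
  clear_value D l
  linarith

end Jet

/-! ### The weighted energy identity -/

/-- The difference of the nonlinear terms of two functions with mean `s` and difference `w`. -/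
noncomputable def nlDiff (b₁ b₂ b₃ : ℝ) (s w : ℕ → ℝ → ℝ) (x : ℝ) : ℝ :=
  b₁ * (s 0 x * w 3 x + w 0 x * s 3 x) + b₂ * (s 1 x * w 2 x + w 1 x * s 2 x) +
    b₃ * (2 * s 0 x * s 1 x * w 0 x + s 0 x ^ 2 * w 1 x + w 0 x ^ 2 * w 1 x / 4)

/-- The jet of the weighted energy identity at a point. -/
def jet (q s w b : ℕ → ℝ → ℝ) (x : ℝ) : Jet :=
  ⟨q 0 x, q 1 x, q 2 x, q 3 x, q 4 x, s 0 x, s 1 x, w 0 x, b 0 x, b 1 x, b 2 x⟩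

section Flux

variable (b₁ b₂ b₃ l : ℝ) (q s w b : ℕ → ℝ → ℝ) (x : ℝ)

/-- The coefficient of `w ∂ₓ²w` in the flux. -/
noncomputable def f₀₂ : ℝ := -2 * (q 0 x ^ 2 + q 1 x) + 2 * b₁ * s 0 x

/-- The coefficient of `(∂ₓw)²` in the flux. -/
noncomputable def f₁₁ : ℝ := 3 * (q 0 x ^ 2 + q 1 x) - b₁ * s 0 x - 4 * q 0 x ^ 2

/-- The coefficient of `w ∂ₓw` in the flux. -/
noncomputable def f₀₁ : ℝ := 2 * (q 0 x ^ 3 + 3 * (q 0 x * q 1 x) + q 2 x) - 4 * b₁ * s 1 x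
  + 2 * b₂ * s 1 x - 5 * q 0 x ^ 3 - l * (q 0 x ^ 2 + q 0 x + b 0 x)

/-- The coefficient of `w²` in the flux. -/
noncomputable def f₀₀ : ℝ :=
  -(q 0 x ^ 4 + 6 * (q 0 x ^ 2 * q 1 x) + 3 * q 1 x ^ 2 + 4 * (q 0 x * q 2 x) + q 3 x)
  + 2 * b₁ * s 2 x - 2 * b₁ * (q 0 x * s 1 x) + 2 * b₃ * (s 0 x ^ 2 + 1 / 12 * w 0 x ^ 2)
  + 15 / 2 * (q 0 x ^ 2 * q 1 x)
  + 1 / 2 * l * ((q 0 x ^ 2 + q 0 x + b 0 x) * q 0 x + (2 * (q 0 x * q 1 x) + q 1 x + b 1 x))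

/-- The flux in the weighted energy identity, up to the factor given by the weight. -/
noncomputable def flux : ℝ :=
  -2 * (w 0 x * w 4 x) + 2 * (q 0 x * (w 0 x * w 3 x)) + 2 * (w 1 x * w 3 x) - w 2 x * w 2 x
    - 4 * (q 0 x * (w 1 x * w 2 x)) + f₀₂ b₁ q s x * (w 0 x * w 2 x)
    + f₁₁ b₁ q s x * (w 1 x * w 1 x) + f₀₁ b₁ b₂ l q s b x * (w 0 x * w 1 x)
    + f₀₀ b₁ b₃ l q s w b x * (w 0 x * w 0 x)

variable {q s w b x}

/-- The terms of total order five in `q` and `∂ₓ` are arranged as a negative square, a spare `-q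
(∂ₓ²w)²` and the excess `9/16 q⁵ w²`. The spare term is kept for the mixed term `w ∂ₓ²w`. The part
of the flux containing `l` trades `B (∂ₓw)²` for `B w ∂ₓ²w` and `w²`, which is legitimate for any
`l`. -/
theorem hasDerivAt_flux {φ : ℝ → ℝ} (hφ : HasDerivAt φ (φ x * q 0 x) x)
    (hq : ∀ j ≤ 3, HasDerivAt (q j) (q (j + 1) x) x) (hs : ∀ j, HasDerivAt (s j) (s (j + 1) x) x)
    (hw : ∀ j, HasDerivAt (w j) (w (j + 1) x) x) (hb : ∀ j < 2, HasDerivAt (b j) (b (j + 1) x) x) :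
    HasDerivAt (fun y => φ y * flux b₁ b₂ b₃ l q s w b y)
      (φ x * (9 / 16 * q 0 x ^ 5 * w 0 x ^ 2
        - 4 * q 0 x * (w 2 x + q 0 x * w 1 x + 5 / 8 * q 0 x ^ 2 * w 0 x) ^ 2
        - q 0 x * w 2 x ^ 2 + (jet q s w b x).R b₁ b₂ b₃ l (w 1 x) (w 2 x)
        - 2 * w 0 x * w 5 x + 2 * w 0 x * nlDiff b₁ b₂ b₃ s w x)) x := by
  have q0 := hq 0 (by simp)
  have q1 := hq 1 (by simp)
  have q2 := hq 2 (by simp)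
  have q3 := hq 3 (by simp)
  have s0 := hs 0
  have s1 := hs 1
  have s2 := hs 2
  have w0 := hw 0
  have w1 := hw 1
  have w2 := hw 2
  have w3 := hw 3
  have w4 := hw 4
  have b0 := hb 0 (by simp)
  have b1 := hb 1 (by simp)
  have d02 : HasDerivAt (fun y => f₀₂ b₁ q s y) _ x :=
    (((q0.fun_pow 2).fun_add q1).const_mul (-2)).fun_add (s0.const_mul (2 * b₁))
  have d11 : HasDerivAt (fun y => f₁₁ b₁ q s y) _ x :=
    ((((q0.fun_pow 2).fun_add q1).const_mul 3).fun_sub (s0.const_mul b₁)).fun_sub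
      ((q0.fun_pow 2).const_mul 4)
  have d01 : HasDerivAt (fun y => f₀₁ b₁ b₂ l q s b y) _ x :=
    (((((((q0.fun_pow 3).fun_add ((q0.fun_mul q1).const_mul 3)).fun_add q2).const_mul 2).fun_sub
      (s1.const_mul (4 * b₁))).fun_add (s1.const_mul (2 * b₂))).fun_sub
      ((q0.fun_pow 3).const_mul 5)).fun_sub
      ((((q0.fun_pow 2).fun_add q0).fun_add b0).const_mul l)
  have d00 : HasDerivAt (fun y => f₀₀ b₁ b₃ l q s w b y) _ x :=
    ((((((((((q0.fun_pow 4).fun_add (((q0.fun_pow 2).fun_mul q1).const_mul 6)).fun_add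
      ((q1.fun_pow 2).const_mul 3)).fun_add ((q0.fun_mul q2).const_mul 4)).fun_add q3).fun_neg).fun_add
      (s2.const_mul (2 * b₁))).fun_sub ((q0.fun_mul s1).const_mul (2 * b₁))).fun_add
      (((s0.fun_pow 2).fun_add ((w0.fun_pow 2).const_mul (1 / 12))).const_mul (2 * b₃))).fun_add
      (((q0.fun_pow 2).fun_mul q1).const_mul (15 / 2))).fun_add
      ((((((q0.fun_pow 2).fun_add q0).fun_add b0).fun_mul q0).fun_add
        ((((q0.fun_mul q1).const_mul 2).fun_add q1).fun_add b1)).const_mul (1 / 2 * l))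
  have d : HasDerivAt (fun y => flux b₁ b₂ b₃ l q s w b y) _ x :=
    ((((((((w0.fun_mul w4).const_mul (-2)).fun_add
      ((q0.fun_mul (w0.fun_mul w3)).const_mul 2)).fun_add
      ((w1.fun_mul w3).const_mul 2)).fun_sub (w2.fun_mul w2)).fun_sub
      ((q0.fun_mul (w1.fun_mul w2)).const_mul 4)).fun_add (d02.fun_mul (w0.fun_mul w2))).fun_add
      (d11.fun_mul (w1.fun_mul w1))).fun_add (d01.fun_mul (w0.fun_mul w1)) |>.fun_add
      (d00.fun_mul (w0.fun_mul w0))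
  refine (hφ.fun_mul d).congr_deriv ?_
  unfold flux f₀₂ f₁₁ f₀₁ f₀₀ Jet.R Jet.c₁₁ Jet.c₀₁ Jet.c₀₂ Jet.c₀₀ Jet.B Jet.B₁ Jet.B₂ jet nlDiff
  simp only [Nat.reduceAdd, zero_add]
  push_cast
  ring

end Flux

theorem memLp_comb {f g : ℝ → ℝ} (hf : MemLp f 2) (hg : MemLp g 2) (a b : ℝ) :
    MemLp (fun x => a * f x + b * g x) 2 ∧ ∫ x, (a * f x + b * g x) ^ 2 ≤
      2 * a ^ 2 * (∫ x, f x ^ 2) + 2 * b ^ 2 * ∫ x, g x ^ 2 := by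
  have h : MemLp (fun x => a * f x + b * g x) 2 := (hf.const_mul a).add (hg.const_mul b)
  refine ⟨h, ?_⟩
  rw [← integral_const_mul, ← integral_const_mul,
    ← integral_add (hf.integrable_sq.const_mul _) (hg.integrable_sq.const_mul _)]
  refine integral_mono h.integrable_sq
    ((hf.integrable_sq.const_mul _).add (hg.integrable_sq.const_mul _)) fun x => ?_
  simp only
  nlinarith [sq_nonneg (a * f x - b * g x)]

/-- Smooth evolutions form a vector space. -/
theorem SmoothEvolution.comb {T : ℝ} {v n v' n' : ℕ → ℝ → ℝ → ℝ} (h : SmoothEvolution T v n)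
    (h' : SmoothEvolution T v' n') (a b : ℝ) :
    SmoothEvolution T (fun j t x => a * v j t x + b * v' j t x)
      (fun j t x => a * n j t x + b * n' j t x) where
  hasDerivAt j t ht x :=
    ((h.hasDerivAt j t ht x).const_mul a).fun_add ((h'.hasDerivAt j t ht x).const_mul b)
  hasDerivAt' j t ht x :=
    ((h.hasDerivAt' j t ht x).const_mul a).fun_add ((h'.hasDerivAt' j t ht x).const_mul b)
  evol j t ht x := (((h.evol j t ht x).const_mul a).fun_add
    ((h'.evol j t ht x).const_mul b)).congr_deriv (by ring)
  bound j := by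
    obtain ⟨C, hC⟩ := h.bound j
    obtain ⟨C', hC'⟩ := h'.bound j
    refine ⟨2 * a ^ 2 * C + 2 * b ^ 2 * C', fun t ht => ?_⟩
    obtain ⟨h1, h2⟩ := memLp_comb (hC t ht).1 (hC' t ht).1 a b
    exact ⟨h1, h2.trans (add_le_add (mul_le_mul_of_nonneg_left (hC t ht).2 (by positivity))
      (mul_le_mul_of_nonneg_left (hC' t ht).2 (by positivity)))⟩
  bound' j := by
    obtain ⟨C, hC⟩ := h.bound' j
    obtain ⟨C', hC'⟩ := h'.bound' j
    refine ⟨2 * a ^ 2 * C + 2 * b ^ 2 * C', fun t ht => ?_⟩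
    obtain ⟨h1, h2⟩ := memLp_comb (hC t ht).1 (hC' t ht).1 a b
    exact ⟨h1, h2.trans (add_le_add (mul_le_mul_of_nonneg_left (hC t ht).2 (by positivity))
      (mul_le_mul_of_nonneg_left (hC' t ht).2 (by positivity)))⟩

/-! ### Good weights and the weighted Gronwall estimate -/

/-- A phase `χ 0` with derivatives `χ j`, and an auxiliary weight `b 0` with derivatives `b 1`,
`b 2`, suited to the weighted energy estimate with weight `exp (a χ)`. -/
structure GoodWeight (A : ℝ) (χ b : ℕ → ℝ → ℝ) : Prop where
  hasDerivAt : ∀ j x, HasDerivAt (χ j) (χ (j + 1) x) x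
  hasDerivAt_b : ∀ j < 2, ∀ x, HasDerivAt (b j) (b (j + 1) x) x
  continuous_b : Continuous (b 2)
  nonneg : ∀ x, 0 ≤ χ 0 x
  slope_nonneg : ∀ x, 0 ≤ χ 1 x
  pow_five_le : ∀ x, χ 1 x ^ 5 ≤ (5 / 4) ^ 5 * χ 0 x
  far : ∀ x, 2 ≤ x → ∀ j ≤ 5, 2 ≤ j → |χ j x| ≤ A * χ 1 x
  near : ∀ x < 2, ∀ j ≤ 5, |χ j x| ≤ A
  bounded : ∀ j, 1 ≤ j → j ≤ 5 → ∃ C, 0 ≤ C ∧ ∀ x, |χ j x| ≤ C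
  b_nonneg : ∀ x, 0 ≤ b 0 x
  b_le : ∀ x, b 0 x ≤ A
  b_deriv_le : ∀ x, |b 1 x| ≤ A * b 0 x ∧ |b 2 x| ≤ A * b 0 x
  b_sq_le : ∀ x, 2 ≤ x → b 0 x ^ 2 ≤ A * χ 1 x

section Jets

variable {A : ℝ} {χ b : ℕ → ℝ → ℝ} {a a₁ a₂ : ℝ} {s w : ℕ → ℝ → ℝ} {x : ℝ}

/-- The summand `A / a₁` is needed only for `b² ≤ A χ'`, which is not homogeneous in `a` and has to
be restated in terms of `q = a χ'`. -/
theorem GoodWeight.jet_mem_far (h : GoodWeight A χ b) (hA : 0 ≤ A) (ha₁ : 0 < a₁) (ha : a₁ ≤ a)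
    (hx : 2 ≤ x) (hs : |s 0 x| ≤ b 0 x) (hs₁ : |s 1 x| ≤ b 0 x) (hw : |w 0 x| ≤ b 0 x) :
    jet (fun j y => a * χ (j + 1) y) s w b x ∈ Jet.Far (A + A / a₁) := by
  have ha0 : 0 < a := ha₁.trans_le ha
  have hle : A ≤ A + A / a₁ := le_add_of_nonneg_right (by positivity)
  have hq0 : 0 ≤ a * χ 1 x := mul_nonneg ha0.le (h.slope_nonneg x)
  have hq : ∀ j ≤ 5, 2 ≤ j → |a * χ j x| ≤ (A + A / a₁) * (a * χ 1 x) := by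
    intro j hj h2
    rw [abs_mul, abs_of_pos ha0]
    have := mul_le_mul_of_nonneg_left (h.far x hx j hj h2) ha0.le
    have := mul_le_mul_of_nonneg_right hle hq0
    linarith
  have hb0 := h.b_nonneg x
  have hb := h.b_deriv_le x
  have hbA := mul_le_mul_of_nonneg_right hle hb0
  refine ⟨hq0, hq 2 (by simp) le_rfl, hq 3 (by simp) (by simp), hq 4 (by simp) (by simp),
    hq 5 le_rfl (by simp), hs, hs₁, hw, hb0, (h.b_le x).trans hle, ?_, hb.1.trans hbA,
    hb.2.trans hbA⟩
  refine (h.b_sq_le x hx).trans ?_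
  have h1 : A * χ 1 x ≤ A / a₁ * (a * χ 1 x) := by
    rw [div_mul_eq_mul_div, le_div_iff₀ ha₁]
    have := mul_le_mul_of_nonneg_left ha (mul_nonneg hA (h.slope_nonneg x))
    linarith
  have := mul_nonneg hA hq0
  simp only [jet]
  linarith

theorem GoodWeight.jet_mem_near (h : GoodWeight A χ b) (hA : 0 ≤ A) (ha₁ : 0 < a₁) (ha : a₁ ≤ a)
    (ha₂ : a ≤ a₂) (hx : x < 2) (hs : |s 0 x| ≤ b 0 x) (hs₁ : |s 1 x| ≤ b 0 x)
    (hw : |w 0 x| ≤ b 0 x) :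
    jet (fun j y => a * χ (j + 1) y) s w b x ∈ Jet.Near (A + A * A + a₂ * A) := by
  have ha0 : 0 < a := ha₁.trans_le ha
  have hq : ∀ j ≤ 5, |a * χ j x| ≤ A + A * A + a₂ * A := by
    intro j hj
    rw [abs_mul, abs_of_pos ha0]
    have := mul_le_mul ha₂ (h.near x hx j hj) (abs_nonneg _) (ha0.le.trans ha₂)
    have := mul_nonneg hA hA
    linarith
  have hb0 := h.b_nonneg x
  have hbA : b 0 x ≤ A + A * A + a₂ * A := by
    have := h.b_le x
    have := mul_nonneg hA hA
    have := mul_nonneg (ha0.le.trans ha₂) hA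
    linarith
  have hb1 : A * b 0 x ≤ A + A * A + a₂ * A := by
    have := mul_le_mul_of_nonneg_left (h.b_le x) hA
    have := mul_nonneg (ha0.le.trans ha₂) hA
    linarith
  refine ⟨hq 1 (by simp), hq 2 (by simp), hq 3 (by simp), hq 4 (by simp), hq 5 le_rfl,
    hs.trans hbA, hs₁.trans hbA, hw.trans hbA, ?_, (h.b_deriv_le x).1.trans hb1,
    (h.b_deriv_le x).2.trans hb1⟩
  simpa only [jet, abs_of_nonneg hb0] using hbA

end Jets

/-- The pointwise form of the weighted energy inequality. -/
theorem exists_pointwise_bound (b₁ b₂ b₃ : ℝ) {A a₁ a₂ : ℝ} (hA : 0 ≤ A) (ha₁ : 0 < a₁) :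
    ∃ l K, 0 ≤ K ∧ ∀ χ b : ℕ → ℝ → ℝ, GoodWeight A χ b → ∀ a : ℝ, a₁ ≤ a → a ≤ a₂ →
      ∀ (s w : ℕ → ℝ → ℝ) (x w₁ w₂ : ℝ), |s 0 x| ≤ b 0 x → |s 1 x| ≤ b 0 x → |w 0 x| ≤ b 0 x →
        Real.exp (a * χ 0 x) * (jet (fun j y => a * χ (j + 1) y) s w b x).R b₁ b₂ b₃ l w₁ w₂ ≤
          Real.exp (a * χ 0 x) * ((K + (a * χ 1 x) ^ 5 / 8) * w 0 x ^ 2 + a * χ 1 x * w₂ ^ 2) +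
            K * (w 0 x ^ 2 + w₁ ^ 2 + w₂ ^ 2) := by
  obtain ⟨l, C, hC, hfar⟩ := Jet.exists_far_bound b₁ b₂ b₃ (A := A + A / a₁) (by positivity)
  obtain ⟨C', hC', hnear⟩ := Jet.exists_near_bound b₁ b₂ b₃ l (A + A * A + a₂ * A)
  -- To the left of `2` the weight is at most `exp (a₂ A)`, so everything there is charged to the
  -- unweighted `H²` norm of `w`.
  refine ⟨l, C + Real.exp (a₂ * A) * C', by positivity, ?_⟩
  intro χ b h a ha ha' s w x w₁ w₂ hs hs₁ hw
  have ha0 : 0 < a := ha₁.trans_le ha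
  have hq0 : 0 ≤ a * χ 1 x := mul_nonneg ha0.le (h.slope_nonneg x)
  have e0 := Real.exp_pos (a * χ 0 x)
  rcases le_or_gt 2 x with hx | hx
  · have h1 := hfar _ (h.jet_mem_far hA ha₁ ha hx hs hs₁ hw) w₁ w₂
    simp only [jet, zero_add] at h1 ⊢
    have h2 : 0 ≤ Real.exp (a₂ * A) * C' * w 0 x ^ 2 := by positivity
    have h3 : 0 ≤ (C + Real.exp (a₂ * A) * C') * (w 0 x ^ 2 + w₁ ^ 2 + w₂ ^ 2) := by positivity
    have h4 := mul_le_mul_of_nonneg_left (h1.trans (show _ ≤ (C + Real.exp (a₂ * A) * C' +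
      (a * χ 1 x) ^ 5 / 8) * w 0 x ^ 2 + a * χ 1 x * w₂ ^ 2 by linarith)) e0.le
    linarith
  · have h1 := hnear _ (h.jet_mem_near hA ha₁ ha ha' hx hs hs₁ hw) w₁ w₂
    simp only [jet, zero_add] at h1 ⊢
    have h2 : Real.exp (a * χ 0 x) ≤ Real.exp (a₂ * A) := by
      refine Real.exp_le_exp.2 (mul_le_mul ha' ?_ (h.nonneg x) (ha0.le.trans ha'))
      exact (le_abs_self _).trans (h.near x hx 0 (by simp))
    have h3 : 0 ≤ C' * (w 0 x ^ 2 + w₁ ^ 2 + w₂ ^ 2) := by positivity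
    have h4 := mul_le_mul_of_nonneg_left h1 e0.le
    have h5 := mul_le_mul_of_nonneg_right h2 h3
    have h6 : 0 ≤ Real.exp (a * χ 0 x) * ((C + Real.exp (a₂ * A) * C' + (a * χ 1 x) ^ 5 / 8) *
      w 0 x ^ 2 + a * χ 1 x * w₂ ^ 2) := by positivity
    have h7 : 0 ≤ C * (w 0 x ^ 2 + w₁ ^ 2 + w₂ ^ 2) := by positivity
    linarith

/-- Fluxes whose weighted coefficients are bounded are dominated. -/
theorem dom_flux {T l b₁ b₂ b₃ : ℝ} {Q φ : ℝ → ℝ → ℝ} {q s w : ℕ → ℝ → ℝ → ℝ} {b : ℕ → ℝ → ℝ}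
    (hq : ∀ j ≤ 3, Bdd T (q j)) (hs : ∀ j, Bdd T (s j)) (hw : ∀ j, Bdd T (w j))
    (hb : ∀ j < 2, Bdd T fun _ x => b j x)
    (h : ∀ i < 5, ∀ j < 5, Dom T Q fun t x => φ t x * w i t x * w j t x) :
    Dom T Q fun t x => φ t x * flux b₁ b₂ b₃ l (fun j => q j t) (fun j => s j t)
      (fun j => w j t) b x := by
  have q0 := hq 0 (by simp)
  have q1 := hq 1 (by simp)
  have q2 := hq 2 (by simp)
  have q3 := hq 3 (by simp)
  have b0 := hb 0 (by simp)
  have b1 := hb 1 (by simp)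
  have d02 : Bdd T fun t x => f₀₂ b₁ (fun j => q j t) (fun j => s j t) x :=
    (((q0.pow_bdd 2).add q1).const_mul (-2)).add ((hs 0).const_mul (2 * b₁))
  have d11 : Bdd T fun t x => f₁₁ b₁ (fun j => q j t) (fun j => s j t) x :=
    ((((q0.pow_bdd 2).add q1).const_mul 3).sub ((hs 0).const_mul b₁)).sub
      ((q0.pow_bdd 2).const_mul 4)
  have d01 : Bdd T fun t x => f₀₁ b₁ b₂ l (fun j => q j t) (fun j => s j t) b x :=
    (((((((q0.pow_bdd 3).add ((q0.mul_bdd q1).const_mul 3)).add q2).const_mul 2).sub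
      ((hs 1).const_mul (4 * b₁))).add ((hs 1).const_mul (2 * b₂))).sub
      ((q0.pow_bdd 3).const_mul 5)).sub
      ((((q0.pow_bdd 2).add q0).add b0).const_mul l)
  have d00 : Bdd T fun t x => f₀₀ b₁ b₃ l (fun j => q j t) (fun j => s j t) (fun j => w j t) b x :=
    ((((((((((q0.pow_bdd 4).add (((q0.pow_bdd 2).mul_bdd q1).const_mul 6)).add
      ((q1.pow_bdd 2).const_mul 3)).add ((q0.mul_bdd q2).const_mul 4)).add q3).neg).add
      ((hs 2).const_mul (2 * b₁))).sub ((q0.mul_bdd (hs 1)).const_mul (2 * b₁))).add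
      ((((hs 0).pow_bdd 2).add (((hw 0).pow_bdd 2).const_mul (1 / 12))).const_mul (2 * b₃))).add
      (((q0.pow_bdd 2).mul_bdd q1).const_mul (15 / 2))).add
      ((((((q0.pow_bdd 2).add q0).add b0).mul_bdd q0).add
        ((((q0.mul_bdd q1).const_mul 2).add q1).add b1)).const_mul (1 / 2 * l))
  have g := (((((((((h 0 (by simp) 4 (by simp)).const_mul (-2)).add
    ((q0.bdd_mul (h 0 (by simp) 3 (by simp))).const_mul 2)).add
    ((h 1 (by simp) 3 (by simp)).const_mul 2)).sub (h 2 (by simp) 2 (by simp))).sub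
    ((q0.bdd_mul (h 1 (by simp) 2 (by simp))).const_mul 4)).add
    (d02.bdd_mul (h 0 (by simp) 2 (by simp)))).add (d11.bdd_mul (h 1 (by simp) 1 (by simp)))).add
    (d01.bdd_mul (h 0 (by simp) 1 (by simp)))).add (d00.bdd_mul (h 0 (by simp) 0 (by simp)))
  obtain ⟨K, hK, hK'⟩ := g
  refine ⟨K, hK, fun t ht x => ?_⟩
  refine le_trans (le_of_eq ?_) (hK' t ht x)
  congr 1
  unfold flux
  ring

/-- The weighted energy inequality for the difference of two evolutions. -/
theorem exists_weighted_growth (b₁ b₂ b₃ : ℝ) {A a₁ a₂ : ℝ} (hA : 0 ≤ A) (ha₁ : 0 < a₁) :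
    ∃ K, 0 ≤ K ∧ ∀ (χ b : ℕ → ℝ → ℝ), GoodWeight A χ b → ∀ (T : ℝ) (a a' : ℝ → ℝ) (A' : ℝ),
      (∀ t ∈ Icc 0 T, a₁ ≤ a t ∧ a t ≤ a₂ ∧ HasDerivWithinAt a (a' t) (Icc 0 T) t ∧
        |a' t| ≤ A' ∧ a' t ≤ -(11 / 16 * (5 / 4) ^ 5 * a t ^ 5)) →
      ∀ w m s m' : ℕ → ℝ → ℝ → ℝ, SmoothEvolution T w m → SmoothEvolution T s m' →
      (∀ t ∈ Icc 0 T, ∀ x, |s 0 t x| ≤ b 0 x ∧ |s 1 t x| ≤ b 0 x ∧ |w 0 t x| ≤ b 0 x) →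
      ∀ D : ℝ, (∀ t ∈ Icc 0 T, (∫ x, w 0 t x ^ 2) + (∫ x, w 1 t x ^ 2) + ∫ x, w 2 t x ^ 2 ≤ D) →
      (∀ j < 5, ∃ C, ∀ t ∈ Icc 0 T, MemLp (fun x => Real.exp (a t * χ 0 x) * w j t x) 2 ∧
        ∫ x, (Real.exp (a t * χ 0 x) * w j t x) ^ 2 ≤ C) →
      ∀ F : ℝ, (∀ t ∈ Icc 0 T, ∫ x, (Real.exp (a t * χ 0 x) * w 0 t x) ^ 2 ≤ F) →
      ∀ (ε : ℝ) (e : ℝ → ℝ → ℝ), 0 < ε →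
      (∀ t ∈ Icc 0 T, ∀ x,
        e t x = nlDiff b₁ b₂ b₃ (fun j => s j t) (fun j => w j t) x - m 0 t x) →
      (∀ t ∈ Icc 0 T, MemLp (e t) 2 ∧ ∫ x, e t x ^ 2 ≤ ε ^ 2) →
      ∀ t ∈ Icc 0 T, ∫ x, Real.exp (a t * χ 0 x) * w 0 t x ^ 2 ≤
        Real.exp (K * t) * ((∫ x, Real.exp (a 0 * χ 0 x) * w 0 0 x ^ 2) +
          (K * D + ε * (F + 1)) * t) := by
  obtain ⟨l, K, hK, hpt⟩ := exists_pointwise_bound b₁ b₂ b₃ (A := A) (a₁ := a₁) (a₂ := a₂) hA ha₁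
  refine ⟨K, hK, fun χ b hχ T a a' A' ha w m s m' hw hs hb D hD hφw F hF ε e hε he heε t ht => ?_⟩
  have h0T : (0 : ℝ) ∈ Icc 0 T := ⟨le_rfl, ht.1.trans ht.2⟩
  have hD0 : 0 ≤ D := by
    have p0 : 0 ≤ ∫ x, w 0 0 x ^ 2 := integral_nonneg fun _ => sq_nonneg _
    have p1 : 0 ≤ ∫ x, w 1 0 x ^ 2 := integral_nonneg fun _ => sq_nonneg _
    have p2 : 0 ≤ ∫ x, w 2 0 x ^ 2 := integral_nonneg fun _ => sq_nonneg _
    linarith [hD 0 h0T]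
  have hF0 : 0 ≤ F := (integral_nonneg fun _ => sq_nonneg _).trans (hF 0 h0T)
  set φ : ℝ → ℝ → ℝ := fun t x => Real.exp (a t * χ 0 x) with hφ
  set q : ℕ → ℝ → ℝ → ℝ := fun j t x => a t * χ (j + 1) x with hq
  have ha₂ : 0 ≤ a₂ := ha₁.le.trans ((ha 0 h0T).1.trans (ha 0 h0T).2.1)
  have hA' : 0 ≤ A' := (abs_nonneg _).trans (ha 0 h0T).2.2.2.1
  have abdd : Bdd T fun t _ => a t := ⟨a₂, ha₂, fun t ht x => by
    rw [abs_of_nonneg (ha₁.le.trans (ha t ht).1), mul_one]; exact (ha t ht).2.1⟩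
  have qbdd : ∀ j ≤ 3, Bdd T (q j) := by
    intro j hj
    obtain ⟨C, hC, hC'⟩ := hχ.bounded (j + 1) (by omega) (by omega)
    exact abdd.mul_bdd ⟨C, hC, fun t _ x => by rw [mul_one]; exact hC' x⟩
  have bbdd : ∀ j < 2, Bdd T fun _ x => b j x := by
    intro j hj
    refine ⟨A + A * A, by positivity, fun t _ x => ?_⟩
    have h1 := hχ.b_le x
    have h0 := hχ.b_nonneg x
    have h2 := (hχ.b_deriv_le x).1
    have h3 := mul_le_mul_of_nonneg_left h1 hA
    have h4 := mul_nonneg hA hA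
    rw [mul_one]
    interval_cases j
    · rw [abs_of_nonneg h0]; linarith
    · linarith
  choose! Cφ hCφ using hφw
  choose C hC using hw.bound
  set Q : ℝ → ℝ → ℝ := fun t x => ∑ j ∈ Finset.range 5, ((φ t x * w j t x) ^ 2 + w j t x ^ 2)
    with hQ
  have hQi : ∀ t ∈ Icc 0 T, Integrable (Q t) ∧ ∫ x, Q t x ≤ ∑ j ∈ Finset.range 5, (Cφ j + C j) := by
    intro t ht
    have i : ∀ j ∈ Finset.range 5, Integrable fun x => (φ t x * w j t x) ^ 2 + w j t x ^ 2 :=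
      fun j hj => (hCφ j (Finset.mem_range.1 hj) t ht).1.integrable_sq.fun_add
        (hC j t ht).1.integrable_sq
    refine ⟨integrable_finsetSum _ i, ?_⟩
    simp only [hQ]
    rw [integral_finsetSum _ i]
    refine Finset.sum_le_sum fun j hj => ?_
    rw [integral_add (hCφ j (Finset.mem_range.1 hj) t ht).1.integrable_sq
      (hC j t ht).1.integrable_sq]
    exact add_le_add (hCφ j (Finset.mem_range.1 hj) t ht).2 (hC j t ht).2
  have hQ1 : ∀ j < 5, ∀ t ∈ Icc 0 T, ∀ x, (φ t x * w j t x) ^ 2 ≤ Q t x ∧ w j t x ^ 2 ≤ Q t x := by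
    intro j hj t _ x
    have := Finset.single_le_sum (f := fun j => (φ t x * w j t x) ^ 2 + w j t x ^ 2)
      (fun _ _ => by positivity) (Finset.mem_range.2 hj)
    constructor
    · linarith [sq_nonneg (w j t x)]
    · linarith [sq_nonneg (φ t x * w j t x)]
  have χc : ∀ j, Continuous (χ j) := fun j => hasDerivAt_continuous (hχ.hasDerivAt j)
  have bc : ∀ j < 2, Continuous (b j) := fun j hj => hasDerivAt_continuous (hχ.hasDerivAt_b j hj)
  set G : ℝ → ℝ → ℝ := fun t x => φ t x * flux b₁ b₂ b₃ l (fun j => q j t) (fun j => s j t)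
      (fun j => w j t) b x with hG
  have hGdom : Dom T Q G := dom_flux qbdd hs.bdd hw.bdd bbdd fun i hi j hj =>
    Dom.mul_of_sq_le (fun t ht x => (hQ1 i hi t ht x).1) fun t ht x => (hQ1 j hj t ht x).2
  set Gx : ℝ → ℝ → ℝ := fun t x => φ t x * (9 / 16 * q 0 t x ^ 5 * w 0 t x ^ 2
        - 4 * q 0 t x * (w 2 t x + q 0 t x * w 1 t x + 5 / 8 * q 0 t x ^ 2 * w 0 t x) ^ 2
        - q 0 t x * w 2 t x ^ 2 + (jet (fun j => q j t) (fun j => s j t) (fun j => w j t) b x).R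
          b₁ b₂ b₃ l (w 1 t x) (w 2 t x) - 2 * w 0 t x * w 5 t x
        + 2 * w 0 t x * nlDiff b₁ b₂ b₃ (fun j => s j t) (fun j => w j t) x) with hGx
  have hGd : ∀ t ∈ Icc 0 T, ∀ x, HasDerivAt (G t) (Gx t x) x := by
    intro t ht x
    refine hasDerivAt_flux b₁ b₂ b₃ l ?_ (fun j _ => ?_) (fun j => hs.hasDerivAt j t ht x)
      (fun j => hw.hasDerivAt j t ht x) fun j hj => hχ.hasDerivAt_b j hj x
    · exact ((hχ.hasDerivAt 0 x).const_mul (a t)).exp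
    · exact (hχ.hasDerivAt (j + 1) x).const_mul (a t)
  have hGc : ∀ t ∈ Icc 0 T, Continuous (G t) := fun t ht => hasDerivAt_continuous (hGd t ht)
  obtain ⟨CG, hCG⟩ := hGdom.integral_le hGc hQi
  -- The source: the part controlled by the unweighted norms, and the mollification error. The
  -- latter is paired with `φ w` with its full weight, which is why the doubled weight must be
  -- integrable; its size `F` matters little, being multiplied by `ε`.
  set S : ℝ → ℝ → ℝ := fun t x => K * (w 0 t x ^ 2 + w 1 t x ^ 2 + w 2 t x ^ 2) +
    2 * (φ t x * w 0 t x) * e t x with hS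
  set Ψt : ℝ → ℝ → ℝ := fun t x => φ t x * (a' t * χ 0 x * w 0 t x ^ 2 +
    2 * w 0 t x * (w 5 t x - m 0 t x)) with hΨt
  obtain ⟨k0, hk0, hk0'⟩ := (hw.bdd 0).pow_bdd 2
  obtain ⟨k1, hk1, hk1'⟩ := ((hw.bdd 0).const_mul 2).mul_bdd ((hw.bdd 5).sub (hw.bdd' 0))
  have φc : ∀ t, Continuous (φ t) := fun t => by
    have := χc 0
    simp only [hφ]; fun_prop
  have wc := fun j => @SmoothEvolution.continuous _ _ _ hw j
  have hfin := integral_le_of_evolution (T := T) (K₁ := K) (K₂ := K * D + ε * (F + 1)) (CG := CG)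
    hK (by positivity) (Ψ := fun t x => φ t x * w 0 t x ^ 2) (Ψt := Ψt) (G := G)
    (Gx := Gx) (S := S)
    (Cb := fun x => Real.exp (a₂ * χ 0 x) * (k0 + A' * χ 0 x * k0 + k1))
    ?_ ?_ ?_ ?_ ?_ ?_ hGd ?_ hCG ?_ ?_ t ht
  · exact hfin
  · have := χc 0
    fun_prop
  · intro t ht
    have := wc 0 ht; have := φc t
    fun_prop
  · intro t ht
    have := wc 0 ht; have := wc 5 ht; have := φc t; have := hw.continuous' 0 ht; have := χc 0
    simp only [hΨt]
    fun_prop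
  · intro t ht x
    have c0 := hχ.nonneg x
    have e1 : φ t x ≤ Real.exp (a₂ * χ 0 x) :=
      Real.exp_le_exp.2 (mul_le_mul_of_nonneg_right (ha t ht).2.1 c0)
    have e0 : 0 < φ t x := Real.exp_pos _
    have w0 := hk0' t ht x
    have w1 := hk1' t ht x
    simp only [mul_one] at w0 w1
    have p0 : 0 ≤ A' * χ 0 x * k0 := by positivity
    constructor
    · rw [abs_mul, abs_of_pos e0]
      exact mul_le_mul e1 (by linarith) (abs_nonneg _) (Real.exp_pos _).le
    · simp only [hΨt]
      rw [abs_mul, abs_of_pos e0]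
      refine mul_le_mul e1 ((abs_add_le _ _).trans ?_) (abs_nonneg _) (Real.exp_pos _).le
      have : |a' t * χ 0 x * w 0 t x ^ 2| ≤ A' * χ 0 x * k0 := by
        rw [abs_mul, abs_mul, abs_of_nonneg c0]
        exact mul_le_mul (mul_le_mul_of_nonneg_right (ha t ht).2.2.2.1 c0) w0 (abs_nonneg _)
          (by positivity)
      linarith
  · intro t ht x
    have e0 := hw.evol 0 t ht x
    refine ((((ha t ht).2.2.1.mul_const (χ 0 x)).exp).fun_mul (e0.fun_pow 2)).congr_deriv ?_
    simp only [hΨt, hφ, zero_add]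
    push_cast; ring
  · intro t ht
    have i : Integrable fun x => φ t x * w 0 t x * w 0 t x :=
      (hCφ 0 (by simp) t ht).1.integrable_mul (hw.memLp 0 ht)
    exact i.congr (Eventually.of_forall fun x => by simp only; ring)
  · intro t ht
    have q' : ∀ j, Continuous (q j t) := fun j => continuous_const.mul (χc (j + 1))
    have := q' 0; have := q' 1; have := q' 2; have := q' 3; have := q' 4
    have := wc 0 ht; have := wc 1 ht; have := wc 2 ht; have := wc 3 ht; have := wc 5 ht
    have := hs.continuous 0 ht; have := hs.continuous 1 ht; have := hs.continuous 2 ht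
    have := hs.continuous 3 ht
    have := bc 0 (by simp); have := bc 1 (by simp); have := φc t
    have := hχ.continuous_b
    simp only [hGx, Jet.R, Jet.c₁₁, Jet.c₀₁, Jet.c₀₂, Jet.c₀₀, Jet.B, Jet.B₁, Jet.B₂, jet, nlDiff]
    fun_prop
  · intro t ht
    have m0 := (hw.memLp 0 ht).integrable_sq
    have m1 := (hw.memLp 1 ht).integrable_sq
    have m2 := (hw.memLp 2 ht).integrable_sq
    have mφ := (hCφ 0 (by simp) t ht).1
    have me := (heε t ht).1
    have i1 : Integrable fun x => K * (w 0 t x ^ 2 + w 1 t x ^ 2 + w 2 t x ^ 2) :=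
      ((m0.fun_add m1).fun_add m2).const_mul K
    have i2 : Integrable fun x => ε * (φ t x * w 0 t x) ^ 2 + ε⁻¹ * e t x ^ 2 :=
      (mφ.integrable_sq.const_mul ε).fun_add (me.integrable_sq.const_mul ε⁻¹)
    have i3 : Integrable fun x => 2 * (φ t x * w 0 t x) * e t x := by
      have : Integrable fun x => φ t x * w 0 t x * e t x := mφ.integrable_mul me
      exact (this.const_mul 2).congr (Eventually.of_forall fun x => by simp only; ring)
    have iS : Integrable (S t) := i1.fun_add i3
    have hb' : ∀ x, |S t x| ≤ K * (w 0 t x ^ 2 + w 1 t x ^ 2 + w 2 t x ^ 2) +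
        (ε * (φ t x * w 0 t x) ^ 2 + ε⁻¹ * e t x ^ 2) := by
      intro x
      refine (abs_add_le _ _).trans (add_le_add (le_of_eq (abs_of_nonneg (by positivity))) ?_)
      have h1 : 0 ≤ ε⁻¹ * (ε * |φ t x * w 0 t x| - |e t x|) ^ 2 := by positivity
      have h2 : ε⁻¹ * (ε * |φ t x * w 0 t x| - |e t x|) ^ 2 =
          ε * |φ t x * w 0 t x| ^ 2 + ε⁻¹ * |e t x| ^ 2 - 2 * |φ t x * w 0 t x| * |e t x| := by
        field_simp; ring
      rw [abs_mul, abs_mul 2, abs_two]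
      rw [sq_abs, sq_abs] at h2
      linarith
    refine ⟨iS, (integral_mono iS.abs (i1.fun_add i2) hb').trans ?_⟩
    rw [integral_add i1 i2, integral_const_mul, integral_add (m0.fun_add m1) m2,
      integral_add m0 m1, integral_add (mφ.integrable_sq.const_mul ε)
        (me.integrable_sq.const_mul ε⁻¹), integral_const_mul, integral_const_mul]
    have t1 := mul_le_mul_of_nonneg_left (hD t ht) hK
    have t2 := mul_le_mul_of_nonneg_left (hF t ht) hε.le
    have t3 : ε⁻¹ * ∫ x, e t x ^ 2 ≤ ε := by
      have := mul_le_mul_of_nonneg_left (heε t ht).2 (inv_pos.2 hε).le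
      refine this.trans (le_of_eq ?_)
      field_simp
    linarith
  · intro t ht x
    obtain ⟨u0, u1, u2⟩ := hb t ht x
    have hp := hpt χ b hχ (a t) (ha t ht).1 (ha t ht).2.1 (fun j => s j t) (fun j => w j t) x
      (w 1 t x) (w 2 t x) u0 u1 u2
    have e0 : 0 < φ t x := Real.exp_pos _
    have hat : 0 ≤ a t := ha₁.le.trans (ha t ht).1
    have hq0 : 0 ≤ q 0 t x := mul_nonneg hat (hχ.slope_nonneg x)
    -- Here `χ'⁵ ≤ (5/4)⁵ χ` converts the decrease of `a` into `-11/16 q⁵`, which exactly balances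
    -- `9/16 + 1/8`.
    have h1 : a' t * χ 0 x ≤ -(11 / 16 * q 0 t x ^ 5) := by
      have g1 := mul_le_mul_of_nonneg_right (ha t ht).2.2.2.2 (hχ.nonneg x)
      have g2 := mul_le_mul_of_nonneg_left (hχ.pow_five_le x) (pow_nonneg hat 5)
      have g3 : q 0 t x ^ 5 = a t ^ 5 * χ 1 x ^ 5 := by simp only [hq, zero_add, mul_pow]
      rw [g3]
      linarith
    have h2 := mul_le_mul_of_nonneg_left (mul_le_mul_of_nonneg_right h1 (sq_nonneg (w 0 t x))) e0.le
    have h3 : 0 ≤ φ t x * (4 * q 0 t x *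
        (w 2 t x + q 0 t x * w 1 t x + 5 / 8 * q 0 t x ^ 2 * w 0 t x) ^ 2) := by positivity
    have h4 := he t ht x
    have h5 : φ t x * (2 * w 0 t x * (nlDiff b₁ b₂ b₃ (fun j => s j t) (fun j => w j t) x
      - m 0 t x)) = 2 * (φ t x * w 0 t x) * e t x := by rw [h4]; ring
    change φ t x * (jet (fun j => q j t) (fun j => s j t) (fun j => w j t) b x).R b₁ b₂ b₃ l
      (w 1 t x) (w 2 t x) ≤ φ t x * ((K + q 0 t x ^ 5 / 8) * w 0 t x ^ 2 + q 0 t x * w 2 t x ^ 2) +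
        K * (w 0 t x ^ 2 + w 1 t x ^ 2 + w 2 t x ^ 2) at hp
    simp only [hΨt, hGx, hS]
    generalize (jet (fun j => q j t) (fun j => s j t) (fun j => w j t) b x).R b₁ b₂ b₃ l
      (w 1 t x) (w 2 t x) = r at *
    linarith

/-! ### The phase `x₊^{5/4}` with capped slope, smoothed -/

/-- The function `x₊^{1/4}`. -/
noncomputable def root4 (x : ℝ) : ℝ := max x 0 ^ (1 / 4 : ℝ)

theorem root4_nonneg (x : ℝ) : 0 ≤ root4 x := Real.rpow_nonneg (le_max_right _ _) _

theorem root4_pow_four (x : ℝ) : root4 x ^ 4 = max x 0 := by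
  unfold root4
  rw [← Real.rpow_natCast, ← Real.rpow_mul (le_max_right _ _)]
  norm_num

theorem rpow_five_fourths (x : ℝ) : max x 0 ^ (5 / 4 : ℝ) = root4 x ^ 5 := by
  unfold root4
  rw [← Real.rpow_natCast, ← Real.rpow_mul (le_max_right _ _)]
  norm_num

theorem root4_of_nonpos {x : ℝ} (hx : x ≤ 0) : root4 x = 0 := by
  have := root4_pow_four x
  rw [max_eq_right hx] at this
  exact pow_eq_zero_iff (by norm_num) |>.1 this

theorem root4_continuous : Continuous root4 := by
  unfold root4
  exact (continuous_id.max continuous_const).rpow_const fun x => Or.inr (by norm_num)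

theorem root4_mono : Monotone root4 := fun x y h => by
  unfold root4
  exact Real.rpow_le_rpow (le_max_right _ _) (max_le_max h le_rfl) (by norm_num)

theorem root4_le_of_le_pow {x c : ℝ} (hc : 0 ≤ c) (h : x ≤ c ^ 4) : root4 x ≤ c := by
  refine le_of_pow_le_pow_left₀ (n := 4) (by norm_num) hc ?_
  rw [root4_pow_four]
  exact max_le h (by positivity)

theorem le_root4_of_pow_le {x c : ℝ} (h : c ^ 4 ≤ x) : c ≤ root4 x := by
  refine le_of_pow_le_pow_left₀ (n := 4) (by norm_num) (root4_nonneg x) ?_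
  rw [root4_pow_four]
  exact h.trans (le_max_left _ _)

/-- The tangent inequalities for `x₊^{5/4}`. -/
theorem tangent_le (x y : ℝ) : root4 x ^ 5 + 5 / 4 * root4 x * (y - x) ≤ root4 y ^ 5 := by
  have hX := root4_nonneg x
  have hY := root4_nonneg y
  have h4X := root4_pow_four x
  have h4Y := root4_pow_four y
  have h1 : root4 x * (y - x) ≤ root4 x * (root4 y ^ 4 - root4 x ^ 4) := by
    rcases le_total x 0 with hx | hx
    · simp [root4_of_nonpos hx]
    · refine mul_le_mul_of_nonneg_left ?_ hX
      rw [h4X, h4Y, max_eq_left hx]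
      linarith [le_max_left y 0]
  generalize root4 x = X at *
  generalize root4 y = Y at *
  have h2 : 0 ≤ (Y - X) ^ 2 * (4 * Y ^ 3 + 3 * X * Y ^ 2 + 2 * X ^ 2 * Y + X ^ 3) := by positivity
  linarith

/-- With `X`, `Y` the fourth roots, the gap between `Y⁵` and its tangent in the variable `X⁴` is a
quarter of the expression in `h6`, hence at most `(Y - X)(Y⁴ - X⁴) ≤ 1`. Passing from `y₊ - x₊` to
`y - x` costs at most `5/4` more; the total is `9/4`. -/
theorem le_tangent {x y : ℝ} (h : |x - y| ≤ 1) :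
    root4 y ^ 5 ≤ root4 x ^ 5 + 9 / 4 + 5 / 4 * root4 x * (y - x) := by
  have hX := root4_nonneg x
  have hY := root4_nonneg y
  have h4X := root4_pow_four x
  have h4Y := root4_pow_four y
  obtain ⟨ha, hb⟩ := abs_le.1 h
  have h1 : root4 x * (root4 y ^ 4 - root4 x ^ 4) ≤ root4 x * (y - x) + 1 := by
    rcases le_total x 0 with hx | hx
    · simp [root4_of_nonpos hx]
    · rw [h4X, h4Y, max_eq_left hx]
      rcases le_total y 0 with hy | hy
      · rw [max_eq_right hy]
        have : root4 x ≤ 1 := root4_le_of_le_pow zero_le_one (by linarith)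
        nlinarith
      · rw [max_eq_left hy]; linarith
  have h2 : |root4 y ^ 4 - root4 x ^ 4| ≤ 1 := by
    rw [h4X, h4Y]
    refine (abs_max_sub_max_le_abs _ _ _).trans ?_
    rw [abs_sub_comm]; exact h
  generalize root4 x = X at *
  generalize root4 y = Y at *
  have h3 : |Y - X| ^ 4 ≤ 1 := by
    refine le_trans ?_ h2
    have e : Y ^ 4 - X ^ 4 = (Y - X) * (Y ^ 3 + Y ^ 2 * X + Y * X ^ 2 + X ^ 3) := by ring
    rw [e, abs_mul, pow_succ']
    refine mul_le_mul_of_nonneg_left ?_ (abs_nonneg _)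
    rw [abs_of_nonneg (a := Y ^ 3 + _ + _ + _) (by positivity)]
    have : |Y - X| ≤ max Y X := abs_sub_le_of_nonneg_of_le hY (le_max_left _ _) hX (le_max_right _ _)
    have h5 := pow_le_pow_left₀ (abs_nonneg _) this 3
    refine h5.trans ?_
    have p1 : 0 ≤ Y ^ 3 := by positivity
    have p2 : 0 ≤ X ^ 3 := by positivity
    have p3 : 0 ≤ Y ^ 2 * X := by positivity
    have p4 : 0 ≤ Y * X ^ 2 := by positivity
    rcases max_cases Y X with ⟨e, _⟩ | ⟨e, _⟩ <;> rw [e] <;> linarith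
  have h4 : |Y - X| ≤ 1 := by
    have : |Y - X| ^ 4 ≤ 1 ^ 4 := by rw [one_pow]; exact h3
    exact le_of_pow_le_pow_left₀ (by norm_num) zero_le_one this
  have h5 : (Y - X) * (Y ^ 4 - X ^ 4) ≤ 1 := by
    refine (le_abs_self _).trans ?_
    rw [abs_mul]
    exact mul_le_one₀ h4 (abs_nonneg _) h2
  have h6 : (Y - X) ^ 2 * (4 * Y ^ 3 + 3 * X * Y ^ 2 + 2 * X ^ 2 * Y + X ^ 3) ≤
      4 * ((Y - X) * (Y ^ 4 - X ^ 4)) := by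
    have : 0 ≤ (Y - X) ^ 2 * (X * Y ^ 2 + 2 * X ^ 2 * Y + 3 * X ^ 3) := by positivity
    linarith
  linarith

/-- An admissible upper bound for the slope of the phase. -/
structure IsCap (h : ℝ → ℝ) : Prop where
  continuous : Continuous h
  antitone : Antitone h
  pos : ∀ x, 0 < h x
  ratio : ∀ y z, 1 ≤ y → 1 ≤ z → z ≤ 3 * y → h y ≤ 9 * h z

/-- The capped slope. -/
noncomputable def slope (h : ℝ → ℝ) (x : ℝ) : ℝ := min (root4 x) (h x)

/-- The phase before smoothing. -/
noncomputable def phase₀ (h : ℝ → ℝ) (x : ℝ) : ℝ := 5 / 4 * ∫ y in 0..x, slope h y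

/-- The derivatives of the smoothed phase. -/
noncomputable def phase (h : ℝ → ℝ) (j : ℕ) : ℝ → ℝ := cv (iteratedDeriv j (moll 0)) (phase₀ h)

theorem moll_zero_isMollifier : IsMollifier 1 (moll 0) := by simpa using moll_isMollifier 0

/-- The `L¹` norm of a derivative of the mollifier. -/
noncomputable def mollNorm (j : ℕ) : ℝ := ∫ y, |iteratedDeriv j (moll 0) y|

theorem mollNorm_nonneg (j : ℕ) : 0 ≤ mollNorm j := integral_nonneg fun _ => abs_nonneg _

theorem abs_cv_le {k f : ℝ → ℝ} {δ C x : ℝ} (hk : Continuous k) (hc : HasCompactSupport k)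
    (hz : ∀ x, δ < |x| → k x = 0) (hf : ∀ y, |x - y| ≤ δ → |f y| ≤ C) :
    |cv k f x| ≤ (∫ y, |k y|) * C := by
  have hi : Integrable fun y => |k y| := (hk.integrable_of_hasCompactSupport hc).abs
  unfold cv
  rw [← integral_sub_left_eq_self (fun y => |k y|) volume x, ← integral_mul_const,
    ← Real.norm_eq_abs]
  refine norm_integral_le_of_norm_le ((hi.comp_sub_left x).mul_const C)
    (Eventually.of_forall fun y => ?_)
  rw [Real.norm_eq_abs, abs_mul]
  by_cases hy : |x - y| ≤ δ
  · exact mul_le_mul_of_nonneg_left (hf y hy) (abs_nonneg _)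
  · simp [hz _ (not_le.1 hy)]

theorem abs_cv_moll_le {f : ℝ → ℝ} {C x : ℝ} (j : ℕ) (hf : ∀ y, |x - y| ≤ 1 → |f y| ≤ C) :
    |cv (iteratedDeriv j (moll 0)) f x| ≤ mollNorm j * C :=
  abs_cv_le (contDiff_iteratedDeriv moll_zero_isMollifier.smooth j).continuous
    (hasCompactSupport_iteratedDeriv moll_zero_isMollifier.hasCompactSupport j)
    (moll_zero_isMollifier.iteratedDeriv_zero_of_le j) hf

/-- Evenness kills the odd part. Tangent lines therefore pass through the smoothing unchanged, so
convex functions can be compared with their mollifications. -/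
theorem IsMollifier.cv_affine {δ : ℝ} {η : ℝ → ℝ} (h : IsMollifier δ η) (c d x : ℝ) :
    cv η (fun y => c + d * (y - x)) x = c := by
  have h1 : cv η (fun y => c + d * (y - x)) x = ∫ y, η y * (c + d * -y) := by
    unfold cv
    rw [← integral_sub_left_eq_self (fun y => η y * (c + d * -y)) volume x]
    exact integral_congr_ae (Eventually.of_forall fun y => by simp only; ring)
  have i0 : Integrable fun y => η y * c :=
    (h.smooth.continuous.integrable_of_hasCompactSupport h.hasCompactSupport).mul_const c
  have i1 : Integrable fun y => η y * (d * -y) :=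
    (h.smooth.continuous.mul (by fun_prop)).integrable_of_hasCompactSupport
      h.hasCompactSupport.mul_right
  have h2 : ∫ y, η y * (d * -y) = 0 := by
    have := integral_neg_eq_self (fun y => η y * (d * -y)) volume
    have e : ∫ y, η (-y) * (d * - -y) = -∫ y, η y * (d * -y) := by
      rw [← integral_neg]
      exact integral_congr_ae (Eventually.of_forall fun y => by simp only [h.even]; ring)
    linarith
  rw [h1]
  simp only [mul_add]
  rw [integral_add i0 i1, h2, integral_mul_const, h.integral]
  ring

namespace IsCap

variable {h : ℝ → ℝ} (hh : IsCap h)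
include hh

theorem slope_continuous : Continuous (slope h) := root4_continuous.min hh.continuous

theorem slope_nonneg (x : ℝ) : 0 ≤ slope h x := le_min (root4_nonneg x) (hh.pos x).le

omit hh in
theorem slope_le (x : ℝ) : slope h x ≤ root4 x := min_le_left _ _

theorem hasDerivAt_phase₀ (x : ℝ) : HasDerivAt (phase₀ h) (5 / 4 * slope h x) x :=
  (intervalIntegral.integral_hasDerivAt_right
    (hh.slope_continuous.intervalIntegrable _ _)
    (hh.slope_continuous.stronglyMeasurableAtFilter _ _)
    hh.slope_continuous.continuousAt).const_mul _

theorem phase₀_continuous : Continuous (phase₀ h) := hasDerivAt_continuous hh.hasDerivAt_phase₀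

theorem slope_of_nonpos {x : ℝ} (hx : x ≤ 0) : slope h x = 0 :=
  le_antisymm ((slope_le x).trans (root4_of_nonpos hx).le) (hh.slope_nonneg x)

theorem phase₀_mono : Monotone (phase₀ h) :=
  monotone_of_hasDerivAt_nonneg hh.hasDerivAt_phase₀ fun x => by
    have := hh.slope_nonneg x
    simp only [Pi.zero_apply]
    positivity

theorem phase₀_of_nonpos {x : ℝ} (hx : x ≤ 0) : phase₀ h x = 0 := by
  unfold phase₀
  rw [intervalIntegral.integral_congr (g := fun _ => 0) fun y hy => ?_]
  · simp
  · rw [uIcc_of_ge hx] at hy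
    exact hh.slope_of_nonpos hy.2

theorem phase₀_nonneg (x : ℝ) : 0 ≤ phase₀ h x := by
  rcases le_total x 0 with hx | hx
  · exact (hh.phase₀_of_nonpos hx).ge
  · exact (hh.phase₀_of_nonpos le_rfl).ge.trans (hh.phase₀_mono hx)

omit hh in
theorem integral_root4 {x : ℝ} (hx : 0 ≤ x) : 5 / 4 * ∫ y in 0..x, root4 y = root4 x ^ 5 := by
  have e : ∫ y in 0..x, root4 y = ∫ y in 0..x, y ^ (1 / 4 : ℝ) := by
    refine intervalIntegral.integral_congr fun y hy => ?_
    rw [uIcc_of_le hx] at hy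
    simp only [root4, max_eq_left hy.1]
  rw [e, integral_rpow (Or.inl (by norm_num)), ← rpow_five_fourths, max_eq_left hx,
    Real.zero_rpow (by norm_num)]
  norm_num
  ring

theorem phase₀_le (x : ℝ) : phase₀ h x ≤ root4 x ^ 5 := by
  rcases le_total x 0 with hx | hx
  · rw [hh.phase₀_of_nonpos hx]
    exact pow_nonneg (root4_nonneg x) 5
  · rw [← integral_root4 hx]
    unfold phase₀
    refine mul_le_mul_of_nonneg_left (intervalIntegral.integral_mono_on hx
      (hh.slope_continuous.intervalIntegrable _ _) (root4_continuous.intervalIntegrable _ _)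
      fun y _ => slope_le y) (by norm_num)

theorem le_phase₀ {x : ℝ} (hx : ∀ y ≤ x, root4 y ≤ h y) : root4 x ^ 5 ≤ phase₀ h x := by
  rcases le_total x 0 with h0 | h0
  · rw [root4_of_nonpos h0, hh.phase₀_of_nonpos h0]; norm_num
  · rw [← integral_root4 h0]
    unfold phase₀
    refine mul_le_mul_of_nonneg_left (intervalIntegral.integral_mono_on h0
      (root4_continuous.intervalIntegrable _ _) (hh.slope_continuous.intervalIntegrable _ _)
      fun y hy => le_min le_rfl (hx y hy.2)) (by norm_num)

/-- Let `m` be the slope at `x`, so `m⁴ ≤ x`. The cap is decreasing and at least `m` at `x`, so it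
is inactive on `[0, m⁴]`, where the phase reaches `m⁵`; after that it only increases. -/
theorem slope_pow_five_le (x : ℝ) : slope h x ^ 5 ≤ phase₀ h x := by
  set m := slope h x with hm
  have hm0 : 0 ≤ m := hh.slope_nonneg x
  rcases le_total x 0 with hx | hx
  · rw [hm, hh.slope_of_nonpos hx, hh.phase₀_of_nonpos hx]; norm_num
  have hmx : m ^ 4 ≤ x := by
    have := pow_le_pow_left₀ hm0 (slope_le (h := h) x) 4
    rwa [root4_pow_four, max_eq_left hx] at this
  have h1 : root4 (m ^ 4) = m :=
    le_antisymm (root4_le_of_le_pow hm0 le_rfl) (le_root4_of_pow_le le_rfl)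
  have h2 : root4 (m ^ 4) ^ 5 ≤ phase₀ h (m ^ 4) := hh.le_phase₀ fun y hy => by
    calc root4 y ≤ root4 (m ^ 4) := root4_mono hy
      _ = m := h1
      _ ≤ h x := min_le_right _ _
      _ ≤ h y := hh.antitone (hy.trans hmx)
  rw [h1] at h2
  exact h2.trans (hh.phase₀_mono hmx)

theorem locallyIntegrable_phase₀ : LocallyIntegrable (phase₀ h) :=
  hh.phase₀_continuous.locallyIntegrable

theorem hasDerivAt_phase (j : ℕ) (x : ℝ) : HasDerivAt (phase h j) (phase h (j + 1) x) x :=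
  cv_hasDerivAt moll_zero_isMollifier.smooth moll_zero_isMollifier.hasCompactSupport
    hh.locallyIntegrable_phase₀ j x

theorem phase_succ (j : ℕ) :
    phase h (j + 1) = cv (iteratedDeriv j (moll 0)) fun x => 5 / 4 * slope h x := by
  refine cv_weakDeriv moll_zero_isMollifier.smooth moll_zero_isMollifier.hasCompactSupport
    ⟨hh.locallyIntegrable_phase₀, (continuous_const.mul hh.slope_continuous).locallyIntegrable,
      fun φ hφ hc => ?_⟩ j
  have hd : ∀ x, HasDerivAt φ (iteratedDeriv 1 φ x) x := fun x => by
    rw [iteratedDeriv_one]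
    exact (hφ.differentiable (by simp) x).hasDerivAt
  have c1 : Continuous (iteratedDeriv 1 φ) := (contDiff_iteratedDeriv hφ 1).continuous
  have i1 : Integrable fun x => phase₀ h x * iteratedDeriv 1 φ x :=
    (hh.phase₀_continuous.mul c1).integrable_of_hasCompactSupport
      (hasCompactSupport_iteratedDeriv hc 1).mul_left
  have i2 : Integrable fun x => 5 / 4 * slope h x * φ x :=
    ((continuous_const.mul hh.slope_continuous).mul hφ.continuous).integrable_of_hasCompactSupport
      hc.mul_left
  have i3 : Integrable fun x => phase₀ h x * φ x :=
    (hh.phase₀_continuous.mul hφ.continuous).integrable_of_hasCompactSupport hc.mul_left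
  have := integral_eq_zero_of_hasDerivAt_of_integrable
    (fun x => (hh.hasDerivAt_phase₀ x).fun_mul (hd x)) (i2.fun_add i1) i3
  rw [integral_add i2 i1] at this
  have e : ∫ x, ((fun _ : ℝ => (5 / 4 : ℝ)) * slope h) x * φ x = ∫ x, 5 / 4 * slope h x * φ x := rfl
  rw [pow_one]
  linarith

omit hh in
theorem phase_zero : phase h 0 = cv (moll 0) (phase₀ h) := by
  unfold phase; rw [iteratedDeriv_zero]

theorem phase_nonneg (x : ℝ) : 0 ≤ phase h 0 x := by
  rw [phase_zero, ← moll_zero_isMollifier.cv_const 0 x]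
  exact moll_zero_isMollifier.cv_mono (continuous_const.locallyIntegrable)
    hh.locallyIntegrable_phase₀ x fun y _ => hh.phase₀_nonneg y

theorem phase_one : phase h 1 = cv (moll 0) fun x => 5 / 4 * slope h x := by
  have := hh.phase_succ 0
  rwa [iteratedDeriv_zero] at this

theorem locallyIntegrable_slope : LocallyIntegrable fun x => 5 / 4 * slope h x :=
  (continuous_const.mul hh.slope_continuous).locallyIntegrable

theorem le_phase_one {c x : ℝ} (hc : ∀ y, |x - y| < 1 → c ≤ 5 / 4 * slope h y) :
    c ≤ phase h 1 x := by
  rw [hh.phase_one, ← moll_zero_isMollifier.cv_const c x]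
  exact moll_zero_isMollifier.cv_mono (continuous_const.locallyIntegrable)
    hh.locallyIntegrable_slope x hc

theorem phase_one_nonneg (x : ℝ) : 0 ≤ phase h 1 x :=
  hh.le_phase_one fun y _ => by have := hh.slope_nonneg y; positivity

theorem phase_le {c x : ℝ} (hc : ∀ y, |x - y| < 1 → phase₀ h y ≤ c) : phase h 0 x ≤ c := by
  rw [phase_zero, ← moll_zero_isMollifier.cv_const c x]
  exact moll_zero_isMollifier.cv_mono hh.locallyIntegrable_phase₀
    (continuous_const.locallyIntegrable) x hc

/-- The excess `9/4` does not depend on the cap, so the initial energy with a truncated weight is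
bounded uniformly in the truncation. -/
theorem phase_le_rpow (x : ℝ) : phase h 0 x ≤ root4 x ^ 5 + 9 / 4 := by
  rw [phase_zero, ← moll_zero_isMollifier.cv_affine (root4 x ^ 5 + 9 / 4) (5 / 4 * root4 x) x]
  refine moll_zero_isMollifier.cv_mono hh.locallyIntegrable_phase₀
    (Continuous.locallyIntegrable (by fun_prop)) x fun y hy => ?_
  exact (hh.phase₀_le y).trans (le_tangent hy.le)

/-- Smoothing a convex function can only raise it, so no loss occurs where the cap is inactive on
the whole averaging window. -/
theorem le_phase {x : ℝ} (hx : ∀ y ≤ x + 1, root4 y ≤ h y) : root4 x ^ 5 ≤ phase h 0 x := by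
  rw [phase_zero, ← moll_zero_isMollifier.cv_affine (root4 x ^ 5) (5 / 4 * root4 x) x]
  refine moll_zero_isMollifier.cv_mono (Continuous.locallyIntegrable (by fun_prop))
    hh.locallyIntegrable_phase₀ x fun y hy => ?_
  refine (tangent_le x y).trans (hh.le_phase₀ fun z hz => hx z ?_)
  have := (abs_lt.1 hy).1
  linarith

/-- Jensen's inequality for the fifth power, written with the tangent line at `m`, the mean of the
slope over the kernel. -/
theorem phase_one_pow_five_le (x : ℝ) : phase h 1 x ^ 5 ≤ (5 / 4) ^ 5 * phase h 0 x := by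
  set m := phase h 1 x / (5 / 4) with hm
  have hm0 : 0 ≤ m := div_nonneg (hh.phase_one_nonneg x) (by norm_num)
  have e : phase h 1 x = 5 / 4 * m := by rw [hm]; field_simp
  have key : ∀ y : ℝ, 0 ≤ y → m ^ 5 + 5 * m ^ 4 * (y - m) ≤ y ^ 5 := by
    intro y hy
    have : 0 ≤ (y - m) ^ 2 * (y ^ 3 + 2 * m * y ^ 2 + 3 * m ^ 2 * y + 4 * m ^ 3) := by positivity
    linarith
  have h1 : cv (moll 0) (fun y => m ^ 5 + 5 * m ^ 4 * (slope h y - m)) x ≤ phase h 0 x := by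
    rw [phase_zero]
    refine moll_zero_isMollifier.cv_mono (Continuous.locallyIntegrable
      (by have := hh.slope_continuous; fun_prop)) hh.locallyIntegrable_phase₀ x fun y _ => ?_
    exact (key _ (hh.slope_nonneg y)).trans (hh.slope_pow_five_le y)
  have h2 : cv (moll 0) (fun y => m ^ 5 + 5 * m ^ 4 * (slope h y - m)) x = m ^ 5 := by
    have c := moll_zero_isMollifier
    have i1 := integrable_kernel_mul c.smooth.continuous c.hasCompactSupport
      hh.locallyIntegrable_slope x
    have i2 := integrable_kernel_mul c.smooth.continuous c.hasCompactSupport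
      (f := fun _ => m ^ 5 - 5 * m ^ 4 * m) continuous_const.locallyIntegrable x
    have h3 : ∫ y, moll 0 (x - y) * (5 / 4 * slope h y) = 5 / 4 * m := by
      rw [← e, hh.phase_one]; rfl
    have h4 := c.cv_const (m ^ 5 - 5 * m ^ 4 * m) x
    unfold cv at h4 ⊢
    have : (fun y => moll 0 (x - y) * (m ^ 5 + 5 * m ^ 4 * (slope h y - m))) =
        fun y => 4 * m ^ 4 * (moll 0 (x - y) * (5 / 4 * slope h y)) +
          moll 0 (x - y) * (m ^ 5 - 5 * m ^ 4 * m) := by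
      funext y; ring
    rw [this, integral_add (i1.const_mul _) i2, integral_const_mul, h3, h4]
    ring
  rw [e, mul_pow]
  exact mul_le_mul_of_nonneg_left (h2.ge.trans h1) (by norm_num)

theorem slope_ratio {y z : ℝ} (hy : 1 ≤ y) (hz : 1 ≤ z) (h1 : y ≤ 3 * z) (h2 : z ≤ 3 * y) :
    slope h y ≤ 9 * slope h z := by
  have e : 9 * slope h z = min (9 * root4 z) (9 * h z) := by
    unfold slope; rw [mul_min_of_nonneg _ _ (by norm_num)]
  rw [e]
  refine min_le_min (root4_le_of_le_pow (by have := root4_nonneg z; positivity) ?_)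
    (hh.ratio y z hy hz h2)
  rw [mul_pow, root4_pow_four, max_eq_left (by linarith)]
  linarith

/-- For `x ≥ 2` any two points within distance one of `x` are at least `1` and have ratio at most
`3`, so by `slope_ratio` the slopes there are comparable. Further derivatives fall on the kernel and
cost only its `L¹` norms. -/
theorem abs_phase_succ_le_far {x : ℝ} (hx : 2 ≤ x) (j : ℕ) :
    |phase h (j + 1) x| ≤ 9 * mollNorm j * phase h 1 x := by
  rw [hh.phase_succ j]
  refine (abs_cv_moll_le j (C := 9 * phase h 1 x) fun y hy => ?_).trans (le_of_eq (by ring))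
  obtain ⟨ya, yb⟩ := abs_le.1 hy
  rw [abs_of_nonneg (by have := hh.slope_nonneg y; positivity)]
  have : 5 / 4 * slope h y / 9 ≤ phase h 1 x := hh.le_phase_one fun z hz => by
    obtain ⟨za, zb⟩ := abs_lt.1 hz
    have := hh.slope_ratio (y := y) (z := z) (by linarith) (by linarith) (by linarith) (by linarith)
    linarith
  linarith

theorem abs_phase_le_near {x : ℝ} (hx : x < 2) (j : ℕ) :
    |phase h 0 x| ≤ 32 ∧ |phase h (j + 1) x| ≤ 5 * mollNorm j := by
  have hr : ∀ y, y ≤ 3 → root4 y ≤ 2 := fun y hy => root4_le_of_le_pow (by norm_num) (by linarith)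
  constructor
  · rw [abs_of_nonneg (hh.phase_nonneg x)]
    refine hh.phase_le fun y hy => (hh.phase₀_le y).trans ?_
    have h1 := hr y (by linarith [(abs_lt.1 hy).1])
    have := pow_le_pow_left₀ (root4_nonneg y) h1 5
    linarith
  · rw [hh.phase_succ j]
    refine (abs_cv_moll_le j (C := 5) fun y hy => ?_).trans (le_of_eq (by ring))
    rw [abs_of_nonneg (by have := hh.slope_nonneg y; positivity)]
    have h1 := hr y (by linarith [(abs_le.1 hy).1])
    have := slope_le (h := h) y
    linarith

theorem slope_le_zero (x : ℝ) : slope h x ≤ h 0 := by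
  rcases le_total x 0 with hx | hx
  · rw [hh.slope_of_nonpos hx]; exact (hh.pos 0).le
  · exact (min_le_right _ _).trans (hh.antitone hx)

theorem abs_phase_succ_le (j : ℕ) (x : ℝ) : |phase h (j + 1) x| ≤ mollNorm j * (5 / 4 * h 0) := by
  rw [hh.phase_succ j]
  refine abs_cv_moll_le j fun y _ => ?_
  rw [abs_of_nonneg (by have := hh.slope_nonneg y; positivity)]
  linarith [hh.slope_le_zero y]

end IsCap

/-- The constant bounding the derivatives of the phases. -/
noncomputable def phaseConst : ℝ := 32 + 9 * ∑ j ∈ Finset.range 5, mollNorm j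

theorem phaseConst_nonneg : 0 ≤ phaseConst :=
  add_nonneg (by norm_num) (mul_nonneg (by norm_num) (Finset.sum_nonneg fun j _ => mollNorm_nonneg j))

theorem mollNorm_le_phaseConst {j : ℕ} (hj : j < 5) : 9 * mollNorm j ≤ phaseConst := by
  have := Finset.single_le_sum (f := mollNorm) (fun j _ => mollNorm_nonneg j) (Finset.mem_range.2 hj)
  unfold phaseConst
  linarith

theorem IsCap.goodWeight {h : ℝ → ℝ} (hh : IsCap h) {A : ℝ} (hA : phaseConst ≤ A)
    {b : ℕ → ℝ → ℝ} (hb : ∀ j < 2, ∀ x, HasDerivAt (b j) (b (j + 1) x) x)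
    (hbc : Continuous (b 2)) (hb0 : ∀ x, 0 ≤ b 0 x) (hbA : ∀ x, b 0 x ≤ A)
    (hbd : ∀ x, |b 1 x| ≤ A * b 0 x ∧ |b 2 x| ≤ A * b 0 x)
    (hbs : ∀ x, 2 ≤ x → b 0 x ^ 2 ≤ A * phase h 1 x) : GoodWeight A (phase h) b where
  hasDerivAt := hh.hasDerivAt_phase
  hasDerivAt_b := hb
  continuous_b := hbc
  nonneg := hh.phase_nonneg
  slope_nonneg := hh.phase_one_nonneg
  pow_five_le := hh.phase_one_pow_five_le
  far x hx j hj h2 := by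
    obtain ⟨i, rfl⟩ : ∃ i, j = i + 1 := ⟨j - 1, by omega⟩
    exact (hh.abs_phase_succ_le_far hx i).trans (mul_le_mul_of_nonneg_right
      ((mollNorm_le_phaseConst (by omega)).trans hA) (hh.phase_one_nonneg x))
  near x hx j hj := by
    rcases Nat.eq_zero_or_pos j with rfl | h0
    · refine (hh.abs_phase_le_near hx 0).1.trans (le_trans ?_ hA)
      have := Finset.sum_nonneg (s := Finset.range 5) fun j _ => mollNorm_nonneg j
      unfold phaseConst
      linarith
    · obtain ⟨i, rfl⟩ : ∃ i, j = i + 1 := ⟨j - 1, by omega⟩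
      refine (hh.abs_phase_le_near hx i).2.trans (le_trans ?_ hA)
      have := mollNorm_le_phaseConst (show i < 5 by omega)
      have := mollNorm_nonneg i
      linarith
  bounded j h1 hj := by
    obtain ⟨i, rfl⟩ : ∃ i, j = i + 1 := ⟨j - 1, by omega⟩
    exact ⟨mollNorm i * (5 / 4 * h 0), mul_nonneg (mollNorm_nonneg i)
      (mul_nonneg (by norm_num) (hh.pos 0).le), hh.abs_phase_succ_le i⟩
  b_nonneg := hb0
  b_le := hbA
  b_deriv_le := hbd
  b_sq_le := hbs

/-! ### Spatial decay of the solutions -/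

theorem jb_hasDerivAt (x : ℝ) : HasDerivAt jb (x / jb x) x := by
  have h := (((hasDerivAt_id x).fun_pow 2).const_add 1).sqrt (by simp only [id]; positivity)
  refine h.congr_deriv ?_
  unfold jb
  simp only [id]
  push_cast
  field_simp

theorem abs_div_jb_le (x : ℝ) : |x / jb x| ≤ 1 := by
  rw [abs_div, abs_of_pos (jb_pos x), div_le_one (jb_pos x)]
  exact abs_le_jb x

theorem div_jb_continuous : Continuous fun x => x / jb x :=
  continuous_id.div jb_continuous fun x => (jb_pos x).ne'

theorem abs_integral_mul_le {f g : ℝ → ℝ} {M : ℝ} (hf : MemLp f 2) (hg : MemLp g 2)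
    (hfM : ∫ x, f x ^ 2 ≤ M) (hgM : ∫ x, g x ^ 2 ≤ M) : ∫ x, |f x * g x| ≤ M := by
  linarith [integral_abs_mul_le hf hg]

/-- Decay of a function and its derivative in terms of weighted norms. -/
theorem jb_mul_sq_le {v : ℕ → ℝ → ℝ} (hv : ∀ j x, HasDerivAt (v j) (v (j + 1) x) x)
    (hm : ∀ j, MemLp (v j) 2) (hw : ∀ j, MemLp (fun x => jb x * v j x) 2) {M : ℝ}
    (hM : ∀ j ≤ 4, ∫ x, v j x ^ 2 ≤ M) (hwM : ∫ x, (jb x * v 0 x) ^ 2 ≤ M) (x : ℝ) :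
    jb x * v 0 x ^ 2 ≤ 6 * M ∧ jb x * v 1 x ^ 2 ≤ 6 * M := by
  have hM0 : 0 ≤ M := (integral_nonneg fun _ => sq_nonneg _).trans hwM
  have iw : ∀ i j, Integrable fun x => jb x * v i x * v j x := fun i j =>
    (hw i).integrable_mul (hm j)
  have i0 : ∀ i j, Integrable fun x => x / jb x * (v i x * v j x) := fun i j => by
    have : Integrable fun x => v i x * v j x := (hm i).integrable_mul (hm j)
    exact this.bdd_mul (c := 1) div_jb_continuous.aestronglyMeasurable
      (Eventually.of_forall fun x => abs_div_jb_le x)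
  have a0 : ∀ i ≤ 4, ∀ j ≤ 4, ∫ x, |x / jb x * (v i x * v j x)| ≤ M := fun i hi j hj => by
    have : Integrable fun x => v i x * v j x := (hm i).integrable_mul (hm j)
    refine le_trans (integral_mono (i0 i j).abs this.abs fun x => ?_)
      (abs_integral_mul_le (hm i) (hm j) (hM i hi) (hM j hj))
    simp only
    rw [abs_mul]
    exact mul_le_of_le_one_left (abs_nonneg _) (abs_div_jb_le x)
  have aw : ∀ j ≤ 4, ∫ x, |jb x * v 0 x * v j x| ≤ M := fun j hj =>
    abs_integral_mul_le (hw 0) (hm j) hwM (hM j hj)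
  have d : ∀ i j x, HasDerivAt (fun x => jb x * v i x * v j x)
      (x / jb x * (v i x * v j x) + jb x * v (i + 1) x * v j x + jb x * v i x * v (j + 1) x) x :=
    fun i j x => (((jb_hasDerivAt x).fun_mul (hv i x)).fun_mul (hv j x)).congr_deriv (by ring)
  -- Repeated use moves derivatives onto one factor until the other carries none: `∂v ∂v` becomes `v
  -- ∂²v`, and `∂²v ∂²v` becomes `∂v ∂³v`, then `v ∂⁴v`. Only `v` itself then needs a quantitative
  -- weighted bound, with four unweighted derivatives.
  have parts : ∀ i j, ∫ x, jb x * v (i + 1) x * v j x =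
      -(∫ x, x / jb x * (v i x * v j x)) - ∫ x, jb x * v i x * v (j + 1) x := fun i j => by
    have := integral_eq_zero_of_hasDerivAt_of_integrable (d i j)
      (((i0 i j).fun_add (iw (i + 1) j)).fun_add (iw i (j + 1))) (iw i j)
    rw [integral_add ((i0 i j).fun_add (iw (i + 1) j)) (iw i (j + 1)),
      integral_add (i0 i j) (iw (i + 1) j)] at this
    linarith
  have ab : ∀ {f : ℝ → ℝ}, |∫ x, f x| ≤ ∫ x, |f x| := abs_integral_le_integral_abs
  have I1 : ∫ x, jb x * v 1 x * v 1 x ≤ 2 * M := by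
    have := parts 0 1
    simp only [zero_add, Nat.reduceAdd] at this
    have h1 := (neg_abs_le _).trans' (neg_le_neg (ab.trans (a0 0 (by simp) 1 (by simp))))
    have h2 := (neg_abs_le _).trans' (neg_le_neg (ab.trans (aw 2 (by simp))))
    linarith
  have I13 : |∫ x, jb x * v 1 x * v 3 x| ≤ 2 * M := by
    have := parts 0 3
    simp only [zero_add, Nat.reduceAdd] at this
    rw [this]
    have h1 := ab.trans (a0 0 (by simp) 3 (by simp))
    have h2 := ab.trans (aw 4 (by simp))
    rw [abs_le] at h1 h2 ⊢
    constructor <;> linarith [h1.1, h1.2, h2.1, h2.2]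
  have I2 : ∫ x, jb x * v 2 x * v 2 x ≤ 3 * M := by
    have := parts 1 2
    simp only [Nat.reduceAdd] at this
    have h1 := ab.trans (a0 1 (by simp) 2 (by simp))
    rw [abs_le] at h1 I13
    linarith [h1.1, I13.1]
  have bnd : ∀ i, jb x * v i x * v i x ≤
      (∫ x, |x / jb x * (v i x * v i x)|) + 2 * ∫ x, |jb x * v i x * v (i + 1) x| := by
    intro i
    have e : ∀ y, |y / jb y * (v i y * v i y) + jb y * v (i + 1) y * v i y +
        jb y * v i y * v (i + 1) y| ≤ |y / jb y * (v i y * v i y)| +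
        2 * |jb y * v i y * v (i + 1) y| := fun y => by
      have : jb y * v (i + 1) y * v i y = jb y * v i y * v (i + 1) y := by ring
      rw [this, add_assoc, ← two_mul]
      refine (abs_add_le _ _).trans (le_of_eq ?_)
      rw [abs_mul 2, abs_two]
    have id := ((i0 i i).fun_add (iw (i + 1) i)).fun_add (iw i (i + 1))
    have ie := (i0 i i).abs.fun_add ((iw i (i + 1)).abs.const_mul 2)
    refine (le_abs_self _).trans ((abs_le_integral_abs_deriv (d i i) (iw i i) id x).trans
      ((integral_mono id.abs ie e).trans (le_of_eq ?_)))
    rw [integral_add (i0 i i).abs ((iw i (i + 1)).abs.const_mul 2), integral_const_mul]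
  constructor
  · have h1 := a0 0 (by simp) 0 (by simp)
    have h2 := aw 1 (by simp)
    have h3 := bnd 0
    simp only [zero_add] at h3
    have : jb x * v 0 x ^ 2 = jb x * v 0 x * v 0 x := by ring
    linarith
  · have h1 := a0 1 (by simp) 1 (by simp)
    have h3 := bnd 1
    have h4 : 2 * ∫ x, |jb x * v 1 x * v 2 x| ≤ (∫ x, jb x * v 1 x * v 1 x) +
        ∫ x, jb x * v 2 x * v 2 x := by
      rw [← integral_const_mul, ← integral_add (iw 1 1) (iw 2 2)]
      refine integral_mono ((iw 1 2).abs.const_mul 2) ((iw 1 1).add (iw 2 2)) fun y => ?_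
      simp only
      have hj := (jb_pos y).le
      rw [mul_assoc (jb y), abs_mul, abs_of_nonneg hj, abs_mul]
      nlinarith [mul_nonneg hj (sq_nonneg (|v 1 y| - |v 2 y|)), sq_abs (v 1 y), sq_abs (v 2 y)]
    simp only [Nat.reduceAdd] at h3
    have : jb x * v 1 x ^ 2 = jb x * v 1 x * v 1 x := by ring
    linarith

/-! ### The auxiliary weight and the caps -/

/-- The auxiliary weight `(1 + x²)^{-1/4}` and its first two derivatives. -/
noncomputable def decay (j : ℕ) (x : ℝ) : ℝ :=
  match j with
  | 0 => (1 + x ^ 2) ^ (-(1 / 4) : ℝ)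
  | 1 => -(1 / 4) * (1 + x ^ 2) ^ (-(5 / 4) : ℝ) * (2 * x)
  | _ => 5 / 16 * (1 + x ^ 2) ^ (-(9 / 4) : ℝ) * (2 * x) ^ 2
      - 1 / 2 * (1 + x ^ 2) ^ (-(5 / 4) : ℝ)

theorem one_add_sq_rpow_hasDerivAt (p x : ℝ) :
    HasDerivAt (fun x : ℝ => (1 + x ^ 2) ^ p) (p * (1 + x ^ 2) ^ (p - 1) * (2 * x)) x := by
  have h := ((((hasDerivAt_id x).fun_pow 2).const_add 1).rpow_const (p := p)
    (Or.inl (by simp only [id]; positivity)))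
  refine h.congr_deriv ?_
  simp only [id]
  push_cast
  ring

theorem decay_hasDerivAt {j : ℕ} (hj : j < 2) (x : ℝ) :
    HasDerivAt (decay j) (decay (j + 1) x) x := by
  interval_cases j
  · have h := one_add_sq_rpow_hasDerivAt (-(1 / 4)) x
    norm_num at h
    refine h.congr_deriv ?_
    simp only [decay]
    norm_num
  · have h := ((one_add_sq_rpow_hasDerivAt (-(5 / 4)) x).const_mul (-(1 / 4))).fun_mul
      ((hasDerivAt_id x).const_mul 2)
    refine h.congr_deriv ?_
    have : (-(5 / 4) - 1 : ℝ) = -(9 / 4) := by norm_num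
    simp only [decay, this, id]
    ring

theorem decay_two_continuous : Continuous (decay 2) := by
  have h : ∀ p : ℝ, Continuous fun x : ℝ => (1 + x ^ 2) ^ p := fun p =>
    (by fun_prop : Continuous fun x : ℝ => 1 + x ^ 2).rpow_const fun x =>
      Or.inl (by positivity)
  have h1 := h (-(9 / 4))
  have h2 := h (-(5 / 4))
  unfold decay
  fun_prop

theorem decay_pos (x : ℝ) : 0 < decay 0 x := Real.rpow_pos_of_pos (by positivity) _

theorem decay_le_one (x : ℝ) : decay 0 x ≤ 1 :=
  Real.rpow_le_one_of_one_le_of_nonpos (by nlinarith [sq_nonneg x]) (by norm_num)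

theorem decay_sq (x : ℝ) : decay 0 x ^ 2 = (jb x)⁻¹ := by
  simp only [decay, jb]
  rw [← Real.rpow_natCast, ← Real.rpow_mul (by positivity), Real.sqrt_eq_rpow,
    ← Real.rpow_neg (by positivity)]
  norm_num

theorem abs_decay_le (x : ℝ) : |decay 1 x| ≤ 2 * decay 0 x ∧ |decay 2 x| ≤ 2 * decay 0 x := by
  have hp : (0 : ℝ) < 1 + x ^ 2 := by positivity
  have e0 : (1 + x ^ 2 : ℝ) ^ (-(1 / 4) : ℝ) = (1 + x ^ 2) ^ (-(5 / 4) : ℝ) * (1 + x ^ 2) := by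
    rw [← Real.rpow_add_one hp.ne']; norm_num
  have e1 : (1 + x ^ 2 : ℝ) ^ (-(5 / 4) : ℝ) = (1 + x ^ 2) ^ (-(9 / 4) : ℝ) * (1 + x ^ 2) := by
    rw [← Real.rpow_add_one hp.ne']; norm_num
  have p5 : 0 < (1 + x ^ 2 : ℝ) ^ (-(5 / 4) : ℝ) := Real.rpow_pos_of_pos hp _
  have p9 : 0 < (1 + x ^ 2 : ℝ) ^ (-(9 / 4) : ℝ) := Real.rpow_pos_of_pos hp _
  simp only [decay]
  rw [e0]
  constructor
  · rw [abs_le]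
    generalize (1 + x ^ 2 : ℝ) ^ (-(5 / 4) : ℝ) = p at *
    constructor <;> nlinarith [mul_nonneg p5.le (sq_nonneg (x - 1)),
      mul_nonneg p5.le (sq_nonneg (x + 1)), mul_nonneg p5.le (sq_nonneg x)]
  · rw [e1]
    generalize (1 + x ^ 2 : ℝ) ^ (-(9 / 4) : ℝ) = p at *
    rw [abs_le]
    constructor <;> nlinarith [mul_nonneg p9.le (sq_nonneg (x ^ 2)), mul_nonneg p9.le (sq_nonneg x)]

/-- The cap used for the qualitative estimate: it decays like `κ / x`. -/
noncomputable def cap (κ N x : ℝ) : ℝ := κ / (1 + max x 0) + N / (1 + max x 0) ^ 2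

theorem isCap_cap {κ N : ℝ} (hκ : 0 < κ) (hN : 0 ≤ N) : IsCap (cap κ N) where
  continuous := by
    unfold cap
    have h : ∀ x : ℝ, 1 + max x 0 ≠ 0 := fun x => by have := le_max_right x 0; positivity
    exact (continuous_const.div (by fun_prop) h).add
      (continuous_const.div (by fun_prop) fun x => pow_ne_zero _ (h x))
  antitone x y hxy := by
    unfold cap
    have h0 := le_max_right x 0
    have := max_le_max hxy (le_refl (0 : ℝ))
    gcongr
  pos x := by
    unfold cap
    have h0 := le_max_right x 0
    positivity
  ratio y z hy hz h := by
    unfold cap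
    rw [max_eq_left (by linarith), max_eq_left (by linarith)]
    have h1 : κ / (1 + y) ≤ 9 * (κ / (1 + z)) := by
      rw [← mul_div_assoc, div_le_div_iff₀ (by linarith) (by linarith)]
      nlinarith
    have h2 : N / (1 + y) ^ 2 ≤ 9 * (N / (1 + z) ^ 2) := by
      rw [← mul_div_assoc, div_le_div_iff₀ (by positivity) (by positivity)]
      have : (1 + z) ^ 2 ≤ (3 * (1 + y)) ^ 2 := pow_le_pow_left₀ (by linarith) (by linarith) 2
      nlinarith
    linarith

theorem isCap_const {M : ℝ} (hM : 0 < M) : IsCap fun _ => M where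
  continuous := continuous_const
  antitone := antitone_const
  pos _ := hM
  ratio _ _ _ _ _ := by linarith

/-- The part `κ / (1 + x)` integrates to a logarithm, and `N / (1 + x)²` has total mass at most `N`.
Raising `N` thus frees the slope on longer intervals without changing the growth of the phase at
infinity. -/
theorem phase₀_cap_le {κ N : ℝ} (hκ : 0 < κ) (hN : 0 ≤ N) {x : ℝ} (hx : 0 ≤ x) :
    phase₀ (cap κ N) x ≤ 5 / 4 * (κ * Real.log (1 + x) + N) := by
  have hh := isCap_cap hκ hN
  set F : ℝ → ℝ := fun x => 5 / 4 * (κ * Real.log (1 + x) + (N - N / (1 + x))) - phase₀ (cap κ N) x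
    with hF
  have hd : ∀ y ∈ Ici (0 : ℝ), HasDerivAt F (5 / 4 * (κ * (1 / (1 + y)) + N / (1 + y) ^ 2) -
      5 / 4 * slope (cap κ N) y) y := by
    intro y hy
    have hy' : (1 + y) ≠ 0 := by have : 0 ≤ y := hy; positivity
    have e1 : HasDerivAt (fun y : ℝ => 1 + y) 1 y := (hasDerivAt_id y).const_add 1
    have e2 := (e1.log hy').const_mul κ
    have e3 := ((hasDerivAt_const y N).fun_div e1 hy').const_sub N
    refine (((e2.fun_add e3).const_mul (5 / 4)).fun_sub (hh.hasDerivAt_phase₀ y)).congr_deriv ?_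
    field_simp
    ring
  have hmono : MonotoneOn F (Ici 0) := by
    refine monotoneOn_of_deriv_nonneg (convex_Ici 0)
      (fun y hy => (hd y hy).continuousAt.continuousWithinAt)
      (fun y hy => (hd y (interior_subset hy)).differentiableAt.differentiableWithinAt)
      fun y hy => ?_
    rw [(hd y (interior_subset hy)).deriv]
    have h0 : (0 : ℝ) ≤ y := interior_subset hy
    have h1 : slope (cap κ N) y ≤ κ * (1 / (1 + y)) + N / (1 + y) ^ 2 := by
      refine (min_le_right _ _).trans (le_of_eq ?_)
      unfold cap
      rw [max_eq_left h0]
      ring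
    linarith
  have := hmono (mem_Ici.2 le_rfl) (mem_Ici.2 hx) hx
  simp only [hF, add_zero, Real.log_one, mul_zero, div_one, sub_self,
    hh.phase₀_of_nonpos le_rfl] at this
  have h2 : 0 ≤ N / (1 + x) := by positivity
  linarith

/-! ### Removing the mollification from the weighted estimate -/

theorem GoodWeight.exists_lipschitz {A : ℝ} {χ b : ℕ → ℝ → ℝ} (h : GoodWeight A χ b) :
    ∃ Q, 0 ≤ Q ∧ ∀ x y, χ 0 x ≤ χ 0 y + Q * |x - y| := by
  obtain ⟨Q, hQ, hQ'⟩ := h.bounded 1 le_rfl (by simp)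
  refine ⟨Q, hQ, fun x y => ?_⟩
  have := convex_univ.norm_image_sub_le_of_norm_hasDerivWithin_le (f := χ 0) (f' := χ 1)
    (fun x _ => (h.hasDerivAt 0 x).hasDerivWithinAt) (fun x _ => hQ' x) (mem_univ y) (mem_univ x)
  rw [Real.norm_eq_abs, Real.norm_eq_abs] at this
  linarith [le_abs_self (χ 0 x - χ 0 y)]

theorem exp_weight_le {χ : ℝ → ℝ} {Q a a₂ δ x y : ℝ} (ha : 0 ≤ a) (ha₂ : a ≤ a₂) (hQ : 0 ≤ Q)
    (hχ : ∀ x y, χ x ≤ χ y + Q * |x - y|) (h : |x - y| ≤ δ) :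
    Real.exp (a * χ x) ≤ Real.exp (a₂ * Q * δ) * Real.exp (a * χ y) := by
  rw [← Real.exp_add]
  refine Real.exp_le_exp.2 ?_
  have h1 := mul_le_mul_of_nonneg_left (hχ x y) ha
  have h2 : a * (Q * |x - y|) ≤ a₂ * (Q * δ) :=
    mul_le_mul ha₂ (mul_le_mul_of_nonneg_left h hQ) (by positivity) (ha.trans ha₂)
  linarith

theorem cv_sub {k f g : ℝ → ℝ} (hk : Continuous k) (hc : HasCompactSupport k)
    (hf : LocallyIntegrable f) (hg : LocallyIntegrable g) (x : ℝ) :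
    cv k (f - g) x = cv k f x - cv k g x := by
  unfold cv
  rw [← integral_sub (integrable_kernel_mul hk hc hf x) (integrable_kernel_mul hk hc hg x)]
  exact integral_congr_ae (Eventually.of_forall fun y => by simp only [Pi.sub_apply]; ring)

/-- The weighted energy estimate for the difference of two solutions, provided the weighted
difference is square integrable. -/
theorem exists_weighted_estimate (b₁ b₂ b₃ : ℝ) {A a₁ a₂ : ℝ} (hA : 0 ≤ A) (ha₁ : 0 < a₁) :
    ∃ K, 0 ≤ K ∧ ∀ (χ b : ℕ → ℝ → ℝ), GoodWeight A χ b → ∀ (T : ℝ) (a a' : ℝ → ℝ) (A' : ℝ),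
      (∀ t ∈ Icc 0 T, a₁ ≤ a t ∧ a t ≤ a₂ ∧ HasDerivWithinAt a (a' t) (Icc 0 T) t ∧
        |a' t| ≤ A' ∧ a' t ≤ -(11 / 16 * (5 / 4) ^ 5 * a t ^ 5)) →
      ∀ (u₁ u₂ : ℝ → ℝ → ℝ) (M D F : ℝ), IsSolution b₁ b₂ b₃ T u₁ → IsSolution b₁ b₂ b₃ T u₂ →
      (∀ t ∈ Icc 0 T, H4Bound (u₁ t) M ∧ H4Bound (u₂ t) M) →
      (∀ k, ∀ t ∈ Icc 0 T, ∀ x, ∀ j ≤ 1, |mv (moll k) u₁ j t x| ≤ b 0 x / 2 ∧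
        |mv (moll k) u₂ j t x| ≤ b 0 x / 2) →
      (∀ t ∈ Icc 0 T, ∀ j ≤ 2, ∫ x, weakDeriv j (u₁ t) x ^ 2 ≤ D ∧
        ∫ x, weakDeriv j (u₂ t) x ^ 2 ≤ D) →
      (∀ t ∈ Icc 0 T, MemLp (fun x => Real.exp (a t * χ 0 x) * (u₁ t - u₂ t) x) 2 ∧
        ∫ x, (Real.exp (a t * χ 0 x) * (u₁ t - u₂ t) x) ^ 2 ≤ F) →
      ∀ t ∈ Icc 0 T, ∫ x, (Real.exp (a t / 2 * χ 0 x) * (u₁ t - u₂ t) x) ^ 2 ≤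
        Real.exp (K * t) * ((∫ x, (Real.exp (a 0 / 2 * χ 0 x) * (u₁ 0 - u₂ 0) x) ^ 2) +
          K * (12 * D) * t) := by
  obtain ⟨K, hK, hgrow⟩ := exists_weighted_growth b₁ b₂ b₃ (A := A) (a₁ := a₁) (a₂ := a₂) hA ha₁
  refine ⟨K, hK, fun χ b hχ T a a' A' ha u₁ u₂ M D F hs₁ hs₂ hM hb hD hF t ht => ?_⟩
  have h0T : (0 : ℝ) ∈ Icc 0 T := ⟨le_rfl, ht.1.trans ht.2⟩
  obtain ⟨Q, hQ, hχQ⟩ := hχ.exists_lipschitz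
  have χc : Continuous (χ 0) := hasDerivAt_continuous (hχ.hasDerivAt 0)
  have ha0 : ∀ t ∈ Icc 0 T, 0 ≤ a t := fun t ht => ha₁.le.trans (ha t ht).1
  have ha₂ : 0 ≤ a₂ := (ha0 0 h0T).trans (ha 0 h0T).2.1
  have hM0 : 0 ≤ M := (hM 0 h0T).1.nonneg
  have hl : ∀ t ∈ Icc 0 T, LocallyIntegrable (u₁ t - u₂ t) := fun t ht =>
    (hM t ht).1.locallyIntegrable.sub (hM t ht).2.locallyIntegrable
  have hmem : ∀ t ∈ Icc 0 T, MemLp (u₁ t - u₂ t) 2 := fun t ht => (hM t ht).1.1.sub (hM t ht).2.1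
  set w : ℕ → ℕ → ℝ → ℝ → ℝ := fun k j t x => 1 * mv (moll k) u₁ j t x + (-1) * mv (moll k) u₂ j t x
    with hw
  set s : ℕ → ℕ → ℝ → ℝ → ℝ := fun k j t x =>
    1 / 2 * mv (moll k) u₁ j t x + 1 / 2 * mv (moll k) u₂ j t x with hs
  have ev₁ := fun k => smoothEvolution_mollify (fun t ht => (hM t ht).1) hs₁ (moll_isMollifier k)
  have ev₂ := fun k => smoothEvolution_mollify (fun t ht => (hM t ht).2) hs₂ (moll_isMollifier k)
  have kc : ∀ k j, Continuous (iteratedDeriv j (moll k)) := fun k j =>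
    (contDiff_iteratedDeriv (moll_isMollifier k).smooth j).continuous
  have ks : ∀ k j, HasCompactSupport (iteratedDeriv j (moll k)) := fun k j =>
    hasCompactSupport_iteratedDeriv (moll_isMollifier k).hasCompactSupport j
  have hwcv : ∀ k j, ∀ t ∈ Icc 0 T, w k j t = cv (iteratedDeriv j (moll k)) (u₁ t - u₂ t) := by
    intro k j t ht
    funext x
    rw [cv_sub (kc k j) (ks k j) (hM t ht).1.locallyIntegrable (hM t ht).2.locallyIntegrable]
    simp only [hw, mv]
    ring
  have δ1 : ∀ k : ℕ, 1 / ((k : ℝ) + 1) ≤ 1 := fun k => by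
    rw [div_le_one (by positivity)]; linarith [(Nat.cast_nonneg k : (0 : ℝ) ≤ k)]
  -- Derivatives fall on the kernel, so these bounds may blow up with `k` for `j > 0`; they only
  -- ensure that the fluxes vanish at infinity. For `j = 0` the kernel has mass one, which yields
  -- the bound `E` below, independent of `k`.
  have wt : ∀ k j, ∀ t ∈ Icc 0 T,
      MemLp (fun x => Real.exp (a t * χ 0 x) * w k j t x) 2 ∧
      ∫ x, (Real.exp (a t * χ 0 x) * w k j t x) ^ 2 ≤ Real.exp (a₂ * Q * 1) ^ 2 *
        (∫ y, |iteratedDeriv j (moll k) y|) ^ 2 * F := by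
    intro k j t ht
    rw [hwcv k j t ht]
    have := cv_memLp_weight (φ := fun x => Real.exp (a t * χ 0 x)) (kc k j) (ks k j)
      ((moll_isMollifier k).iteratedDeriv_zero_of_le j) (by fun_prop)
      (fun x => (Real.exp_pos _).le) (fun x y hxy => exp_weight_le (ha0 t ht) (ha t ht).2.1 hQ hχQ
        (hxy.trans (δ1 k))) (hl t ht) (hF t ht).1
    exact ⟨this.1, this.2.trans (mul_le_mul_of_nonneg_left (hF t ht).2 (by positivity))⟩
  have half : ∀ t ∈ Icc 0 T, MemLp (fun x => Real.exp (a t / 2 * χ 0 x) * (u₁ t - u₂ t) x) 2 := by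
    intro t ht
    have hm1 : AEStronglyMeasurable (fun x => Real.exp (a t / 2 * χ 0 x) * (u₁ t - u₂ t) x) volume :=
      (by fun_prop : Continuous fun x => Real.exp (a t / 2 * χ 0 x)).aestronglyMeasurable.mul
        (hmem t ht).1
    refine (memLp_two_iff_integrable_sq hm1).2 ?_
    have i : Integrable fun x => Real.exp (a t * χ 0 x) * (u₁ t - u₂ t) x * (u₁ t - u₂ t) x :=
      (hF t ht).1.integrable_mul (hmem t ht)
    refine i.congr (Eventually.of_forall fun x => ?_)
    simp only
    rw [mul_pow, ← Real.exp_nat_mul, mul_assoc, ← sq]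
    congr 2
    push_cast
    ring
  have hwt : ∀ k, ∀ t ∈ Icc 0 T,
      MemLp (fun x => Real.exp (a t / 2 * χ 0 x) * cv (moll k) (u₁ t - u₂ t) x) 2 ∧
      ∫ x, (Real.exp (a t / 2 * χ 0 x) * cv (moll k) (u₁ t - u₂ t) x) ^ 2 ≤
        Real.exp (a₂ * Q * (1 / ((k : ℝ) + 1))) ^ 2 *
          ∫ x, (Real.exp (a t / 2 * χ 0 x) * (u₁ t - u₂ t) x) ^ 2 := by
    intro k t ht
    have h1 := ha0 t ht
    have h2 := (ha t ht).2.1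
    have := cv_memLp_weight (φ := fun x => Real.exp (a t / 2 * χ 0 x)) (kc k 0) (ks k 0)
      ((moll_isMollifier k).iteratedDeriv_zero_of_le 0) (by fun_prop)
      (fun x => (Real.exp_pos _).le) (fun x y hxy => exp_weight_le (a₂ := a₂) (by positivity)
        (by linarith) hQ hχQ hxy) (hl t ht) (half t ht)
    simpa only [iteratedDeriv_zero, (moll_isMollifier k).integral_abs, one_pow, mul_one] using this
  have sqr : ∀ k, ∀ t ∈ Icc 0 T, ∫ x, Real.exp (a t * χ 0 x) * w k 0 t x ^ 2 =
      ∫ x, (Real.exp (a t / 2 * χ 0 x) * cv (moll k) (u₁ t - u₂ t) x) ^ 2 := by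
    intro k t ht
    refine integral_congr_ae (Eventually.of_forall fun x => ?_)
    simp only
    rw [hwcv k 0 t ht, mul_pow, ← Real.exp_nat_mul, iteratedDeriv_zero]
    congr 2
    push_cast
    ring
  set C := Real.sqrt (24 * (b₁ ^ 2 + b₂ ^ 2 + 8 * M * b₃ ^ 2) * M ^ 2) + 1 with hC
  have hC1 : 0 < C := by have := Real.sqrt_nonneg (24 * (b₁ ^ 2 + b₂ ^ 2 + 8 * M * b₃ ^ 2) * M ^ 2)
                         linarith
  have hCsq : 24 * (b₁ ^ 2 + b₂ ^ 2 + 8 * M * b₃ ^ 2) * M ^ 2 ≤ C ^ 2 := by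
    have := Real.sq_sqrt (show 0 ≤ 24 * (b₁ ^ 2 + b₂ ^ 2 + 8 * M * b₃ ^ 2) * M ^ 2 by positivity)
    have := Real.sqrt_nonneg (24 * (b₁ ^ 2 + b₂ ^ 2 + 8 * M * b₃ ^ 2) * M ^ 2)
    nlinarith
  -- The factor `2` accounts for the difference of two errors: `2 C² + 2 C² = (2 C)²`.
  set ε : ℕ → ℝ := fun k => 1 / ((k : ℝ) + 1) * (2 * C) with hε
  have hε0 : ∀ k, 0 < ε k := fun k => by positivity
  have hεt : Tendsto ε atTop (𝓝 0) := by
    simpa only [zero_mul] using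
      (tendsto_one_div_add_atTop_nhds_zero_nat (𝕜 := ℝ)).mul_const (2 * C)
  have hδt := tendsto_one_div_add_atTop_nhds_zero_nat (𝕜 := ℝ)
  set E := Real.exp (a₂ * Q * 1) ^ 2 * F with hE
  have main : ∀ k, ∫ x, (Real.exp (a t / 2 * χ 0 x) * cv (moll k) (u₁ t - u₂ t) x) ^ 2 ≤
      Real.exp (K * t) * (Real.exp (a₂ * Q * (1 / ((k : ℝ) + 1))) ^ 2 *
          (∫ x, (Real.exp (a 0 / 2 * χ 0 x) * (u₁ 0 - u₂ 0) x) ^ 2) +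
        (K * (12 * D) + ε k * (E + 1)) * t) := by
    intro k
    have g := hgrow χ b hχ T a a' A' ha (w k) _ (s k) _ ((ev₁ k).comb (ev₂ k) 1 (-1))
      ((ev₁ k).comb (ev₂ k) (1 / 2) (1 / 2)) ?_ (12 * D) ?_ (fun j _ => ⟨_, wt k j⟩) E ?_ (ε k)
      (fun t x => 1 * (nl b₁ b₂ b₃ (mv (moll k) u₁ 0 t x) (mv (moll k) u₁ 1 t x)
        (mv (moll k) u₁ 2 t x) (mv (moll k) u₁ 3 t x) - mn b₁ b₂ b₃ (moll k) u₁ 0 t x) +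
        (-1) * (nl b₁ b₂ b₃ (mv (moll k) u₂ 0 t x) (mv (moll k) u₂ 1 t x)
        (mv (moll k) u₂ 2 t x) (mv (moll k) u₂ 3 t x) - mn b₁ b₂ b₃ (moll k) u₂ 0 t x))
      (hε0 k) ?_ ?_ t ht
    · rw [sqr k t ht, sqr k 0 h0T] at g
      exact g.trans (mul_le_mul_of_nonneg_left (add_le_add_left (hwt k 0 h0T).2 _)
        (Real.exp_pos _).le)
    · intro t ht x
      obtain ⟨p0, p0'⟩ := hb k t ht x 0 (by simp)
      obtain ⟨p1, p1'⟩ := hb k t ht x 1 le_rfl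
      rw [abs_le] at p0 p0' p1 p1'
      simp only [hw, hs, abs_le]
      refine ⟨⟨?_, ?_⟩, ⟨?_, ?_⟩, ⟨?_, ?_⟩⟩ <;>
        linarith [p0.1, p0.2, p0'.1, p0'.2, p1.1, p1.2, p1'.1, p1'.2]
    · intro t ht
      have hj : ∀ j ≤ 2, ∫ x, w k j t x ^ 2 ≤ 4 * D := by
        intro j hj
        have h1 := (memLp_comb ((ev₁ k).memLp j ht) ((ev₂ k).memLp j ht) 1 (-1)).2
        have h2 := (hM t ht).1.integral_sq_le_weakDeriv (moll_isMollifier k) (j := j) (by omega)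
        have h3 := (hM t ht).2.integral_sq_le_weakDeriv (moll_isMollifier k) (j := j) (by omega)
        have h4 := hD t ht j hj
        change ∫ x, mv (moll k) u₁ j t x ^ 2 ≤ _ at h2
        change ∫ x, mv (moll k) u₂ j t x ^ 2 ≤ _ at h3
        refine h1.trans ?_
        linarith [h4.1, h4.2]
      linarith [hj 0 (by simp), hj 1 (by simp), hj 2 le_rfl]
    · intro t ht
      have := (wt k 0 t ht).2
      simp only [iteratedDeriv_zero, (moll_isMollifier k).integral_abs, one_pow, mul_one] at this
      simp only [hE, mul_one]
      exact this
    · intro t _ x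
      simp only [nlDiff, nl, hw, hs]
      ring
    · intro t ht
      obtain ⟨p, p'⟩ := (hM t ht).1.mollified_error (moll_isMollifier k) b₁ b₂ b₃
      obtain ⟨r, r'⟩ := (hM t ht).2.mollified_error (moll_isMollifier k) b₁ b₂ b₃
      obtain ⟨y, y'⟩ := memLp_comb p r 1 (-1)
      refine ⟨y, y'.trans ?_⟩
      have := mul_le_mul_of_nonneg_left hCsq (sq_nonneg (1 / ((k : ℝ) + 1)))
      simp only [hε]
      linarith
  refine integral_weight_sq_le_of_moll (hl t ht) (half t ht) (fun k => (hwt k t ht).1) main ?_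
  have c1 : Continuous fun r : ℝ => Real.exp (a₂ * Q * r) ^ 2 := by fun_prop
  have t1 := (c1.tendsto 0).comp hδt
  simp only [mul_zero, Real.exp_zero, one_pow] at t1
  have t2 := (((t1.mul_const (∫ x, (Real.exp (a 0 / 2 * χ 0 x) * (u₁ 0 - u₂ 0) x) ^ 2)).add
    (((hεt.mul_const (E + 1)).const_add (K * (12 * D))).mul_const t))).const_mul (Real.exp (K * t))
  simp only [one_mul, zero_mul, add_zero] at t2
  exact t2

/-! ### The decay rate and the two families of good weights -/

theorem decayRate_zero (a₀ ε : ℝ) : decayRate a₀ ε 0 = a₀ := by simp [decayRate]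

/-- The worst case is `ε → 0`, where `3/2 + 5/4 = 11/4`. -/
theorem le_kConst {ε : ℝ} (hε : 0 < ε) (hε1 : ε ≤ 1) : 11 / 16 * (5 / 4) ^ 5 ≤ kConst ε / 4 := by
  have h : 5 / 4 ≤ 25 / (4 * (5 - ε)) := by
    rw [le_div_iff₀ (by linarith)]; linarith
  unfold kConst
  linarith

theorem decayRate_pos {a₀ ε t : ℝ} (ha : 0 < a₀) (hε : 0 < ε) (hε1 : ε ≤ 1) (ht : 0 ≤ t) :
    0 < decayRate a₀ ε t := by
  have hk : 0 < kConst ε := by have := le_kConst hε hε1; norm_num at this; linarith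
  unfold decayRate
  positivity

/-- The differential inequality satisfied by the decay rate. -/
theorem decayRate_spec {a₀ ε T : ℝ} (ha : 0 < a₀) (hε : 0 < ε) (hε1 : ε ≤ 1) :
    ∀ t ∈ Icc 0 T, decayRate a₀ ε T ≤ decayRate a₀ ε t ∧ decayRate a₀ ε t ≤ a₀ ∧
      HasDerivWithinAt (decayRate a₀ ε) (-(kConst ε / 4 * decayRate a₀ ε t ^ 5)) (Icc 0 T) t ∧
      |-(kConst ε / 4 * decayRate a₀ ε t ^ 5)| ≤ kConst ε / 4 * a₀ ^ 5 ∧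
      -(kConst ε / 4 * decayRate a₀ ε t ^ 5) ≤
        -(11 / 16 * (5 / 4) ^ 5 * decayRate a₀ ε t ^ 5) := by
  intro t ht
  have hk : 0 < kConst ε := by have := le_kConst hε hε1; norm_num at this; linarith
  have hpos := decayRate_pos ha hε hε1 ht.1
  set c := kConst ε * a₀ ^ 4 with hc
  have hc0 : 0 < c := by positivity
  have mono : ∀ s r : ℝ, 0 ≤ s → s ≤ r → decayRate a₀ ε r ≤ decayRate a₀ ε s := by
    intro s r hs hr
    unfold decayRate
    refine div_le_div_of_nonneg_left ha.le (by positivity) ?_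
    exact Real.rpow_le_rpow (by positivity) (by gcongr) (by norm_num)
  have hle : decayRate a₀ ε t ≤ a₀ := by
    have := mono 0 t le_rfl ht.1
    rwa [decayRate_zero] at this
  refine ⟨mono t T ht.1 ht.2, hle, ?_, ?_, ?_⟩
  · have hb : 0 < 1 + c * t := by have := ht.1; positivity
    have h1 : HasDerivAt (fun t => 1 + c * t) c t := by
      simpa using ((hasDerivAt_id t).const_mul c).const_add 1
    have h2 := h1.rpow_const (p := (1 / 4 : ℝ)) (Or.inl hb.ne')
    have hp : 0 < (1 + c * t) ^ (1 / 4 : ℝ) := Real.rpow_pos_of_pos hb _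
    have h3 := (hasDerivAt_const t a₀).fun_div h2 hp.ne'
    refine (h3.congr_deriv ?_).hasDerivWithinAt
    have e4 : ((1 + c * t) ^ (1 / 4 : ℝ)) ^ 4 = 1 + c * t := by
      rw [← Real.rpow_natCast, ← Real.rpow_mul hb.le]; norm_num
    have e : (1 + c * t) ^ ((1 / 4 : ℝ) - 1) * ((1 + c * t) ^ (1 / 4 : ℝ)) ^ 3 = 1 := by
      rw [← Real.rpow_natCast, ← Real.rpow_mul hb.le, ← Real.rpow_add hb]; norm_num
    unfold decayRate
    rw [← hc]
    generalize (1 + c * t) ^ (1 / 4 : ℝ) = p at *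
    generalize (1 + c * t) ^ ((1 / 4 : ℝ) - 1) = r at *
    have hr : r = 1 / p ^ 3 := by field_simp; exact e
    rw [hr, hc]
    field_simp
    ring
  · rw [abs_neg, abs_of_nonneg (by positivity)]
    exact mul_le_mul_of_nonneg_left (pow_le_pow_left₀ hpos.le hle 5) (by positivity)
  · exact neg_le_neg (mul_le_mul_of_nonneg_right (le_kConst hε hε1) (by positivity))

/-- The slope is at least `min 1 κ / (2 + x)` far out, whatever `N` is, and `decay² = 1 / jb` is of
the same order. So `A` does not depend on `N`, and the growth constant is uniform over the whole
family. -/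
theorem goodWeight_cap {κ K : ℝ} (hκ : 0 < κ) (hK : 0 ≤ K) : ∃ A, 0 ≤ A ∧ ∀ N, 0 ≤ N →
    GoodWeight A (phase (cap κ N)) fun j x => K * decay j x := by
  have hm : 0 < min 1 κ := lt_min one_pos hκ
  have hp := phaseConst_nonneg
  have hd : 0 ≤ 2 * K ^ 2 / min 1 κ := by positivity
  refine ⟨phaseConst + 2 + K + 2 * K ^ 2 / min 1 κ, by positivity, fun N hN => ?_⟩
  have hh := isCap_cap hκ hN
  refine hh.goodWeight (by linarith) (fun j hj x => (decay_hasDerivAt hj x).const_mul K)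
    (continuous_const.mul decay_two_continuous) (fun x => mul_nonneg hK (decay_pos x).le)
    (fun x => ?_) (fun x => ?_) fun x hx => ?_
  · have := mul_le_mul_of_nonneg_left (decay_le_one x) hK
    linarith
  · have h0 := mul_nonneg hK (decay_pos x).le
    have h2 : 2 * (K * decay 0 x) ≤ (phaseConst + 2 + K + 2 * K ^ 2 / min 1 κ) * (K * decay 0 x) :=
      mul_le_mul_of_nonneg_right (by linarith) h0
    rw [abs_mul, abs_mul, abs_of_nonneg hK]
    constructor
    · have := mul_le_mul_of_nonneg_left (abs_decay_le x).1 hK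
      linarith
    · have := mul_le_mul_of_nonneg_left (abs_decay_le x).2 hK
      linarith
  · have h1 : min 1 κ / (2 + x) ≤ phase (cap κ N) 1 x := by
      refine hh.le_phase_one fun y hy => ?_
      obtain ⟨ya, yb⟩ := abs_lt.1 hy
      have s0 : min 1 κ / (2 + x) ≤ slope (cap κ N) y := by
        refine le_min ?_ ?_
        · have : 1 ≤ root4 y := le_root4_of_pow_le (by linarith)
          refine le_trans ?_ this
          rw [div_le_one (by linarith)]
          linarith [min_le_left 1 κ]
        · unfold cap
          rw [max_eq_left (by linarith)]
          have : min 1 κ / (2 + x) ≤ κ / (1 + y) :=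
            div_le_div₀ hκ.le (min_le_right _ _) (by linarith) (by linarith)
          have : 0 ≤ N / (1 + y) ^ 2 := by positivity
          linarith
      have : 0 ≤ min 1 κ / (2 + x) := by have : 0 < 2 + x := by linarith
                                         positivity
      linarith
    have h2 : (K * decay 0 x) ^ 2 ≤ 2 * K ^ 2 / min 1 κ * (min 1 κ / (2 + x)) := by
      rw [mul_pow, decay_sq, div_mul_div_cancel₀ hm.ne', ← div_eq_mul_inv,
        div_le_div_iff₀ (jb_pos x) (by linarith)]
      have := (le_abs_self x).trans (abs_le_jb x)
      nlinarith [sq_nonneg K]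
    have h3 := mul_le_mul_of_nonneg_left h1 hd
    have h4 := hh.phase_one_nonneg x
    have h5 : 0 ≤ (phaseConst + 2 + K) * phase (cap κ N) 1 x := by positivity
    linarith

/-- Once the cap is at least `1`, the slope is bounded below far out, so the auxiliary weight need
not decay and no spatial decay of the solutions is required. -/
theorem goodWeight_const {K : ℝ} (hK : 0 ≤ K) : ∃ A, 0 ≤ A ∧ ∀ M, 1 ≤ M →
    GoodWeight A (phase fun _ => M) fun j _ => if j = 0 then K else 0 := by
  have hp := phaseConst_nonneg
  refine ⟨phaseConst + K + K ^ 2, by positivity, fun M hM => ?_⟩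
  have hh := isCap_const (one_pos.trans_le hM)
  have hA : 0 ≤ phaseConst + K + K ^ 2 := by positivity
  refine hh.goodWeight (by linarith [sq_nonneg K]) (fun j _ x => ?_) ?_ (fun x => ?_)
    (fun x => ?_) (fun x => ?_) fun x hx => ?_
  · simpa using hasDerivAt_const x (if j = 0 then K else 0)
  · exact continuous_const
  · simpa using hK
  · simp only [if_true]; linarith [sq_nonneg K]
  · simp only [if_true, one_ne_zero, OfNat.ofNat_ne_zero, if_false, abs_zero]
    exact ⟨mul_nonneg hA hK, mul_nonneg hA hK⟩
  · have h1 : 1 ≤ phase (fun _ => M) 1 x := by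
      refine hh.le_phase_one fun y hy => ?_
      have : 1 ≤ slope (fun _ => M) y :=
        le_min (le_root4_of_pow_le (by linarith [(abs_lt.1 hy).2])) hM
      linarith
    have h2 := mul_le_mul_of_nonneg_left h1 hA
    simp only [if_true]
    linarith

/-! ### From capped weights to the exponential energy -/

theorem expEnergy_eq (a : ℝ) (f : ℝ → ℝ) :
    expEnergy a f = ∫⁻ x, ENNReal.ofReal ((Real.exp (a / 2 * root4 x ^ 5) * f x) ^ 2) := by
  unfold expEnergy
  refine lintegral_congr fun x => ?_
  rw [rpow_five_fourths, sq_abs, mul_pow, ← Real.exp_nat_mul]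
  congr 3
  push_cast
  ring

/-- Fatou's lemma along the caps: at each point the smoothed phase eventually lies above `x₊^{5/4}`.
-/
theorem expEnergy_le_of_caps {h : ℕ → ℝ → ℝ} (hh : ∀ N, IsCap (h N))
    (hev : ∀ x, ∀ᶠ N in atTop, ∀ y ≤ x, root4 y ≤ h N y) {a X : ℝ} (ha : 0 ≤ a) {f : ℝ → ℝ}
    (hX : ∀ N, MemLp (fun x => Real.exp (a / 2 * phase (h N) 0 x) * f x) 2 ∧
      ∫ x, (Real.exp (a / 2 * phase (h N) 0 x) * f x) ^ 2 ≤ X) :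
    expEnergy a f ≤ ENNReal.ofReal X := by
  rw [expEnergy_eq]
  have h1 : ∀ N, ∫⁻ x, ENNReal.ofReal ((Real.exp (a / 2 * phase (h N) 0 x) * f x) ^ 2) ≤
      ENNReal.ofReal X := fun N => by
    rw [← ofReal_integral_eq_lintegral_ofReal (hX N).1.integrable_sq
      (Eventually.of_forall fun _ => sq_nonneg _)]
    exact ENNReal.ofReal_le_ofReal (hX N).2
  have h2 : ∫⁻ x, ENNReal.ofReal ((Real.exp (a / 2 * root4 x ^ 5) * f x) ^ 2) ≤
      liminf (fun N => ∫⁻ x, ENNReal.ofReal ((Real.exp (a / 2 * phase (h N) 0 x) * f x) ^ 2))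
        atTop := by
    refine le_trans (lintegral_mono fun x => ?_) (lintegral_liminf_le' fun N =>
      ((hX N).1.1.aemeasurable.pow_const 2).ennreal_ofReal)
    refine le_liminf_of_le (by isBoundedDefault) ?_
    filter_upwards [hev (x + 1)] with N hN
    refine ENNReal.ofReal_le_ofReal ?_
    rw [mul_pow, mul_pow]
    refine mul_le_mul_of_nonneg_right (pow_le_pow_left₀ (Real.exp_pos _).le ?_ 2) (sq_nonneg _)
    exact Real.exp_le_exp.2 (mul_le_mul_of_nonneg_left ((hh N).le_phase hN) (by linarith))
  refine h2.trans ((liminf_le_liminf (Eventually.of_forall h1)).trans ?_)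
  rw [liminf_const]

theorem integral_phase_le_of_expEnergy {h : ℝ → ℝ} (hh : IsCap h) {a : ℝ} (ha : 0 ≤ a) {Λ : ℝ≥0}
    {f : ℝ → ℝ} (hf : AEStronglyMeasurable f volume) (hΛ : expEnergy a f ≤ Λ) :
    ∫ x, (Real.exp (a / 2 * phase h 0 x) * f x) ^ 2 ≤ Real.exp (a * (9 / 4)) * Λ := by
  have hc : Continuous (phase h 0) := hasDerivAt_continuous (hh.hasDerivAt_phase 0)
  have hm : AEStronglyMeasurable (fun x => (Real.exp (a / 2 * phase h 0 x) * f x) ^ 2) volume :=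
    ((by fun_prop : Continuous fun x => Real.exp (a / 2 * phase h 0 x)).aestronglyMeasurable.mul
      hf).pow 2
  rw [integral_eq_lintegral_of_nonneg_ae (Eventually.of_forall fun _ => sq_nonneg _) hm]
  have h1 : ∫⁻ x, ENNReal.ofReal ((Real.exp (a / 2 * phase h 0 x) * f x) ^ 2) ≤
      ENNReal.ofReal (Real.exp (a * (9 / 4))) * Λ := by
    refine le_trans ?_ (mul_le_mul_right hΛ _)
    rw [expEnergy_eq, ← lintegral_const_mul' _ _ ENNReal.ofReal_ne_top]
    refine lintegral_mono fun x => ?_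
    rw [← ENNReal.ofReal_mul (Real.exp_pos _).le]
    refine ENNReal.ofReal_le_ofReal ?_
    rw [mul_pow, mul_pow, ← mul_assoc]
    refine mul_le_mul_of_nonneg_right ?_ (sq_nonneg _)
    rw [← Real.exp_nat_mul, ← Real.exp_nat_mul, ← Real.exp_add]
    refine Real.exp_le_exp.2 ?_
    have := mul_le_mul_of_nonneg_left (hh.phase_le_rpow x) ha
    push_cast
    linarith
  refine (ENNReal.toReal_mono (ENNReal.mul_ne_top ENNReal.ofReal_ne_top ENNReal.coe_ne_top)
    h1).trans (le_of_eq ?_)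
  rw [ENNReal.toReal_mul, ENNReal.toReal_ofReal (Real.exp_pos _).le]
  rfl

/-- `jb` changes by a factor at most two across the kernel, so the weighted `L²` bound becomes `4
M`; then `6 * (4 M) = 24 M`. -/
theorem abs_cv_le_decay {f : ℝ → ℝ} {M : ℝ} (hf : H4Bound f M)
    (hw : MemLp (fun x => jb x * f x) 2) (hwM : ∫ x, (jb x * f x) ^ 2 ≤ M) (k : ℕ) {j : ℕ}
    (hj : j ≤ 1) (x : ℝ) :
    |cv (iteratedDeriv j (moll k)) f x| ≤ Real.sqrt (24 * M) * decay 0 x := by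
  have hM := hf.nonneg
  have hη := moll_isMollifier k
  have δ1 : 1 / ((k : ℝ) + 1) ≤ 1 := by
    rw [div_le_one (by positivity)]; linarith [(Nat.cast_nonneg k : (0 : ℝ) ≤ k)]
  have wt := fun j => cv_memLp_weight (φ := jb)
    (contDiff_iteratedDeriv hη.smooth j).continuous
    (hasCompactSupport_iteratedDeriv hη.hasCompactSupport j)
    (hη.iteratedDeriv_zero_of_le j) jb_continuous (fun x => (jb_pos x).le)
    (fun x y hxy => jb_le_two_mul δ1 hxy) hf.locallyIntegrable hw
  have h := jb_mul_sq_le (v := fun j => cv (iteratedDeriv j (moll k)) f) (M := 4 * M)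
    (fun j x => hf.hasDerivAt hη j x) (fun j => hf.memLp hη j) (fun j => (wt j).1)
    (fun j hj => (hf.integral_sq_le hη hj).trans (by linarith)) (by
      refine (wt 0).2.trans ?_
      simp only [iteratedDeriv_zero, hη.integral_abs]
      linarith) x
  have key : jb x * cv (iteratedDeriv j (moll k)) f x ^ 2 ≤ 24 * M := by
    interval_cases j
    · linarith [h.1]
    · linarith [h.2]
  refine abs_le_of_sq_le_sq ?_ (mul_nonneg (Real.sqrt_nonneg _) (decay_pos x).le)
  rw [mul_pow, Real.sq_sqrt (by positivity), decay_sq, ← div_eq_mul_inv, le_div_iff₀ (jb_pos x)]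
  linarith

/-- The choice `κ = 4 / (5 a₀)` gives the logarithm in the phase the coefficient `1` after
multiplication by `a₀`, so the weight grows no faster than the factor `⟨x⟩` that the solutions can
carry. -/
theorem exp_phase_cap_le {a₀ a N x : ℝ} (ha₀ : 0 < a₀) (haa : a ≤ a₀) (hN : 0 ≤ N) :
    Real.exp (a * phase (cap (4 / (5 * a₀)) N) 0 x) ≤ 3 * Real.exp (5 / 4 * a₀ * N) * jb x := by
  have hκ : 0 < 4 / (5 * a₀) := by positivity
  have hh := isCap_cap hκ hN
  have h0 := le_max_right x 0
  have h1 : phase (cap (4 / (5 * a₀)) N) 0 x ≤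
      5 / 4 * (4 / (5 * a₀) * Real.log (1 + (max x 0 + 1)) + N) := by
    refine hh.phase_le fun y hy => (hh.phase₀_mono ?_).trans
      (phase₀_cap_le hκ hN (x := max x 0 + 1) (by positivity))
    have := (abs_lt.1 hy).1
    linarith [le_max_left x 0]
  have h2 : a * phase (cap (4 / (5 * a₀)) N) 0 x ≤
      Real.log (1 + (max x 0 + 1)) + 5 / 4 * a₀ * N := by
    have e : a₀ * (5 / 4 * (4 / (5 * a₀) * Real.log (1 + (max x 0 + 1)) + N)) =
      Real.log (1 + (max x 0 + 1)) + 5 / 4 * a₀ * N := by field_simp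
    rw [← e]
    exact mul_le_mul haa h1 (hh.phase_nonneg x) ha₀.le
  refine (Real.exp_le_exp.2 h2).trans ?_
  rw [Real.exp_add, Real.exp_log (by positivity)]
  have h3 : 1 + (max x 0 + 1) ≤ 3 * jb x := by
    have : max x 0 ≤ jb x := max_le ((le_abs_self x).trans (abs_le_jb x)) (jb_pos x).le
    linarith [one_le_jb x]
  have := mul_le_mul_of_nonneg_right h3 (Real.exp_pos (5 / 4 * a₀ * N)).le
  linarith

theorem memLp_half {φ f : ℝ → ℝ} (hφ : Continuous φ) (hf : MemLp f 2)
    (h : MemLp (fun x => Real.exp (φ x) * f x) 2) :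
    MemLp (fun x => Real.exp (φ x / 2) * f x) 2 := by
  have hm1 : AEStronglyMeasurable (fun x => Real.exp (φ x / 2) * f x) volume :=
    (by fun_prop : Continuous fun x => Real.exp (φ x / 2)).aestronglyMeasurable.mul hf.1
  refine (memLp_two_iff_integrable_sq hm1).2 ?_
  have i : Integrable fun x => Real.exp (φ x) * f x * f x := h.integrable_mul hf
  refine i.congr (Eventually.of_forall fun x => ?_)
  simp only
  rw [mul_pow, ← Real.exp_nat_mul, mul_assoc, ← sq]
  congr 2
  push_cast
  ring

/-! ### Persistence: finiteness first, then the controlled constant -/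

/-- Persistence of the exponential decay, without control of the constant. -/
theorem exists_expEnergy_bound {b₁ b₂ b₃ T a₀ ε : ℝ} (hT : 0 ≤ T) (ha₀ : 0 < a₀) (hε : 0 < ε)
    (hε1 : ε ≤ 1) {u₁ u₂ : ℝ → ℝ → ℝ} (hu₁ : ContHWeighted 4 1 T u₁) (hu₂ : ContHWeighted 4 1 T u₂)
    (hs₁ : IsSolution b₁ b₂ b₃ T u₁) (hs₂ : IsSolution b₁ b₂ b₃ T u₂) {Λ : ℝ≥0}
    (hΛ : expEnergy a₀ (u₁ 0 - u₂ 0) ≤ Λ) :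
    ∃ X : ℝ, ∀ t ∈ Icc 0 T, expEnergy (decayRate a₀ ε t) (u₁ t - u₂ t) ≤ ENNReal.ofReal X := by
  have h0T : (0 : ℝ) ∈ Icc 0 T := ⟨le_rfl, hT⟩
  obtain ⟨M₁, hM₁⟩ := hu₁.exists_bound
  obtain ⟨M₂, hM₂⟩ := hu₂.exists_bound
  set M := max M₁ M₂ with hM
  have h₁ : ∀ t ∈ Icc 0 T, H4Bound (u₁ t) M := fun t ht =>
    (hM₁ t ht).1.mono (le_max_left _ _)
  have h₂ : ∀ t ∈ Icc 0 T, H4Bound (u₂ t) M := fun t ht =>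
    (hM₂ t ht).1.mono (le_max_right _ _)
  have w₁ : ∀ t ∈ Icc 0 T, ∫ x, (jb x * u₁ t x) ^ 2 ≤ M := fun t ht =>
    (hM₁ t ht).2.2.trans (le_max_left _ _)
  have w₂ : ∀ t ∈ Icc 0 T, ∫ x, (jb x * u₂ t x) ^ 2 ≤ M := fun t ht =>
    (hM₂ t ht).2.2.trans (le_max_right _ _)
  have hM0 : 0 ≤ M := (h₁ 0 h0T).nonneg
  have hκ : 0 < 4 / (5 * a₀) := by positivity
  obtain ⟨A, hA, hgood⟩ := goodWeight_cap hκ (K := 2 * Real.sqrt (24 * M)) (by positivity)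
  obtain ⟨K, hK, hest⟩ := exists_weighted_estimate b₁ b₂ b₃ (A := A)
    (a₁ := decayRate a₀ ε T) (a₂ := a₀) hA (decayRate_pos ha₀ hε hε1 hT)
  refine ⟨Real.exp (K * T) * (Real.exp (a₀ * (9 / 4)) * Λ + K * (12 * M) * T), fun t ht => ?_⟩
  have wm : ∀ N : ℕ, ∀ t ∈ Icc 0 T,
      MemLp (fun x => Real.exp (decayRate a₀ ε t * phase (cap (4 / (5 * a₀)) N) 0 x) *
        (u₁ t - u₂ t) x) 2 ∧
      ∫ x, (Real.exp (decayRate a₀ ε t * phase (cap (4 / (5 * a₀)) N) 0 x) * (u₁ t - u₂ t) x) ^ 2 ≤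
        (3 * Real.exp (5 / 4 * a₀ * N)) ^ 2 * (4 * M) := by
    intro N t ht
    have hc : Continuous (phase (cap (4 / (5 * a₀)) N) 0) :=
      hasDerivAt_continuous ((isCap_cap hκ (Nat.cast_nonneg N)).hasDerivAt_phase 0)
    obtain ⟨c1, c2⟩ := memLp_comb (hM₁ t ht).2.1 (hM₂ t ht).2.1 1 (-1)
    have hb : ∀ x, (Real.exp (decayRate a₀ ε t * phase (cap (4 / (5 * a₀)) N) 0 x) *
        (u₁ t - u₂ t) x) ^ 2 ≤ (3 * Real.exp (5 / 4 * a₀ * N)) ^ 2 *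
        (1 * (jb x * u₁ t x) + -1 * (jb x * u₂ t x)) ^ 2 := by
      intro x
      have e := exp_phase_cap_le (x := x) ha₀
        (decayRate_spec ha₀ hε hε1 t ht).2.1 (Nat.cast_nonneg N)
      have e2 := pow_le_pow_left₀ (Real.exp_pos _).le e 2
      have e3 := mul_le_mul_of_nonneg_right e2 (sq_nonneg ((u₁ t - u₂ t) x))
      rw [mul_pow]
      refine e3.trans (le_of_eq ?_)
      simp only [Pi.sub_apply]
      ring
    have hm : AEStronglyMeasurable (fun x => Real.exp (decayRate a₀ ε t *
        phase (cap (4 / (5 * a₀)) N) 0 x) * (u₁ t - u₂ t) x) volume :=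
      (by fun_prop : Continuous fun x => Real.exp (decayRate a₀ ε t *
        phase (cap (4 / (5 * a₀)) N) 0 x)).aestronglyMeasurable.mul
        ((h₁ t ht).1.sub (h₂ t ht).1).1
    have i : Integrable fun x => (Real.exp (decayRate a₀ ε t * phase (cap (4 / (5 * a₀)) N) 0 x) *
        (u₁ t - u₂ t) x) ^ 2 := by
      refine (c1.integrable_sq.const_mul ((3 * Real.exp (5 / 4 * a₀ * N)) ^ 2)).mono' (hm.pow 2)
        (Eventually.of_forall fun x => ?_)
      rw [Real.norm_of_nonneg (sq_nonneg _)]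
      exact hb x
    refine ⟨(memLp_two_iff_integrable_sq hm).2 i,
      (integral_mono i (c1.integrable_sq.const_mul _) hb).trans ?_⟩
    rw [integral_const_mul]
    refine mul_le_mul_of_nonneg_left (c2.trans ?_) (by positivity)
    linarith [w₁ t ht, w₂ t ht]
  refine expEnergy_le_of_caps (h := fun N : ℕ => cap (4 / (5 * a₀)) N)
    (fun N => isCap_cap hκ (Nat.cast_nonneg N)) (fun x => ?_)
    (decayRate_pos ha₀ hε hε1 ht.1).le fun N => ⟨?_, ?_⟩
  -- For such `N` the term `N / (1 + x)²` alone exceeds the uncapped slope everywhere up to `x`.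
  · obtain ⟨n, hn⟩ := exists_nat_ge (root4 x * (1 + max x 0) ^ 2)
    filter_upwards [eventually_ge_atTop n] with N hN y hy
    have hNn : (n : ℝ) ≤ N := Nat.cast_le.2 hN
    have p := le_max_right y 0
    have q := max_le_max hy (le_refl (0 : ℝ))
    have h1 : root4 y ≤ N / (1 + max y 0) ^ 2 := by
      rw [le_div_iff₀ (by positivity)]
      refine le_trans ?_ (hn.trans hNn)
      have := root4_mono hy
      have := root4_nonneg y
      have := root4_nonneg x
      gcongr
    have h2 : 0 ≤ 4 / (5 * a₀) / (1 + max y 0) := by positivity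
    unfold cap
    linarith
  · have hc : Continuous (phase (cap (4 / (5 * a₀)) N) 0) :=
      hasDerivAt_continuous ((isCap_cap hκ (Nat.cast_nonneg N)).hasDerivAt_phase 0)
    have := memLp_half (φ := fun x => decayRate a₀ ε t * phase (cap (4 / (5 * a₀)) N) 0 x)
      (by fun_prop) ((h₁ t ht).1.sub (h₂ t ht).1) (wm N t ht).1
    simpa only [div_mul_eq_mul_div] using this
  · have hN := (Nat.cast_nonneg N : (0 : ℝ) ≤ N)
    have g := hest (phase (cap (4 / (5 * a₀)) N)) _ (hgood N hN) T (decayRate a₀ ε) _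
      (kConst ε / 4 * a₀ ^ 5) (decayRate_spec ha₀ hε hε1) u₁ u₂ M M _ hs₁ hs₂
      (fun t ht => ⟨h₁ t ht, h₂ t ht⟩) (fun k t ht x j hj => ?_)
      (fun t ht j hj => ⟨((h₁ t ht).2 j (by omega)).2.2, ((h₂ t ht).2 j (by omega)).2.2⟩)
      (wm N) t ht
    · refine g.trans ?_
      have i0 := integral_phase_le_of_expEnergy (isCap_cap hκ hN) ha₀.le
        ((h₁ 0 h0T).1.sub (h₂ 0 h0T).1).1 hΛ
      rw [decayRate_zero]
      have hb1 : Real.exp (K * t) ≤ Real.exp (K * T) :=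
        Real.exp_le_exp.2 (mul_le_mul_of_nonneg_left ht.2 hK)
      have hb2 : K * (12 * M) * t ≤ K * (12 * M) * T :=
        mul_le_mul_of_nonneg_left ht.2 (by positivity)
      refine mul_le_mul hb1 (add_le_add i0 hb2) ?_ (Real.exp_pos _).le
      have := ht.1
      have : 0 ≤ ∫ x, (Real.exp (a₀ / 2 * phase (cap (4 / (5 * a₀)) N) 0 x) *
        (u₁ 0 - u₂ 0) x) ^ 2 := integral_nonneg fun _ => sq_nonneg _
      positivity
    · have e : 2 * Real.sqrt (24 * M) * decay 0 x / 2 = Real.sqrt (24 * M) * decay 0 x := by ring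
      rw [e]
      exact ⟨abs_cv_le_decay (h₁ t ht) (hM₁ t ht).2.1 (w₁ t ht) k hj x,
        abs_cv_le_decay (h₂ t ht) (hM₂ t ht).2.1 (w₂ t ht) k hj x⟩

/-- A good phase grows at most linearly, so even its double stays below `x₊^{5/4}` up to a constant.
This makes the doubled weight integrable once the exponential energy is finite. -/
theorem GoodWeight.exists_le {A : ℝ} {χ b : ℕ → ℝ → ℝ} (h : GoodWeight A χ b) :
    ∃ C, 0 ≤ C ∧ ∀ x, 2 * χ 0 x ≤ root4 x ^ 5 + C := by
  obtain ⟨Q, hQ, hχ⟩ := h.exists_lipschitz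
  have hA : ∀ x < 2, χ 0 x ≤ A := fun x hx => (le_abs_self _).trans (h.near x hx 0 (by simp))
  have hA0 : 0 ≤ A := (h.nonneg 0).trans (hA 0 (by norm_num))
  refine ⟨2 * A + 2 * Q * (8 * (2 * Q)) ^ 4, by positivity, fun x => ?_⟩
  have hr := root4_nonneg x
  have h5 : 0 ≤ root4 x ^ 5 := by positivity
  have hC : 0 ≤ 2 * Q * (8 * (2 * Q)) ^ 4 := by positivity
  rcases lt_or_ge x 2 with hx | hx
  · linarith [hA x hx]
  · have h1 := hχ x 0
    rw [sub_zero, abs_of_nonneg (by linarith)] at h1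
    have h2 := Jet.quartic_le_quintic (C := 2 * Q) (by positivity) hr
    rw [root4_pow_four, max_eq_left (by linarith)] at h2
    linarith [hA 0 (by norm_num)]

theorem memLp_of_expEnergy {a X : ℝ} {f : ℝ → ℝ} (hf : AEStronglyMeasurable f volume)
    (hX : expEnergy a f ≤ ENNReal.ofReal X) :
    MemLp (fun x => Real.exp (a / 2 * root4 x ^ 5) * f x) 2 ∧
      ∫ x, (Real.exp (a / 2 * root4 x ^ 5) * f x) ^ 2 ≤ max X 0 := by
  have hc := root4_continuous
  have hm : AEStronglyMeasurable (fun x => Real.exp (a / 2 * root4 x ^ 5) * f x) volume :=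
    (by fun_prop : Continuous fun x => Real.exp (a / 2 * root4 x ^ 5)).aestronglyMeasurable.mul hf
  rw [expEnergy_eq] at hX
  have h0 : 0 ≤ᵐ[volume] fun x => (Real.exp (a / 2 * root4 x ^ 5) * f x) ^ 2 :=
    Eventually.of_forall fun _ => sq_nonneg _
  refine ⟨(memLp_two_iff_integrable_sq hm).2 ⟨hm.pow 2, ?_⟩, ?_⟩
  · rw [hasFiniteIntegral_iff_ofReal h0]
    exact hX.trans_lt ENNReal.ofReal_lt_top
  · rw [integral_eq_lintegral_of_nonneg_ae h0 (hm.pow 2)]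
    refine (ENNReal.toReal_mono ENNReal.ofReal_ne_top hX).trans (le_of_eq ?_)
    rw [ENNReal.toReal_ofReal']

theorem GoodWeight.memLp_of_expEnergy {A : ℝ} {χ b : ℕ → ℝ → ℝ} (h : GoodWeight A χ b) (a₂ X : ℝ) :
    ∃ F, ∀ a, 0 ≤ a → a ≤ a₂ → ∀ f : ℝ → ℝ, AEStronglyMeasurable f volume →
      expEnergy a f ≤ ENNReal.ofReal X → MemLp (fun x => Real.exp (a * χ 0 x) * f x) 2 ∧
        ∫ x, (Real.exp (a * χ 0 x) * f x) ^ 2 ≤ F := by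
  obtain ⟨C, hC, hχ⟩ := h.exists_le
  refine ⟨Real.exp (a₂ * C) * max X 0, fun a ha ha₂ f hf hX => ?_⟩
  obtain ⟨h1, h2⟩ := FifthOrder.memLp_of_expEnergy hf hX
  have hc : Continuous (χ 0) := hasDerivAt_continuous (h.hasDerivAt 0)
  have hm : AEStronglyMeasurable (fun x => Real.exp (a * χ 0 x) * f x) volume :=
    (by fun_prop : Continuous fun x => Real.exp (a * χ 0 x)).aestronglyMeasurable.mul hf
  have hb : ∀ x, (Real.exp (a * χ 0 x) * f x) ^ 2 ≤
      Real.exp (a₂ * C) * (Real.exp (a / 2 * root4 x ^ 5) * f x) ^ 2 := by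
    intro x
    rw [mul_pow, mul_pow, ← mul_assoc, ← Real.exp_nat_mul, ← Real.exp_nat_mul, ← Real.exp_add]
    refine mul_le_mul_of_nonneg_right (Real.exp_le_exp.2 ?_) (sq_nonneg _)
    have e1 := mul_le_mul_of_nonneg_left (hχ x) ha
    have e2 := mul_le_mul_of_nonneg_right ha₂ hC
    push_cast
    linarith
  have i : Integrable fun x => (Real.exp (a * χ 0 x) * f x) ^ 2 := by
    refine (h1.integrable_sq.const_mul (Real.exp (a₂ * C))).mono' (hm.pow 2)
      (Eventually.of_forall fun x => ?_)
    rw [Real.norm_of_nonneg (sq_nonneg _)]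
    exact hb x
  refine ⟨(memLp_two_iff_integrable_sq hm).2 i,
    (integral_mono i (h1.integrable_sq.const_mul (Real.exp (a₂ * C))) hb).trans ?_⟩
  rw [integral_const_mul]
  exact mul_le_mul_of_nonneg_left h2 (Real.exp_pos _).le

/-- Persistence of the exponential decay, with a constant depending on the solutions only through
a bound on their `H²` norms. -/
theorem exists_constant (b₁ b₂ b₃ : ℝ) {B T a₀ ε : ℝ} (hB : 0 ≤ B) (hT : 0 ≤ T) (ha₀ : 0 < a₀)
    (hε : 0 < ε) (hε1 : ε ≤ 1) (Λ : ℝ≥0) :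
    ∃ C : ℝ≥0, ∀ u₁ u₂ : ℝ → ℝ → ℝ, ContHWeighted 4 1 T u₁ → ContHWeighted 4 1 T u₂ →
      IsSolution b₁ b₂ b₃ T u₁ → IsSolution b₁ b₂ b₃ T u₂ →
      (∀ t ∈ Icc 0 T,
        (∫ x, weakDeriv 0 (u₁ t) x ^ 2) + ∫ x, weakDeriv 2 (u₁ t) x ^ 2 ≤ B) →
      (∀ t ∈ Icc 0 T,
        (∫ x, weakDeriv 0 (u₂ t) x ^ 2) + ∫ x, weakDeriv 2 (u₂ t) x ^ 2 ≤ B) →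
      expEnergy a₀ (u₁ 0 - u₂ 0) ≤ Λ →
      ∀ t ∈ Icc 0 T, expEnergy (decayRate a₀ ε t) (u₁ t - u₂ t) ≤ C := by
  -- An `H²` bound `B` gives `|u|, |∂ₓu| ≤ √(2B)`; the auxiliary weight has to be twice that, to
  -- bound the difference of two solutions.
  obtain ⟨A, hA, hgood⟩ := goodWeight_const (K := 2 * Real.sqrt (2 * B)) (by positivity)
  obtain ⟨K, hK, hest⟩ := exists_weighted_estimate b₁ b₂ b₃ (A := A)
    (a₁ := decayRate a₀ ε T) (a₂ := a₀) hA (decayRate_pos ha₀ hε hε1 hT)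
  refine ⟨(Real.exp (K * T) * (Real.exp (a₀ * (9 / 4)) * Λ + K * (12 * B) * T)).toNNReal,
    fun u₁ u₂ hu₁ hu₂ hs₁ hs₂ hB₁ hB₂ hΛ t ht => ?_⟩
  have h0T : (0 : ℝ) ∈ Icc 0 T := ⟨le_rfl, hT⟩
  obtain ⟨M₁, hM₁⟩ := hu₁.exists_bound
  obtain ⟨M₂, hM₂⟩ := hu₂.exists_bound
  set M := max M₁ M₂ with hM
  have h₁ : ∀ t ∈ Icc 0 T, H4Bound (u₁ t) M := fun t ht =>
    (hM₁ t ht).1.mono (le_max_left _ _)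
  have h₂ : ∀ t ∈ Icc 0 T, H4Bound (u₂ t) M := fun t ht =>
    (hM₂ t ht).1.mono (le_max_right _ _)
  -- `X` depends on the individual solutions. It serves only to make the doubled weight integrable
  -- below, and the constant already fixed above does not contain it.
  obtain ⟨X, hX⟩ := exists_expEnergy_bound hT ha₀ hε hε1 hu₁ hu₂ hs₁ hs₂ hΛ
  have hN : ∀ N : ℕ, (1 : ℝ) ≤ N + 1 := fun N => by
    linarith [(Nat.cast_nonneg N : (0 : ℝ) ≤ N)]
  have hcap : ∀ N : ℕ, IsCap fun _ => (N : ℝ) + 1 := fun N => isCap_const (by linarith [hN N])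
  have wm : ∀ N : ℕ, ∃ F, ∀ t ∈ Icc 0 T,
      MemLp (fun x => Real.exp (decayRate a₀ ε t * phase (fun _ => (N : ℝ) + 1) 0 x) *
        (u₁ t - u₂ t) x) 2 ∧
      ∫ x, (Real.exp (decayRate a₀ ε t * phase (fun _ => (N : ℝ) + 1) 0 x) *
        (u₁ t - u₂ t) x) ^ 2 ≤ F := fun N => by
    obtain ⟨F, hF⟩ := (hgood _ (hN N)).memLp_of_expEnergy a₀ X
    exact ⟨F, fun t ht => hF _ (decayRate_pos ha₀ hε hε1 ht.1).le
      (decayRate_spec ha₀ hε hε1 t ht).2.1 _ ((h₁ t ht).1.sub (h₂ t ht).1).1 (hX t ht)⟩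
  have sup : ∀ {u : ℝ → ℝ → ℝ}, (∀ t ∈ Icc 0 T, H4Bound (u t) M) → IsSolution b₁ b₂ b₃ T u →
      (∀ t ∈ Icc 0 T,
        (∫ x, weakDeriv 0 (u t) x ^ 2) + ∫ x, weakDeriv 2 (u t) x ^ 2 ≤ B) →
      ∀ t ∈ Icc 0 T, (∀ j ≤ 2, ∫ x, weakDeriv j (u t) x ^ 2 ≤ B) ∧
        ∀ k x, ∀ j ≤ 1, |mv (moll k) u j t x| ≤ 2 * Real.sqrt (2 * B) / 2 := by
    intro u hu hs hBu t ht
    have ev := fun k => smoothEvolution_mollify hu hs (moll_isMollifier k)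
    have hBk : ∀ k, (∫ x, mv (moll k) u 0 t x ^ 2) + ∫ x, mv (moll k) u 2 t x ^ 2 ≤ B := fun k =>
      (add_le_add ((hu t ht).integral_sq_le_weakDeriv (moll_isMollifier k) (by simp))
        ((hu t ht).integral_sq_le_weakDeriv (moll_isMollifier k) (by simp))).trans (hBu t ht)
    have p0 : 0 ≤ ∫ x, weakDeriv 0 (u t) x ^ 2 := integral_nonneg fun _ => sq_nonneg _
    have p2 : 0 ≤ ∫ x, weakDeriv 2 (u t) x ^ 2 := integral_nonneg fun _ => sq_nonneg _
    refine ⟨fun j hj => ?_, fun k x j hj => ?_⟩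
    · interval_cases j
      · linarith [hBu t ht]
      · refine integral_sq_le_of_moll ((hu t ht).2 1 (by simp)).2.1 (F := fun _ => B)
          (fun k => ?_) tendsto_const_nhds
        rw [← (hu t ht).cv_eq (moll_isMollifier k) (by simp)]
        have := (ev k).integral_one_sq_le ht (hBk k)
        exact this.trans (by linarith)
      · linarith [hBu t ht]
    · have := (ev k).sq_le_of_bound ht (hBk k) x
      rw [mul_div_cancel_left₀ _ two_ne_zero]
      refine Real.abs_le_sqrt ?_
      interval_cases j
      · exact this.1
      · exact this.2
  refine expEnergy_le_of_caps (h := fun N : ℕ => fun _ => (N : ℝ) + 1) hcap (fun x => ?_)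
    (decayRate_pos ha₀ hε hε1 ht.1).le fun N => ⟨?_, ?_⟩
  · obtain ⟨n, hn⟩ := exists_nat_ge (root4 x)
    filter_upwards [eventually_ge_atTop n] with N hN y hy
    have : (n : ℝ) ≤ N := Nat.cast_le.2 hN
    linarith [root4_mono hy]
  · obtain ⟨F, hF⟩ := wm N
    have hc : Continuous (phase (fun _ => (N : ℝ) + 1) 0) :=
      hasDerivAt_continuous ((hcap N).hasDerivAt_phase 0)
    have := memLp_half (φ := fun x => decayRate a₀ ε t * phase (fun _ => (N : ℝ) + 1) 0 x)
      (by fun_prop) ((h₁ t ht).1.sub (h₂ t ht).1) (hF t ht).1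
    simpa only [div_mul_eq_mul_div] using this
  · obtain ⟨F, hF⟩ := wm N
    have s₁ := sup h₁ hs₁ hB₁
    have s₂ := sup h₂ hs₂ hB₂
    have g := hest _ _ (hgood _ (hN N)) T (decayRate a₀ ε) _
      (kConst ε / 4 * a₀ ^ 5) (decayRate_spec ha₀ hε hε1) u₁ u₂ M B F hs₁ hs₂
      (fun t ht => ⟨h₁ t ht, h₂ t ht⟩)
      (fun k t ht x j hj => ⟨(s₁ t ht).2 k x j hj, (s₂ t ht).2 k x j hj⟩)
      (fun t ht j hj => ⟨(s₁ t ht).1 j hj, (s₂ t ht).1 j hj⟩) hF t ht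
    refine g.trans ?_
    have i0 := integral_phase_le_of_expEnergy (hcap N) ha₀.le
      ((h₁ 0 h0T).1.sub (h₂ 0 h0T).1).1 hΛ
    rw [decayRate_zero]
    have hb1 : Real.exp (K * t) ≤ Real.exp (K * T) :=
      Real.exp_le_exp.2 (mul_le_mul_of_nonneg_left ht.2 hK)
    have hb2 : K * (12 * B) * t ≤ K * (12 * B) * T :=
      mul_le_mul_of_nonneg_left ht.2 (by positivity)
    refine mul_le_mul hb1 (add_le_add i0 hb2) ?_ (Real.exp_pos _).le
    have := ht.1
    have : 0 ≤ ∫ x, (Real.exp (a₀ / 2 * phase (fun _ => (N : ℝ) + 1) 0 x) *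
      (u₁ 0 - u₂ 0) x) ^ 2 := integral_nonneg fun _ => sq_nonneg _
    positivity

/-! ### From Sobolev norms to the statement -/

theorem integral_sq_le_of_sobolevNorm {m j : ℕ} {f : ℝ → ℝ} {M : ℝ≥0} (hf : MemH m f) (hj : j ≤ m)
    (h : sobolevNorm m f ≤ M) : ∫ x, weakDeriv j f x ^ 2 ≤ (M : ℝ) ^ 2 := by
  have h1 := ofReal_integral_sq (hf.isWeakDeriv hj).2
  have h2 : eLpNorm (weakDeriv j f) 2 volume ^ 2 ≤ ENNReal.ofReal ((M : ℝ) ^ 2) := by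
    rw [ENNReal.ofReal_pow M.coe_nonneg, ENNReal.ofReal_coe_nnreal]
    exact pow_le_pow_left' ((eLpNorm_weakDeriv_le_sobolevNorm hj f).trans h) 2
  rw [← h1] at h2
  exact (ENNReal.ofReal_le_ofReal_iff (by positivity)).1 h2

theorem integral_sq_add_le_of_sobolevNorm {m : ℕ} {f : ℝ → ℝ} {M N : ℝ≥0} (hf : MemH m f)
    (hm : 2 ≤ m) (h : sobolevNorm m f ≤ M) (hMN : M ≤ N) :
    (∫ x, weakDeriv 0 f x ^ 2) + ∫ x, weakDeriv 2 f x ^ 2 ≤ 2 * (N : ℝ) ^ 2 := by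
  have h' := h.trans (ENNReal.coe_le_coe.2 hMN)
  linarith [integral_sq_le_of_sobolevNorm hf (Nat.zero_le m) h',
    integral_sq_le_of_sobolevNorm hf hm h']

end FifthOrder

theorem theorem2 (b₁ b₂ b₃ : ℝ) :
    -- on a time of local existence, the constant depends only on the sizes of the initial data
    (∀ M₁ M₂ N₁ N₂ : ℝ≥0, ∃ T₀ : ℝ, 0 < T₀ ∧
      ∀ T : ℝ, 0 < T → T ≤ T₀ → ∀ a₀ : ℝ, 0 < a₀ → ∀ ε : ℝ, 0 < ε → ε ≤ 1 → ∀ Λ : ℝ≥0,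
        ∃ C : ℝ≥0, ∀ u₁ u₂ : ℝ → ℝ → ℝ,
          ContHWeighted 8 2 T u₁ → ContHWeighted 4 1 T u₂ →
          IsSolution b₁ b₂ b₃ T u₁ → IsSolution b₁ b₂ b₃ T u₂ →
          sobolevNorm 8 (u₁ 0) ≤ M₁ → sobolevNorm 4 (u₂ 0) ≤ M₂ →
          weightedNorm 2 (u₁ 0) ≤ N₁ → weightedNorm 1 (u₂ 0) ≤ N₂ →
          expEnergy a₀ (u₁ 0 - u₂ 0) ≤ Λ →
          (⨆ t ∈ Icc 0 T, expEnergy (decayRate a₀ ε t) (u₁ t - u₂ t)) ≤ C) ∧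
    -- on any time interval of existence, it depends on the sizes of the solutions there
    (∀ T : ℝ, 0 < T → ∀ M₁ M₂ N₁ N₂ : ℝ≥0, ∀ a₀ : ℝ, 0 < a₀ → ∀ ε : ℝ, 0 < ε → ε ≤ 1 →
      ∀ Λ : ℝ≥0, ∃ C : ℝ≥0, ∀ u₁ u₂ : ℝ → ℝ → ℝ,
        ContHWeighted 8 2 T u₁ → ContHWeighted 4 1 T u₂ →
        IsSolution b₁ b₂ b₃ T u₁ → IsSolution b₁ b₂ b₃ T u₂ →
        (∀ t ∈ Icc 0 T, sobolevNorm 8 (u₁ t) ≤ M₁ ∧ sobolevNorm 4 (u₂ t) ≤ M₂ ∧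
          weightedNorm 2 (u₁ t) ≤ N₁ ∧ weightedNorm 1 (u₂ t) ≤ N₂) →
        expEnergy a₀ (u₁ 0 - u₂ 0) ≤ Λ →
        (⨆ t ∈ Icc 0 T, expEnergy (decayRate a₀ ε t) (u₁ t - u₂ t)) ≤ C) := by
  constructor
  · intro M₁ M₂ N₁ N₂
    obtain ⟨T₀, B, hT₀, hB⟩ := exists_time_sobolev_bound b₁ b₂ b₃
      (m := 2 * ((max M₁ M₂ : ℝ≥0) : ℝ) ^ 2) (by positivity)
    refine ⟨T₀, hT₀, fun T hT hTT a₀ ha₀ ε hε hε1 Λ => ?_⟩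
    -- The sign of `B` is not recorded by `exists_time_sobolev_bound`, so `max B 0` takes its place.
    obtain ⟨C, hC⟩ := exists_constant b₁ b₂ b₃ (le_max_right B 0) hT.le ha₀ hε hε1 Λ
    refine ⟨C, fun u₁ u₂ hu₁ hu₂ hs₁ hs₂ hM₁ hM₂ _ _ hΛ => iSup₂_le ?_⟩
    have h0 : (0 : ℝ) ∈ Icc 0 T := ⟨le_rfl, hT.le⟩
    refine hC u₁ u₂ hu₁.of_eight hu₂ hs₁ hs₂ (fun t ht => ?_) (fun t ht => ?_) hΛ
    · exact (hB T u₁ hT hTT hu₁.of_eight hs₁ (integral_sq_add_le_of_sobolevNorm (hu₁.1 0 h0).1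
        (by norm_num) hM₁ (le_max_left _ _)) t ht).trans (le_max_left _ _)
    · exact (hB T u₂ hT hTT hu₂ hs₂ (integral_sq_add_le_of_sobolevNorm (hu₂.1 0 h0).1
        (by norm_num) hM₂ (le_max_right _ _)) t ht).trans (le_max_left _ _)
  · intro T hT M₁ M₂ N₁ N₂ a₀ ha₀ ε hε hε1 Λ
    obtain ⟨C, hC⟩ := exists_constant b₁ b₂ b₃ (B := 2 * ((max M₁ M₂ : ℝ≥0) : ℝ) ^ 2)
      (by positivity) hT.le ha₀ hε hε1 Λ
    refine ⟨C, fun u₁ u₂ hu₁ hu₂ hs₁ hs₂ hM hΛ => iSup₂_le ?_⟩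
    exact hC u₁ u₂ hu₁.of_eight hu₂ hs₁ hs₂
      (fun t ht => integral_sq_add_le_of_sobolevNorm (hu₁.1 t ht).1 (by norm_num) (hM t ht).1
        (le_max_left _ _))
      (fun t ht => integral_sq_add_le_of_sobolevNorm (hu₂.1 t ht).1 (by norm_num) (hM t ht).2.1
        (le_max_right _ _)) hΛ
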